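/- **Setting.** Let $X\in\mathbb R^{d\times n}$, $\beta\in\mathbb R^d$, $Y=\beta^TX$. Train $x\mapsto W^{(2)}W^{(1)}x$ ($W^{(1)}\in\mathbb R^{h\times d}$, $W^{(2)}\in\mathbb R^{1\times h}$) by gradient descent with step size $\eta$ on $L(W)=\frac1{2n}\|W^{(2)}W^{(1)}X-Y\|^2$. Let $F_t=W^{(2)}_tW^{(1)}_tX$ and $E_t=F_t-Y$. Let $\lambda_1\ge\dots\ge\lambda_n$ and $q_1,\dots,q_n$ be the eigenvalues and orthonormal eigenvectors of $X^TX$, and $p_1,\dots,p_n$ orthonormal eigenvectors of $XX^T$ with $XX^Tp_i=\lambda_ip_i$. Fix $a\in(0,1)$, $\gamma>1$, $K\ge1$ and a sequence $\rho_n\to0$. All constants hidden in $\Theta$ and $O$ in the assumptions are bounded by $K$, and all $o(1)$ quantities there by $\rho_n$ (write $A=\Theta(B)$ for $B/K\le A\le KB$). *Data and step size.* $\lambda_1=\Theta(n)$; for some $1\le k<n$: $\lambda_i\le\lambda_{i-1}/\gamma$ for $2\le i\le k$, $\lambda_i=\Theta(n^a)$ for $i>k$, and $|\lambda_k-\frac1{n-k}\sum_{i>k}\lambda_i|\le\rho_nn^a$;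 $\|Y\|=\Theta(\sqrt n)$; $|\langle\beta/\|\beta\|,p_i\rangle|=\Theta(1/\sqrt n)$ for all $i\le n$; $\eta=\Theta(n^{-(1-a)/2})$. *Rank one.* At some iteration $t_0$, $W^{(1)}_{t_0}X=uv_{t_0}^T$ and $W^{(2)}_{t_0}=c_{t_0}u^T$ with $\|u\|=1$, and $|F_{t_0}[i]|\le\rho_n|Y[i]|$ for all $i$. Put $c_t=W^{(2)}_tu$, $v_t^T=u^TW^{(1)}_tX$, $\alpha_t=\|v_t\|^2/c_t^2$, $\Delta_t=\frac{\lambda_1}nc_t^2-\frac2\eta$. *Bounds.* For all $t\ge t_0$: $\frac{\lambda_1}nc_t^2\le\frac K\eta$, $\frac{\lambda_i}nc_t^2<\frac1\eta$ for $i\ge2$, and $\|E_t\|^2\le Kn/\eta$. *Phases.* Iteration $t$ is in Phase I (resp. II) if $\Delta_t<0$ (resp. $\Delta_t>0$) and $c_{t+1}^2>c_t^2$; it is in Phase III (resp. IV) if $\Delta_t>0$ (resp. $\Delta_t<0$) and $\langle E_t,F_t\rangle>0$, which is implied by $c_{t+1}^2<c_t^2$. Let $t_0\le T_1<t_1$,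 where $T_1$ is the last iteration of Phase I, all iterations strictly between $T_1$ and $t_1$ are in Phase II, and $t_1$ is the first iteration of Phase III. Put $\delta_0=\|E_{T_1}\|/\|Y\|$, $\delta_1=|\langle Y,q_1\rangle|/\|Y\|$, $\delta_2=\max\{\delta_0,\sqrt{\delta_1}\}$, and assume $\delta_0\le\rho_n$. **(A)** For every $c_1>0$ there is $C>0$ depending only on $a,\gamma,K,c_1$ such that for all $n\ge N$, with $N$ depending on these and on the sequence $\rho$: if the iterations $t_1,\dots,t$ are all in Phase III, $|\langle E_t,q_1\rangle|\ge c_1\delta_2\|Y\|$ and $\Delta_t>C\max\{1,\frac1{\eta n^{a/4}}\}$, then $c_{t+1}^2<c_t^2$ and $\|v_{t+1}\|^2>\|v_t\|^2$. **(B)** There is $C>0$ depending only on $a,\gamma,K$ such that for every $c_2>0$ and all $n\ge N$, with $N$ depending on $a,\gamma,K,c_2$ and the sequence $\rho$, the following holds. Let the sign of $u$ be chosen so that $c_{T_1}>0$. Suppose that Phase III, started at $t_1$, is directly followed by Phase IV, and let $t_2$ be an iteration of this Phase IV, in particular its last one. If $\|E_{t_2}\|^2\le\|E_{t_1}\|^2$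 and $\Delta_{t_1}\ge c_2\delta_2/\eta$, then $\alpha_{t_2}>\alpha_{t_1}$, $\cos(v_{t_1},Y)\ge1-C\delta_2$ and $\cos(v_{t_2},Y)\ge1-C\delta_2$. -/

import Mathlib

open Filter Topology Matrix

noncomputable section

/-- The Euclidean norm of a vector of real coordinates. -/
def l2norm {m : ℕ} (x : Fin m → ℝ) : ℝ := ‖(WithLp.toLp 2 x : EuclideanSpace ℝ (Fin m))‖

/-- The cosine of the angle between two vectors. -/
def cosAngle {m : ℕ} (x y : Fin m → ℝ) : ℝ := x ⬝ᵥ y / (l2norm x * l2norm y)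

/-- The square loss `(1 / 2n) ‖W₂ W₁ X - Y‖²` of the two-layer linear network
`x ↦ W₂ W₁ x` with scalar output; the rows `W₂` and `Y` are vectors. -/
def sqLoss {n d h : ℕ} (X : Matrix (Fin d) (Fin n) ℝ) (Y : Fin n → ℝ)
    (W₁ : Matrix (Fin h) (Fin d) ℝ) (W₂ : Fin h → ℝ) : ℝ :=
  1 / (2 * (n : ℝ)) * l2norm (W₂ ᵥ* (W₁ * X) - Y) ^ 2

/-- The matrix of partial derivatives of the loss in the entries of the first layer. -/
def gradFirst {n d h : ℕ} (X : Matrix (Fin d) (Fin n) ℝ) (Y : Fin n → ℝ)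
    (W₁ : Matrix (Fin h) (Fin d) ℝ) (W₂ : Fin h → ℝ) : Matrix (Fin h) (Fin d) ℝ :=
  Matrix.of fun i j => deriv (fun s : ℝ => sqLoss X Y (W₁ + s • Matrix.single i j (1 : ℝ)) W₂) 0

/-- The vector of partial derivatives of the loss in the entries of the second layer. -/
def gradSecond {n d h : ℕ} (X : Matrix (Fin d) (Fin n) ℝ) (Y : Fin n → ℝ)
    (W₁ : Matrix (Fin h) (Fin d) ℝ) (W₂ : Fin h → ℝ) : Fin h → ℝ :=
  fun i => deriv (fun s : ℝ => sqLoss X Y W₁ (W₂ + s • Pi.single i (1 : ℝ))) 0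

/-- The raw data of a training run with `n` data points in dimension `d` and hidden width `h`.
All properties are stated separately below. Indices are zero-based, so the largest
eigenvalue `λ₁` of the data kernel is `lam 0` and `q₁` is `q 0`. -/
structure Run (n d h : ℕ) where
  /-- data matrix -/
  X : Matrix (Fin d) (Fin n) ℝ
  /-- coefficients of the linear target -/
  β : Fin d → ℝ
  /-- learning rate -/
  η : ℝ
  /-- eigenvalues of `Xᵀ X` -/
  lam : Fin n → ℝ
  /-- eigenvectors of `Xᵀ X` -/
  q : Fin n → Fin n → ℝ
  /-- eigenvectors of `X Xᵀ` -/
  p : Fin n → Fin d → ℝ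
  /-- first layer at each iteration -/
  W₁ : ℕ → Matrix (Fin h) (Fin d) ℝ
  /-- second layer at each iteration -/
  W₂ : ℕ → Fin h → ℝ
  /-- direction of the rank-one structure of the weights -/
  u : Fin h → ℝ

namespace Run

variable {n d h : ℕ}

/-- The labels `Y = βᵀ X`. -/
def Y (R : Run n d h) : Fin n → ℝ := R.β ᵥ* R.X

/-- The network output `F_t = W₂ W₁ X`. -/
def F (R : Run n d h) (t : ℕ) : Fin n → ℝ := R.W₂ t ᵥ* (R.W₁ t * R.X)

/-- The error `E_t = F_t - Y`. -/
def E (R : Run n d h) (t : ℕ) : Fin n → ℝ := R.F t - R.Y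

/-- The coefficient `c_t` of the second layer along `u`: if `W₂ = c uᵀ` with `u` a unit vector,
this is `c`. -/
def c (R : Run n d h) (t : ℕ) : ℝ := R.W₂ t ⬝ᵥ R.u

/-- The vector `v_t`: if `W₁ X = u vᵀ` with `u` a unit vector, this is `v`. -/
def v (R : Run n d h) (t : ℕ) : Fin n → ℝ := R.u ᵥ* (R.W₁ t * R.X)

/-- The ratio `α_t = ‖v_t‖² / c_t²`. -/
def α (R : Run n d h) (t : ℕ) : ℝ := l2norm (R.v t) ^ 2 / R.c t ^ 2

/-- The approximate sharpness `(λ₁ / n) c_t²`. -/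
def sharpness [NeZero n] (R : Run n d h) (t : ℕ) : ℝ := R.lam 0 / n * R.c t ^ 2

/-- The sharpness excess `Δ_t = (λ₁ / n) c_t² - 2 / η`. -/
def excess [NeZero n] (R : Run n d h) (t : ℕ) : ℝ := R.sharpness t - 2 / R.η

/-- `δ₀ = ‖E_T‖ / ‖Y‖`, where `T` is the end of Phase I. -/
def δ₀ (R : Run n d h) (T : ℕ) : ℝ := l2norm (R.E T) / l2norm R.Y

/-- `δ₁ = |cos (Y, q₁)|`. -/
def δ₁ [NeZero n] (R : Run n d h) : ℝ := |R.Y ⬝ᵥ R.q 0| / l2norm R.Y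

/-- `δ₂ = max (δ₀, √δ₁)`. -/
def δ₂ [NeZero n] (R : Run n d h) (T : ℕ) : ℝ := max (R.δ₀ T) (Real.sqrt R.δ₁)

/-- The weights are trained by gradient descent on the square loss with step size `η`. -/
def IsGD (R : Run n d h) : Prop :=
  ∀ t, R.W₁ (t + 1) = R.W₁ t - R.η • gradFirst R.X R.Y (R.W₁ t) (R.W₂ t) ∧
    R.W₂ (t + 1) = R.W₂ t - R.η • gradSecond R.X R.Y (R.W₁ t) (R.W₂ t)

/-- `lam`, `q` are the non-increasing eigenvalues and orthonormal eigenvectors of `Xᵀ X`, and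
`p` are orthonormal eigenvectors of `X Xᵀ` for the same eigenvalues. -/
structure IsSpectral (R : Run n d h) : Prop where
  antitone : Antitone R.lam
  q_orthonormal : Orthonormal ℝ fun i => (WithLp.toLp 2 (R.q i) : EuclideanSpace ℝ (Fin n))
  q_eigen : ∀ i, (R.Xᵀ * R.X) *ᵥ R.q i = R.lam i • R.q i
  p_orthonormal : Orthonormal ℝ fun i => (WithLp.toLp 2 (R.p i) : EuclideanSpace ℝ (Fin d))
  p_eigen : ∀ i, (R.X * R.Xᵀ) *ᵥ R.p i = R.lam i • R.p i

/-- The assumptions on the data. All `Θ` and `O` constants are bounded by `K`, and all quantities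
that tend to zero are bounded by `ρ`. In one-based notation, the eigenvalues of index at most `k`
decay at least geometrically with ratio `γ`, those of index greater than `k` are of order `n ^ a`,
and `λ_k` exceeds the mean of the latter by at most `ρ n ^ a`. -/
structure DataAssumption [NeZero n] (R : Run n d h) (a γ K ρ : ℝ) : Prop where
  top : (n : ℝ) / K ≤ R.lam 0 ∧ R.lam 0 ≤ K * n
  spectrum : ∃ k : ℕ, 1 ≤ k ∧ k < n ∧
    (∀ i j : Fin n, (i : ℕ) + 1 = j → (j : ℕ) < k → R.lam j ≤ R.lam i / γ) ∧
    (∀ i : Fin n, k ≤ (i : ℕ) → (n : ℝ) ^ a / K ≤ R.lam i ∧ R.lam i ≤ K * (n : ℝ) ^ a) ∧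
    (∀ i : Fin n, (i : ℕ) + 1 = k →
      |R.lam i - (∑ j : Fin n, if k ≤ (j : ℕ) then R.lam j else 0) / ((n : ℝ) - k)| ≤ ρ * (n : ℝ) ^ a)
  label : Real.sqrt n / K ≤ l2norm R.Y ∧ l2norm R.Y ≤ K * Real.sqrt n
  target : ∀ i, 1 / (K * Real.sqrt n) ≤ |R.β ⬝ᵥ R.p i| / l2norm R.β ∧
    |R.β ⬝ᵥ R.p i| / l2norm R.β ≤ K / Real.sqrt n

/-- The learning rate has order `n ^ (-(1 - a) / 2)`. -/
def RateAssumption (R : Run n d h) (a K : ℝ) : Prop :=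
  (n : ℝ) ^ (-(1 - a) / 2) / K ≤ R.η ∧ R.η ≤ K * (n : ℝ) ^ (-(1 - a) / 2)

/-- At iteration `t₀` the weights have rank-one structure `W₁ X = u vᵀ`, `W₂ = c uᵀ` with a unit
vector `u`, and the output is small compared with the labels. -/
structure RankOneAssumption (R : Run n d h) (ρ : ℝ) (t₀ : ℕ) : Prop where
  unit : l2norm R.u = 1
  first : R.W₁ t₀ * R.X = Matrix.vecMulVec R.u (R.v t₀)
  second : R.W₂ t₀ = R.c t₀ • R.u
  small : ∀ i, |R.F t₀ i| ≤ ρ * |R.Y i|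

/-- Upper bounds on the sharpness and on the remaining eigenvalues during training. -/
def SharpnessAssumption [NeZero n] (R : Run n d h) (K : ℝ) (t₀ : ℕ) : Prop :=
  ∀ t, t₀ ≤ t → R.sharpness t ≤ K / R.η ∧ ∀ i, i ≠ 0 → R.lam i / n * R.c t ^ 2 < 1 / R.η

/-- The loss does not diverge too much, and is small at the end `T₁` of Phase I. -/
def LossAssumption (R : Run n d h) (K ρ : ℝ) (t₀ T₁ : ℕ) : Prop :=
  (∀ t, t₀ ≤ t → l2norm (R.E t) ^ 2 ≤ K * (n / R.η)) ∧ R.δ₀ T₁ ≤ ρ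

/-- All standing assumptions on a run. -/
structure Assumptions [NeZero n] (R : Run n d h) (a γ K ρ : ℝ) (t₀ T₁ : ℕ) : Prop where
  gd : R.IsGD
  spectral : R.IsSpectral
  data : R.DataAssumption a γ K ρ
  rate : R.RateAssumption a K
  rankOne : R.RankOneAssumption ρ t₀
  sharp : R.SharpnessAssumption K t₀
  loss : R.LossAssumption K ρ t₀ T₁

/-- Phase I: the sharpness is below `2 / η` and `c_t²` increases. -/
def PhaseI [NeZero n] (R : Run n d h) (t : ℕ) : Prop :=
  R.sharpness t < 2 / R.η ∧ R.c t ^ 2 < R.c (t + 1) ^ 2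

/-- Phase II: the sharpness is above `2 / η` and `c_t²` increases. -/
def PhaseII [NeZero n] (R : Run n d h) (t : ℕ) : Prop :=
  2 / R.η < R.sharpness t ∧ R.c t ^ 2 < R.c (t + 1) ^ 2

/-- Phase III: the sharpness is above `2 / η` and is in its decreasing regime `⟨E_t, F_t⟩ > 0`.
Under the rank-one structure
`c_{t+1}² = c_t² - (2η/n) ⟨E_t, F_t⟩ + (η/n)² ⟨E_t, v_t⟩²`,
so every iteration with `c_{t+1}² < c_t²` satisfies `⟨E_t, F_t⟩ > 0`; that `c_t²` really decreases
is not part of the definition. -/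
def PhaseIII [NeZero n] (R : Run n d h) (t : ℕ) : Prop :=
  2 / R.η < R.sharpness t ∧ 0 < R.E t ⬝ᵥ R.F t

/-- Phase IV: the sharpness is below `2 / η` and still in its decreasing regime. -/
def PhaseIV [NeZero n] (R : Run n d h) (t : ℕ) : Prop :=
  R.sharpness t < 2 / R.η ∧ 0 < R.E t ⬝ᵥ R.F t

/-- `T₁` is the last iteration of Phase I, it is followed by Phase II, and `t₁` is the first
iteration of Phase III. -/
def StartsPhaseIII [NeZero n] (R : Run n d h) (t₀ T₁ t₁ : ℕ) : Prop :=
  t₀ ≤ T₁ ∧ T₁ < t₁ ∧ R.PhaseI T₁ ∧ (∀ t, T₁ < t → t < t₁ → R.PhaseII t) ∧ R.PhaseIII t₁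

/-- Phase III has started at `t₁` and has lasted up to and including `t`. -/
def InPhaseIII [NeZero n] (R : Run n d h) (t₁ t : ℕ) : Prop :=
  t₁ ≤ t ∧ ∀ s, t₁ ≤ s → s ≤ t → R.PhaseIII s

/-- Phase III started at `t₁` and ended at some `T₃`, and Phase IV followed it and has lasted up to
and including `t₂`. -/
def InPhaseIV [NeZero n] (R : Run n d h) (t₁ t₂ : ℕ) : Prop :=
  ∃ T₃, R.InPhaseIII t₁ T₃ ∧ T₃ < t₂ ∧ ∀ s, T₃ < s → s ≤ t₂ → R.PhaseIV s

end Run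

end

set_option linter.unusedSectionVars false

/-! Gradient descent preserves the structure `W₁ X = u vᵀ`, `W₂ = c uᵀ`, so a run is a recursion for
`c` and for the coordinates of the error in the eigenbasis of `XᵀX`. Put σ = ηλ₁c²/n and ℓ_i =
λ_i/λ₁, and let e, y be the coordinates of E, Y divided by ‖Y‖. Then σ' = σ(1-g)² and e_i' =
(1-g)(1-ℓ_iσ)e_i - g y_i with g = (M/σ)⟨e, e+y⟩. Here M = O(η²) and M = O(μ), where μ, of order
n^(a-1), bounds all ℓ_i from below. The leading mode is neutral at σ = 2; the others are damped,
because ℓ_iσ ≤ 1 for them.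

Let T be the time from the end of Phase I to the start of Phase III. Before T the correlation ⟨e,
e+y⟩ is negative. This makes the norm of the non-leading error at most b_t = δ₀(1-μ/8)^t + O(δ₁²)
(`Sharpens.rest_le`), the squared leading mode O(b_t + δ₁²) (`Sharpens.lead_sq_le`), and the growth
of σ per step O(M b_t) (`Sharpens.neg_g_le`).

(A) In Phase III, 0 < g ≤ 1/4, so c² falls. Up to a positive factor, the change of ‖v‖² is the sum
of ℓ_iσ(ℓ_iσe_i² - 2e_i(e_i+y_i)). The leading summand is σ((σ-2)e² - 2ey). The others are
controlled because a large excess can only be built up slowly: with m = max(η, n^(-a/4)), an excess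
of order m forces 1/T = O(mδ₂), and over that time the modes, weighted by ℓ_i, have decayed like
δ₂/T. They contribute O(mδ₂²), less than (σ-2)e² (`Sharpens.first_layer_grows`).

(B) Since F = cv, α = ‖F‖²/c⁴, and ‖F‖² = ‖Y‖² + 2⟨E,F⟩ - ‖E‖². Hence ‖F‖² loses at most 2⟨E,F⟩ at
t₁, while c⁴ falls by a relative amount of order c₂δ₂. It remains to see that ⟨E,F⟩ at t₁ is
o(δ₂)‖Y‖² (`Sharpens.corr_last_le`): one step earlier it was negative, and one step near σ = 2
mostly flips the sign of the leading mode and hardly moves the rest. The cosines follow from ‖E‖² =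
O(δ₂)‖Y‖² at t₁ once c is known not to change sign; in Phase IV this needs σ ≥ 1, which an energy
argument gives (`Sharpens.one_le_σ_of_fall`). -/

/-! ### Elementary inequalities. -/

theorem sum_abs_mul_abs_le {ι : Type*} (s : Finset ι) (f g : ι → ℝ) {A B : ℝ} (hA : 0 ≤ A)
    (hB : 0 ≤ B) (hf : ∑ i ∈ s, f i ^ 2 ≤ A ^ 2) (hg : ∑ i ∈ s, g i ^ 2 ≤ B ^ 2) :
    ∑ i ∈ s, |f i| * |g i| ≤ A * B := by
  have h := Finset.sum_mul_sq_le_sq_mul_sq s (fun i => |f i|) (fun i => |g i|)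
  simp only [sq_abs] at h
  refine abs_le_of_sq_le_sq' ?_ (by positivity) |>.2
  calc _ ≤ _ := h
    _ ≤ A ^ 2 * B ^ 2 := mul_le_mul hf hg (Finset.sum_nonneg fun i _ => sq_nonneg _) (by positivity)
    _ = _ := by ring

theorem abs_sum_mul_le {ι : Type*} (s : Finset ι) (f g : ι → ℝ) {A B : ℝ} (hA : 0 ≤ A)
    (hB : 0 ≤ B) (hf : ∑ i ∈ s, f i ^ 2 ≤ A ^ 2) (hg : ∑ i ∈ s, g i ^ 2 ≤ B ^ 2) :
    |∑ i ∈ s, f i * g i| ≤ A * B :=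
  (Finset.abs_sum_le_sum_abs _ _).trans <| by
    simpa only [abs_mul] using sum_abs_mul_abs_le s f g hA hB hf hg

/-- Bernoulli bounds `t * x` by `(1 + x) ^ t`, and `(1 + x) * (1 - x) ≤ 1`. This turns geometric
decay at an unknown rate `x`, weighted by `x`, into a rate `1 / t` uniform in `x`. -/
theorem natCast_mul_mul_one_sub_pow_le {x : ℝ} (h0 : 0 ≤ x) (h1 : x ≤ 1) (t : ℕ) :
    t * x * (1 - x) ^ t ≤ 1 := by
  have hb : 1 + (t : ℝ) * x ≤ (1 + x) ^ t := one_add_mul_le_pow (by linarith) t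
  have hp : 0 ≤ (1 - x) ^ t := pow_nonneg (by linarith) t
  calc t * x * (1 - x) ^ t ≤ (1 + x) ^ t * (1 - x) ^ t := by
        gcongr; linarith
    _ = (1 - x ^ 2) ^ t := by rw [← mul_pow]; ring_nf
    _ ≤ 1 := pow_le_one₀ (by nlinarith) (by nlinarith)

/-! ### The recursion in normalized coordinates. -/

/-- Gradient descent on a rank-one two-layer linear network in normalized coordinates: the error
`e t` and the target `y` in the eigenbasis of the kernel, divided by the norm of the labels, the
relative eigenvalues `ℓ` with `ℓ o = 1`, and the sharpness `σ` in units of `1 / η`. -/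
structure ModeSystem (ι : Type*) where
  o : ι
  ℓ : ι → ℝ
  y : ι → ℝ
  M : ℝ
  e : ℕ → ι → ℝ
  σ : ℕ → ℝ

namespace ModeSystem

variable {ι : Type*} [Fintype ι] [DecidableEq ι]

/-- The correlation `⟨E, F⟩` of error and output. -/
def corr (S : ModeSystem ι) (t : ℕ) : ℝ := ∑ i, S.e t i * (S.e t i + S.y i)

/-- The relative decrease of `c` in one step. -/
noncomputable def g (S : ModeSystem ι) (t : ℕ) : ℝ := S.M / S.σ t * S.corr t

/-- The squared norm of the error in the modes other than `o`. -/
def rest (S : ModeSystem ι) (t : ℕ) : ℝ := ∑ i ∈ Finset.univ.erase S.o, S.e t i ^ 2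

/-- The recursion up to time `N`, with bounds on all parameters. -/
structure Valid (S : ModeSystem ι) (L η μ : ℝ) (N : ℕ) : Prop where
  one_le : 1 ≤ L
  η_pos : 0 < η
  η_small : 100 * L ^ 4 * η ≤ 1
  M_pos : 0 < S.M
  M_le : S.M ≤ L * η ^ 2
  M_le' : S.M ≤ L * μ
  μ_pos : 0 < μ
  ℓ_o : S.ℓ S.o = 1
  μ_le : ∀ i, μ ≤ S.ℓ i
  ℓ_le : ∀ i, S.ℓ i ≤ 1
  y_unit : ∑ i, S.y i ^ 2 = 1
  σ_pos : ∀ t ≤ N, 0 < S.σ t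
  σ_le : ∀ t, S.σ t ≤ L
  damp : ∀ t i, i ≠ S.o → S.ℓ i * S.σ t ≤ 1
  loss : ∀ t, ∑ i, S.e t i ^ 2 ≤ L / η
  e_succ : ∀ t ≤ N, ∀ i, S.e (t + 1) i =
    (1 - S.g t) * (1 - S.ℓ i * S.σ t) * S.e t i - S.g t * S.y i
  σ_succ : ∀ t ≤ N, S.σ (t + 1) = S.σ t * (1 - S.g t) ^ 2

/-- The sharpness rises from below to above `2 / η` and keeps growing until time `T`, when it
starts to fall; the error is at most `δ` at the beginning. -/
structure Sharpens (S : ModeSystem ι) (L δ : ℝ) (T : ℕ) : Prop where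
  T_pos : 0 < T
  δ_nonneg : 0 ≤ δ
  δ_small : 100 * L ^ 4 * δ ≤ 1
  y_small : 100 * L ^ 4 * |S.y S.o| ≤ 1
  start_error : ∑ i, S.e 0 i ^ 2 ≤ δ ^ 2
  start_lt : S.σ 0 < 2
  start_grow : S.σ 0 < S.σ 1
  grow : ∀ t, 0 < t → t < T → 2 < S.σ t ∧ S.σ t < S.σ (t + 1)
  last : 2 < S.σ T ∧ 0 < S.corr T

variable {S : ModeSystem ι} {L η μ δ : ℝ} {N T : ℕ}

theorem corr_eq (S : ModeSystem ι) (t : ℕ) : S.corr t =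
    S.e t S.o * (S.e t S.o + S.y S.o) +
      ∑ i ∈ Finset.univ.erase S.o, S.e t i * (S.e t i + S.y i) :=
  (Finset.add_sum_erase _ _ (Finset.mem_univ _)).symm

theorem sum_sq_eq (S : ModeSystem ι) (t : ℕ) : ∑ i, S.e t i ^ 2 = S.e t S.o ^ 2 + S.rest t :=
  (Finset.add_sum_erase _ (fun i => S.e t i ^ 2) (Finset.mem_univ _)).symm

theorem rest_nonneg (S : ModeSystem ι) (t : ℕ) : 0 ≤ S.rest t :=
  Finset.sum_nonneg fun _ _ => sq_nonneg _

theorem rest_le_sum_sq (S : ModeSystem ι) (t : ℕ) : S.rest t ≤ ∑ i, S.e t i ^ 2 := by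
  rw [sum_sq_eq]; nlinarith [sq_nonneg (S.e t S.o)]

theorem Valid.sum_erase_y_sq_le (hV : S.Valid L η μ N) :
    ∑ i ∈ Finset.univ.erase S.o, S.y i ^ 2 ≤ 1 ^ 2 := by
  have h := hV.y_unit
  rw [← Finset.add_sum_erase _ _ (Finset.mem_univ S.o)] at h
  nlinarith [sq_nonneg (S.y S.o)]

theorem Valid.abs_corr_le (hV : S.Valid L η μ N) {B : ℝ} (hB : 0 ≤ B) {t : ℕ}
    (h : ∑ i, S.e t i ^ 2 ≤ B ^ 2) : |S.corr t| ≤ B ^ 2 + B := by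
  have h1 := abs_sum_mul_le Finset.univ (S.e t) S.y hB zero_le_one h (by simp [hV.y_unit])
  have h2 : S.corr t = ∑ i, S.e t i ^ 2 + ∑ i, S.e t i * S.y i := by
    rw [corr, ← Finset.sum_add_distrib]; exact Finset.sum_congr rfl fun i _ => by ring
  have h3 : 0 ≤ ∑ i, S.e t i ^ 2 := Finset.sum_nonneg fun _ _ => sq_nonneg _
  rw [h2, abs_le]
  rw [abs_le] at h1
  constructor <;> linarith

theorem Valid.L_div_η (hV : S.Valid L η μ N) : 1 ≤ L / η := by
  rw [le_div_iff₀ hV.η_pos]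
  have h1 : 1 ≤ L ^ 4 := one_le_pow₀ hV.one_le
  nlinarith [hV.η_small, hV.η_pos, hV.one_le]

theorem Valid.abs_corr_le_loss (hV : S.Valid L η μ N) (t : ℕ) : |S.corr t| ≤ 2 * (L / η) := by
  have h1 := hV.L_div_η
  have h2 := hV.abs_corr_le (Real.sqrt_nonneg (L / η)) (t := t)
    (by rw [Real.sq_sqrt (by linarith)]; exact hV.loss t)
  rw [Real.sq_sqrt (by linarith)] at h2
  have : √(L / η) ≤ L / η := (Real.sqrt_le_left (by linarith)).2 (by nlinarith)
  linarith

/-- The factor M = O(η²) meets a correlation that the loss bound only allows to be O(1/η). -/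
theorem Valid.abs_g_le (hV : S.Valid L η μ N) {t : ℕ} (hσ : 1 ≤ S.σ t) :
    |S.g t| ≤ 2 * L ^ 2 * η := by
  have hη := hV.η_pos
  have hL := hV.one_le
  have hM := hV.M_pos
  have h1 : S.M / S.σ t ≤ L * η ^ 2 := (div_le_self hM.le hσ).trans hV.M_le
  have h0 : 0 ≤ S.M / S.σ t := by positivity
  rw [g, abs_mul, abs_of_nonneg h0]
  calc _ ≤ L * η ^ 2 * (2 * (L / η)) :=
        mul_le_mul h1 (hV.abs_corr_le_loss t) (abs_nonneg _) (by positivity)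
    _ = _ := by field_simp

theorem Valid.abs_g_le_quarter (hV : S.Valid L η μ N) {t : ℕ} (hσ : 1 ≤ S.σ t) :
    |S.g t| ≤ 1 / 4 := by
  have h1 := hV.abs_g_le hσ
  have h2 : L ^ 2 ≤ L ^ 4 := pow_le_pow_right₀ hV.one_le (by norm_num)
  nlinarith [hV.η_small, hV.η_pos]

theorem mul_pow_mul_le_one {L : ℝ} (h : 1 ≤ L) {x : ℝ} (hx : 0 ≤ x) {C : ℝ} (hC : 0 ≤ C) (k : ℕ)
    (hk : k ≤ 4) (hs : C * L ^ 4 * x ≤ 1) : C * L ^ k * x ≤ 1 := by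
  have : L ^ k ≤ L ^ 4 := pow_le_pow_right₀ h hk
  refine le_trans ?_ hs
  gcongr

/-! ### Growth of the sharpness (end of Phase I and Phase II). -/

theorem Sharpens.σ_one (hS : S.Sharpens L δ T) : 2 < S.σ 1 := by
  rcases Nat.lt_or_ge 1 T with h | h
  · exact (hS.grow 1 one_pos h).1
  · have : T = 1 := le_antisymm h hS.T_pos
    exact this ▸ hS.last.1

/-- A very small `σ 0` could pass 2 in one step only through a huge `g`. The output at time 1 has
squared norm at least (1-g)²/4, while the loss bound allows only 4L/η, so (1-g)² ≤ 16L/η and `σ 0`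
is at least of order η. Then M/σ = O(η), hence `|g| ≤ 1/4`, and one step multiplies σ by at most
25/16. -/
theorem Sharpens.one_le_σ_zero (hS : S.Sharpens L δ T) (hV : S.Valid L η μ N) : 1 ≤ S.σ 0 := by
  have hη := hV.η_pos
  have hL := hV.one_le
  have hM := hV.M_pos
  have hσ := hV.σ_pos 0 (Nat.zero_le _)
  have hδ : 100 * δ ≤ 1 := by
    simpa using mul_pow_mul_le_one hL hS.δ_nonneg (by norm_num) 0 (by norm_num) hS.δ_small
  have hδ2 : δ ^ 2 ≤ 1 / 16 := by nlinarith [hS.δ_nonneg]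
  have hlow : (1 - S.g 0) ^ 2 * (1 / 4) ≤ ∑ i, (S.e 1 i + S.y i) ^ 2 := by
    have h1 : ∀ i, (1 - S.g 0) ^ 2 * (S.y i ^ 2 / 2 - S.e 0 i ^ 2) ≤ (S.e 1 i + S.y i) ^ 2 := by
      intro i
      have hr0 : 0 ≤ S.ℓ i * S.σ 0 := mul_nonneg (hV.μ_pos.le.trans (hV.μ_le i)) hσ.le
      have hr2 : S.ℓ i * S.σ 0 ≤ 2 := by
        nlinarith [hV.ℓ_le i, hS.start_lt]
      have he : S.e 1 i + S.y i = (1 - S.g 0) * (S.y i + (1 - S.ℓ i * S.σ 0) * S.e 0 i) := by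
        rw [show (1 : ℕ) = 0 + 1 from rfl, hV.e_succ 0 (Nat.zero_le _)]; ring
      rw [he, mul_pow]
      refine mul_le_mul_of_nonneg_left ?_ (sq_nonneg _)
      have : ((1 - S.ℓ i * S.σ 0) * S.e 0 i) ^ 2 ≤ S.e 0 i ^ 2 := by
        rw [mul_pow]
        exact mul_le_of_le_one_left (sq_nonneg _) (by nlinarith)
      nlinarith [sq_nonneg (S.y i + 2 * ((1 - S.ℓ i * S.σ 0) * S.e 0 i))]
    refine le_trans ?_ (Finset.sum_le_sum fun i _ => h1 i)
    rw [← Finset.mul_sum, Finset.sum_sub_distrib, ← Finset.sum_div, hV.y_unit]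
    refine mul_le_mul_of_nonneg_left ?_ (sq_nonneg _)
    linarith [hS.start_error]
  have hup : ∑ i, (S.e 1 i + S.y i) ^ 2 ≤ 4 * (L / η) := by
    have h1 : ∀ i, (S.e 1 i + S.y i) ^ 2 ≤ 2 * S.e 1 i ^ 2 + 2 * S.y i ^ 2 := fun i => by
      nlinarith [sq_nonneg (S.e 1 i - S.y i)]
    refine (Finset.sum_le_sum fun i _ => h1 i).trans ?_
    rw [Finset.sum_add_distrib, ← Finset.mul_sum, ← Finset.mul_sum, hV.y_unit]
    linarith [hV.loss 1, hV.L_div_η]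
  have hsucc := hV.σ_succ 0 (Nat.zero_le _)
  have h2 := hS.σ_one
  rw [zero_add] at hsucc
  rw [hsucc] at h2
  have hlarge : η ≤ 8 * L * S.σ 0 := by
    have : (1 - S.g 0) ^ 2 * η ≤ 16 * L := by
      have : (1 - S.g 0) ^ 2 ≤ 16 * L / η := by
        have := hlow.trans hup
        rw [mul_div_assoc]; linarith
      rwa [le_div_iff₀ hη] at this
    nlinarith
  have hg : |S.g 0| ≤ 1 / 4 := by
    have hc := hV.abs_corr_le hS.δ_nonneg hS.start_error
    have hc' : |S.corr 0| ≤ 2 * δ := by nlinarith [hS.δ_nonneg]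
    have hm : S.M / S.σ 0 ≤ 8 * L ^ 2 * η := by
      rw [div_le_iff₀ hσ]
      nlinarith [hV.M_le, mul_le_mul_of_nonneg_left hlarge (by positivity : 0 ≤ L * η)]
    have hm0 : 0 ≤ S.M / S.σ 0 := by positivity
    rw [g, abs_mul, abs_of_nonneg hm0]
    have h3 := mul_pow_mul_le_one hL hη.le (by norm_num) 2 (by norm_num) hV.η_small
    have h4 : S.M / S.σ 0 ≤ 1 := by nlinarith
    nlinarith [abs_nonneg (S.corr 0)]
  rw [abs_le] at hg
  nlinarith

/-- A value of `g` in [0, 1/4] would make σ fall, so growth of σ determines the sign of `g` and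
thereby of the correlation. -/
theorem Sharpens.growth (hS : S.Sharpens L δ T) (hV : S.Valid L η μ N) (hN : T ≤ N) {t : ℕ}
    (ht : t < T) : 1 ≤ S.σ t ∧ -(1 / 4) ≤ S.g t ∧ S.g t < 0 ∧ S.corr t < 0 := by
  have hσ : 1 ≤ S.σ t := by
    rcases Nat.eq_zero_or_pos t with rfl | h
    · exact hS.one_le_σ_zero hV
    · linarith [(hS.grow t h ht).1]
  have hgr : S.σ t < S.σ (t + 1) := by
    rcases Nat.eq_zero_or_pos t with rfl | h
    · exact hS.start_grow
    · exact (hS.grow t h ht).2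
  have hg := abs_le.1 (hV.abs_g_le_quarter hσ)
  rw [hV.σ_succ t (by omega)] at hgr
  have hneg : S.g t < 0 := by
    by_contra h
    have : (1 - S.g t) ^ 2 ≤ 1 := by nlinarith [hg.2]
    nlinarith
  refine ⟨hσ, by linarith [hg.1], hneg, ?_⟩
  by_contra h
  have : 0 ≤ S.g t := mul_nonneg (div_nonneg hV.M_pos.le (by linarith)) (not_lt.1 h)
  linarith

theorem sum_output_sq (hV : S.Valid L η μ N) (t : ℕ) :
    ∑ i, (S.e t i + S.y i) ^ 2 = 1 + 2 * S.corr t - ∑ i, S.e t i ^ 2 := by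
  rw [← hV.y_unit, corr, Finset.mul_sum, ← Finset.sum_add_distrib, ← Finset.sum_sub_distrib]
  exact Finset.sum_congr rfl fun i _ => by ring

theorem Valid.M_small (hV : S.Valid L η μ N) : S.M ≤ 1 / 4 := by
  have h1 := mul_pow_mul_le_one hV.one_le hV.η_pos.le (by norm_num) 1 (by norm_num) hV.η_small
  have h2 := mul_pow_mul_le_one hV.one_le hV.η_pos.le (by norm_num) 0 (by norm_num) hV.η_small
  nlinarith [hV.M_le, hV.η_pos, hV.one_le]

/-- One step of a damped mode with r = ℓσ, h = -g and output f = e + y. The cross term e·f is kept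
exact, because its sum over the modes is part of the correlation, whose sign is known. -/
theorem sq_mode_step_le {r h e f : ℝ} (hr0 : 0 ≤ r) (hr1 : r ≤ 1) (hh0 : 0 ≤ h) (hh : h ≤ 1 / 4) :
    ((1 - r) * e + h * (f - r * e)) ^ 2 ≤
      (1 - r / 4) * e ^ 2 + 2 * h * (e * f) + 4 * h ^ 2 * f ^ 2 := by
  have h1 : 0 ≤ (r * e + 2 * h * f) ^ 2 := sq_nonneg _
  have h2 : 0 ≤ h ^ 2 * (f + r * e) ^ 2 := by positivity
  have h3 : 0 ≤ h * (r * (1 - r)) * e ^ 2 :=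
    mul_nonneg (mul_nonneg hh0 (mul_nonneg hr0 (by linarith))) (sq_nonneg _)
  have h4 : r ^ 2 * e ^ 2 ≤ r * e ^ 2 := mul_le_mul_of_nonneg_right (by nlinarith) (sq_nonneg _)
  have h5 : h ^ 2 * (r ^ 2 * e ^ 2) ≤ 1 / 16 * (r * e ^ 2) :=
    mul_le_mul (by nlinarith) h4 (by positivity) (by norm_num)
  have h6 : 0 ≤ r * e ^ 2 := by positivity
  nlinarith

/-- The correlation equals -hσ/M, and its leading part is at least -y²/4, so the cross terms of
`sq_mode_step_le` sum to at most -2h²/M + hy²/2. Half of the negative term absorbs 4h² since M ≤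
1/4; maximizing what is left over h gives order M y⁴. -/
theorem Sharpens.rest_succ_le (hS : S.Sharpens L δ T) (hV : S.Valid L η μ N) (hN : T ≤ N) {t : ℕ}
    (ht : t < T) : S.rest (t + 1) ≤ (1 - μ / 4) * S.rest t + S.M * |S.y S.o| ^ 4 := by
  obtain ⟨hσ, hg4, hg0, hc⟩ := hS.growth hV hN ht
  have hM := hV.M_pos
  have hM4 := hV.M_small
  set h := -S.g t with hh
  have hmode : ∀ i ∈ Finset.univ.erase S.o, S.e (t + 1) i ^ 2 ≤ (1 - μ / 4) * S.e t i ^ 2 +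
      2 * h * (S.e t i * (S.e t i + S.y i)) + 4 * h ^ 2 * (S.e t i + S.y i) ^ 2 := by
    intro i hi
    have hr0 : μ ≤ S.ℓ i * S.σ t := by nlinarith [hV.μ_le i, hV.μ_pos]
    have h1 := sq_mode_step_le (e := S.e t i) (f := S.e t i + S.y i) (hV.μ_pos.le.trans hr0)
      (hV.damp t i (Finset.ne_of_mem_erase hi)) (by linarith : 0 ≤ h) (by linarith)
    have h2 : S.e (t + 1) i = (1 - S.ℓ i * S.σ t) * S.e t i +
        h * (S.e t i + S.y i - S.ℓ i * S.σ t * S.e t i) := by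
      rw [hV.e_succ t (by omega), hh]; ring
    rw [h2]
    nlinarith [mul_le_mul_of_nonneg_right hr0 (sq_nonneg (S.e t i))]
  have hsum := Finset.sum_le_sum hmode
  rw [Finset.sum_add_distrib, Finset.sum_add_distrib, ← Finset.mul_sum, ← Finset.mul_sum,
    ← Finset.mul_sum] at hsum
  have hF : ∑ i ∈ Finset.univ.erase S.o, (S.e t i + S.y i) ^ 2 ≤ 1 := by
    refine (Finset.sum_le_sum_of_subset_of_nonneg (Finset.erase_subset _ _)
      fun i _ _ => sq_nonneg _).trans ?_
    rw [sum_output_sq hV]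
    have : 0 ≤ ∑ i, S.e t i ^ 2 := Finset.sum_nonneg fun _ _ => sq_nonneg _
    linarith
  have hgc : S.corr t * S.M = -h * S.σ t := by
    rw [hh, g]; field_simp
  have hc2 : S.corr t ≤ -h / S.M := by
    rw [le_div_iff₀ hM, hgc]; nlinarith
  have hce := S.corr_eq t
  set Q := ∑ i ∈ Finset.univ.erase S.o, S.e t i * (S.e t i + S.y i)
  have hQ : Q ≤ -h / S.M + |S.y S.o| ^ 2 / 4 := by
    rw [sq_abs]
    nlinarith [sq_nonneg (S.e t S.o + S.y S.o / 2)]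
  have hh0 : 0 ≤ h := by linarith
  change S.rest (t + 1) ≤ (1 - μ / 4) * S.rest t + 2 * h * Q + _ at hsum
  have h4 : 4 * h ^ 2 ≤ h ^ 2 / S.M := by
    rw [le_div_iff₀ hM]; nlinarith [sq_nonneg h]
  -- Complete the square in h around M y²/4.
  have h5 : -(h ^ 2 / S.M) + h * |S.y S.o| ^ 2 / 2 ≤ S.M * |S.y S.o| ^ 4 := by
    have : -(h ^ 2 / S.M) + h * |S.y S.o| ^ 2 / 2 =
        (-h ^ 2 + h * |S.y S.o| ^ 2 / 2 * S.M) / S.M := by field_simp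
    rw [this, div_le_iff₀ hM]
    nlinarith [sq_nonneg (h - S.M * |S.y S.o| ^ 2 / 4), sq_nonneg (S.M * |S.y S.o| ^ 2)]
  have h6 : 2 * h * Q ≤ -2 * (h ^ 2 / S.M) + h * |S.y S.o| ^ 2 / 2 := by
    calc 2 * h * Q ≤ 2 * h * (-h / S.M + |S.y S.o| ^ 2 / 4) := by gcongr
      _ = _ := by ring
  have h7 : 4 * h ^ 2 * ∑ i ∈ Finset.univ.erase S.o, (S.e t i + S.y i) ^ 2 ≤ 4 * h ^ 2 :=
    mul_le_of_le_one_right (by positivity) hF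
  linarith

/-- The bound for the error outside the leading mode while the sharpness grows. -/
noncomputable def decayBound (S : ModeSystem ι) (L μ δ : ℝ) (t : ℕ) : ℝ :=
  δ * (1 - μ / 8) ^ t + 3 * L * |S.y S.o| ^ 2

theorem Valid.μ_le_one (hV : S.Valid L η μ N) : μ ≤ 1 := (hV.μ_le S.o).trans (hV.ℓ_le S.o)

theorem Valid.decay_pow_nonneg (hV : S.Valid L η μ N) (t : ℕ) : 0 ≤ (1 - μ / 8) ^ t :=
  pow_nonneg (by linarith [hV.μ_le_one]) t

theorem Valid.decay_pow_le_one (hV : S.Valid L η μ N) (t : ℕ) : (1 - μ / 8) ^ t ≤ 1 :=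
  pow_le_one₀ (by linarith [hV.μ_le_one]) (by linarith [hV.μ_pos])

theorem Sharpens.decayBound_nonneg (hS : S.Sharpens L δ T) (hV : S.Valid L η μ N) (t : ℕ) :
    0 ≤ S.decayBound L μ δ t := by
  have h1 := hV.decay_pow_nonneg t
  have h2 := hV.one_le
  have h3 := hS.δ_nonneg
  unfold decayBound; positivity

theorem Sharpens.decayBound_le (hS : S.Sharpens L δ T) (hV : S.Valid L η μ N) (t : ℕ) :
    S.decayBound L μ δ t ≤ δ + 3 * L * |S.y S.o| ^ 2 := by
  have := mul_le_of_le_one_right hS.δ_nonneg (hV.decay_pow_le_one t)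
  unfold decayBound; linarith

theorem Sharpens.mul_decayBound_le (hS : S.Sharpens L δ T) (hV : S.Valid L η μ N) (t : ℕ) :
    L * S.decayBound L μ δ t ≤ 1 / 50 := by
  have h := hS.decayBound_le hV t
  have hL := hV.one_le
  have h1 := mul_pow_mul_le_one hL hS.δ_nonneg (by norm_num) 1 (by norm_num) hS.δ_small
  have h2 := mul_pow_mul_le_one hL (abs_nonneg (S.y S.o)) (by norm_num) 2 (by norm_num) hS.y_small
  have h3 := mul_pow_mul_le_one hL (abs_nonneg (S.y S.o)) (by norm_num) 0 (by norm_num) hS.y_small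
  have h4 : L * (δ + 3 * L * |S.y S.o| ^ 2) ≤ 1 / 50 := by
    have : L ^ 2 * |S.y S.o| * |S.y S.o| ≤ 1 / 100 * (1 / 100) := by
      apply mul_le_mul <;> first | linarith | positivity
    nlinarith
  nlinarith

/-- Because M ≤ Lμ, the forcing M y⁴ is balanced by the damping μ/4 at the level 4L y⁴, which does
not depend on μ. -/
theorem Sharpens.rest_le_sq (hS : S.Sharpens L δ T) (hV : S.Valid L η μ N) (hN : T ≤ N) {t : ℕ}
    (ht : t ≤ T) : S.rest t ≤ (δ * (1 - μ / 8) ^ t + 2 * L * |S.y S.o| ^ 2) ^ 2 := by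
  have hμ1 := hV.μ_le_one
  have hμ := hV.μ_pos
  have hL := hV.one_le
  set d := |S.y S.o|
  have key : ∀ t ≤ T, S.rest t ≤ δ ^ 2 * (1 - μ / 4) ^ t + 4 * L * d ^ 4 := by
    intro t
    induction t with
    | zero =>
      intro _
      have h1 := (S.rest_le_sum_sq 0).trans hS.start_error
      have : 0 ≤ 4 * L * d ^ 4 := by positivity
      simpa using by linarith
    | succ t ih =>
      intro ht
      have h1 := hS.rest_succ_le hV hN (t := t) (by omega)
      have h2 := mul_le_mul_of_nonneg_left (ih (by omega)) (by linarith : 0 ≤ 1 - μ / 4)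
      have h3 : S.M * d ^ 4 ≤ L * μ * d ^ 4 := mul_le_mul_of_nonneg_right hV.M_le' (by positivity)
      calc _ ≤ (1 - μ / 4) * (δ ^ 2 * (1 - μ / 4) ^ t + 4 * L * d ^ 4) + L * μ * d ^ 4 := by
            linarith
        _ = _ := by ring
  refine (key t ht).trans ?_
  have hp := hV.decay_pow_nonneg t
  have h1 : (1 - μ / 4) ^ t ≤ ((1 - μ / 8) ^ t) ^ 2 := by
    rw [← pow_mul, mul_comm t 2, pow_mul]
    exact pow_le_pow_left₀ (by linarith) (by nlinarith) t
  have h2 : δ ^ 2 * (1 - μ / 4) ^ t ≤ δ ^ 2 * ((1 - μ / 8) ^ t) ^ 2 := by gcongr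
  have h3 : 4 * L * d ^ 4 ≤ (2 * L * d ^ 2) ^ 2 := by
    have : L ≤ L ^ 2 := by nlinarith
    calc 4 * L * d ^ 4 ≤ 4 * L ^ 2 * d ^ 4 := by gcongr
      _ = _ := by ring
  have h4 : 0 ≤ δ * (1 - μ / 8) ^ t * (2 * L * d ^ 2) :=
    mul_nonneg (mul_nonneg hS.δ_nonneg hp) (by positivity)
  nlinarith

theorem Sharpens.rest_le (hS : S.Sharpens L δ T) (hV : S.Valid L η μ N) (hN : T ≤ N) {t : ℕ}
    (ht : t ≤ T) : S.rest t ≤ S.decayBound L μ δ t ^ 2 := by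
  refine (hS.rest_le_sq hV hN ht).trans ?_
  have hp := mul_nonneg hS.δ_nonneg (hV.decay_pow_nonneg t)
  have hL := hV.one_le
  refine pow_le_pow_left₀ (by positivity) ?_ 2
  unfold decayBound
  nlinarith [mul_nonneg (by linarith : 0 ≤ L) (sq_nonneg |S.y S.o|)]

theorem Valid.abs_sum_erase_mul_y_le (hV : S.Valid L η μ N) {t : ℕ} {B : ℝ} (hB : 0 ≤ B)
    (h : S.rest t ≤ B ^ 2) : |∑ i ∈ Finset.univ.erase S.o, S.e t i * S.y i| ≤ B := by
  simpa using abs_sum_mul_le _ (S.e t) S.y hB zero_le_one h hV.sum_erase_y_sq_le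

theorem sum_erase_corr (S : ModeSystem ι) (t : ℕ) :
    ∑ i ∈ Finset.univ.erase S.o, S.e t i * (S.e t i + S.y i) =
      S.rest t + ∑ i ∈ Finset.univ.erase S.o, S.e t i * S.y i := by
  rw [rest, ← Finset.sum_add_distrib]
  exact Finset.sum_congr rfl fun i _ => by ring

/-- The leading part of the correlation is at least -y²/4, so only the projection of the remaining
error on the target can drive the growth. The constant 3 instead of 2 in `decayBound` leaves room
for this y²/4. -/
theorem Sharpens.neg_g_le (hS : S.Sharpens L δ T) (hV : S.Valid L η μ N) (hN : T ≤ N) {t : ℕ}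
    (ht : t < T) : -S.g t ≤ S.M * S.decayBound L μ δ t := by
  obtain ⟨hσ, hg4, hg0, hc⟩ := hS.growth hV hN ht
  have hp := mul_nonneg hS.δ_nonneg (hV.decay_pow_nonneg t)
  have hL := hV.one_le
  have h1 := (abs_le.1 (hV.abs_sum_erase_mul_y_le (by positivity) (hS.rest_le_sq hV hN ht.le))).1
  have h2 := S.corr_eq t
  rw [sum_erase_corr] at h2
  have h3 := S.rest_nonneg t
  have h4 : -S.corr t ≤ S.decayBound L μ δ t := by
    unfold decayBound
    have : |S.y S.o| ^ 2 ≤ L * |S.y S.o| ^ 2 := le_mul_of_one_le_left (sq_nonneg _) hL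
    have h5 := sq_abs (S.y S.o)
    nlinarith [sq_nonneg (S.e t S.o + S.y S.o / 2)]
  have h6 : S.M / S.σ t ≤ S.M := div_le_self hV.M_pos.le hσ
  have h7 : 0 ≤ S.M / S.σ t := div_nonneg hV.M_pos.le (by linarith)
  calc -S.g t = S.M / S.σ t * (-S.corr t) := by rw [g]; ring
    _ ≤ S.M * S.decayBound L μ δ t := mul_le_mul h6 h4 (by linarith) hV.M_pos.le

/-- Each mode is damped at rate ℓ and forced by M b_t|y|. The forcing accumulates to about M
b_t|y|/ℓ, hence the weight ℓ. The constant 4 closes the induction: (1-ℓ/2)·4 + ℓ = 4(1-ℓ/4), and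
`decayBound` decays no faster than 1-ℓ/4. -/
theorem Sharpens.mode_le (hS : S.Sharpens L δ T) (hV : S.Valid L η μ N) (hN : T ≤ N) {i : ι}
    (hi : i ≠ S.o) {t : ℕ} (ht : t ≤ T) :
    S.ℓ i * |S.e t i| ≤ S.ℓ i * (1 - S.ℓ i / 2) ^ t * |S.e 0 i| +
      4 * S.M * S.decayBound L μ δ t * |S.y i| := by
  have hμ := hV.μ_pos
  have hℓ := hV.μ_le i
  have hℓ1 := hV.ℓ_le i
  have hM := hV.M_pos
  induction t with
  | zero =>
    have : 0 ≤ 4 * S.M * S.decayBound L μ δ 0 * |S.y i| := by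
      have := hS.decayBound_nonneg hV 0
      positivity
    simpa using this
  | succ t ih =>
    obtain ⟨hσ, hg4, hg0, hc⟩ := hS.growth hV hN ht
    have hg := hS.neg_g_le hV hN ht
    have hb := hS.mul_decayBound_le hV t
    have hb0 := hS.decayBound_nonneg hV t
    have hgμ : -S.g t ≤ S.ℓ i / 50 := by
      calc -S.g t ≤ L * μ * S.decayBound L μ δ t :=
            hg.trans (mul_le_mul_of_nonneg_right hV.M_le' hb0)
        _ = μ * (L * S.decayBound L μ δ t) := by ring
        _ ≤ S.ℓ i * (1 / 50) := mul_le_mul hℓ hb (by have := hV.one_le; positivity) (by linarith)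
        _ = _ := by ring
    have hr1 := hV.damp t i hi
    have hr0 : S.ℓ i ≤ S.ℓ i * S.σ t := le_mul_of_one_le_right (by linarith) hσ
    have hfac0 : 0 ≤ (1 - S.g t) * (1 - S.ℓ i * S.σ t) :=
      mul_nonneg (by linarith) (by linarith)
    have hfac : (1 - S.g t) * (1 - S.ℓ i * S.σ t) ≤ 1 - S.ℓ i / 2 := by
      calc (1 - S.g t) * (1 - S.ℓ i * S.σ t) ≤ (1 + S.ℓ i / 50) * (1 - S.ℓ i) := by
            apply mul_le_mul <;> linarith
        _ ≤ _ := by nlinarith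
    have hstep : |S.e (t + 1) i| ≤ (1 - S.ℓ i / 2) * |S.e t i| +
        S.M * S.decayBound L μ δ t * |S.y i| := by
      rw [hV.e_succ t (by omega)]
      refine (abs_sub _ _).trans ?_
      rw [abs_mul, abs_mul (S.g t), abs_of_nonneg hfac0, abs_of_neg hg0]
      gcongr
    have hdec : (1 - S.ℓ i / 4) * S.decayBound L μ δ t ≤ S.decayBound L μ δ (t + 1) := by
      unfold decayBound
      have h1 := mul_nonneg hS.δ_nonneg (hV.decay_pow_nonneg t)
      have h2 : 0 ≤ 3 * L * |S.y S.o| ^ 2 := by have := hV.one_le; positivity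
      rw [pow_succ (1 - μ / 8)]
      nlinarith
    have ih' := ih (by omega)
    calc S.ℓ i * |S.e (t + 1) i|
        ≤ S.ℓ i * ((1 - S.ℓ i / 2) * |S.e t i| + S.M * S.decayBound L μ δ t * |S.y i|) := by
          gcongr; linarith
      _ = (1 - S.ℓ i / 2) * (S.ℓ i * |S.e t i|) +
          S.ℓ i * (S.M * S.decayBound L μ δ t * |S.y i|) := by ring
      _ ≤ (1 - S.ℓ i / 2) * (S.ℓ i * (1 - S.ℓ i / 2) ^ t * |S.e 0 i| +
          4 * S.M * S.decayBound L μ δ t * |S.y i|) +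
          S.ℓ i * (S.M * S.decayBound L μ δ t * |S.y i|) := by
          gcongr; linarith
      _ = S.ℓ i * (1 - S.ℓ i / 2) ^ (t + 1) * |S.e 0 i| +
          4 * S.M * ((1 - S.ℓ i / 4) * S.decayBound L μ δ t) * |S.y i| := by ring
      _ ≤ _ := by gcongr

/-- Summation of the increments M b_t: a geometric series for the decaying part, and a linear term
for the constant part. -/
theorem Sharpens.σ_le_two_add (hS : S.Sharpens L δ T) (hV : S.Valid L η μ N) (hN : T ≤ N) {t : ℕ}
    (ht : t ≤ T) : S.σ t ≤ 2 + 3 * L * S.M *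
      (8 * δ / μ * (1 - (1 - μ / 8) ^ t) + 3 * L * |S.y S.o| ^ 2 * t) := by
  induction t with
  | zero => simpa using hS.start_lt.le
  | succ t ih =>
    obtain ⟨hσ, hg4, hg0, hc⟩ := hS.growth hV hN ht
    have hg := hS.neg_g_le hV hN ht
    have hL := hV.one_le
    have h1 : S.σ (t + 1) ≤ S.σ t + 3 * L * (-S.g t) := by
      rw [hV.σ_succ t (by omega)]
      have : (1 - S.g t) ^ 2 ≤ 1 + 3 * (-S.g t) := by nlinarith
      nlinarith [hV.σ_le t]
    have h2 : 3 * L * (-S.g t) ≤ 3 * L * (S.M * S.decayBound L μ δ t) := by gcongr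
    refine (h1.trans (add_le_add (ih (by omega)) h2)).trans_eq ?_
    have := hV.μ_pos
    unfold decayBound
    push_cast
    field_simp
    ring

/-! ### Fall of the sharpness above the edge (Phase III). -/

/-- A mode of the error while the sharpness falls: what is left of its initial value, plus a
multiple of the target caused by the decrease of the output. -/
theorem Valid.exists_decomposition (hV : S.Valid L η μ N) {i : ι} (hi : i ≠ S.o) {t : ℕ}
    (hTt : T ≤ t) (htN : t ≤ N + 1)
    (h : ∀ s, T ≤ s → s < t → 1 ≤ S.σ s ∧ 0 ≤ S.g s ∧ S.g s ≤ 1) :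
    ∃ A B : ℝ, S.e t i = A - B * S.y i ∧ 0 ≤ B ∧ B ≤ 1 ∧
      |A| ≤ (1 - μ) ^ (t - T) * |S.e T i| := by
  induction t, hTt using Nat.le_induction with
  | base => exact ⟨S.e T i, 0, by simp, le_rfl, zero_le_one, by simp⟩
  | succ t hTt ih =>
    obtain ⟨A, B, he, hB0, hB1, hA⟩ := ih (by omega) fun s h1 h2 => h s h1 (by omega)
    obtain ⟨hσ, hg0, hg1⟩ := h t hTt (by omega)
    have hr1 := hV.damp t i hi
    have hμ := hV.μ_pos
    have hℓ := hV.μ_le i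
    have hr0 : μ ≤ S.ℓ i * S.σ t := hℓ.trans (le_mul_of_one_le_right (by linarith) hσ)
    have hfac0 : 0 ≤ (1 - S.g t) * (1 - S.ℓ i * S.σ t) :=
      mul_nonneg (by linarith) (by linarith)
    -- The new B is at most (1-g)·1 + g, so it stays in [0, 1].
    refine ⟨(1 - S.g t) * (1 - S.ℓ i * S.σ t) * A,
      (1 - S.g t) * (1 - S.ℓ i * S.σ t) * B + S.g t, ?_, by positivity, ?_, ?_⟩
    · rw [hV.e_succ t (by omega), he]; ring
    · have : (1 - S.g t) * (1 - S.ℓ i * S.σ t) * B ≤ (1 - S.g t) * 1 * 1 := by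
        gcongr
        linarith
      linarith
    · rw [abs_mul, abs_of_nonneg hfac0, show t + 1 - T = t - T + 1 by omega, pow_succ']
      rw [mul_assoc (1 - μ)]
      have : (1 - S.g t) * (1 - S.ℓ i * S.σ t) ≤ 1 * (1 - μ) := by
        apply mul_le_mul <;> linarith
      exact mul_le_mul (by linarith) hA (abs_nonneg _) (by linarith)

/-- With e = A - By the product is A² + (1-2B)Ay - B(1-B)y². The last term has a favourable sign for
0 ≤ B ≤ 1, so only the damped remainder A of the initial error counts. -/
theorem Valid.mode_corr_le (hV : S.Valid L η μ N) {i : ι} (hi : i ≠ S.o) {t : ℕ}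
    (hTt : T ≤ t) (htN : t ≤ N + 1)
    (h : ∀ s, T ≤ s → s < t → 1 ≤ S.σ s ∧ 0 ≤ S.g s ∧ S.g s ≤ 1) :
    S.e t i * (S.e t i + S.y i) ≤
      (1 - μ) ^ (t - T) * (|S.e T i| * (|S.e T i| + |S.y i|)) := by
  obtain ⟨A, B, he, hB0, hB1, hA⟩ := hV.exists_decomposition hi hTt htN h
  have hp1 : (1 - μ) ^ (t - T) ≤ 1 :=
    pow_le_one₀ (by linarith [hV.μ_le_one]) (by linarith [hV.μ_pos])
  have hA' : |A| ≤ |S.e T i| := hA.trans (mul_le_of_le_one_left (abs_nonneg _) hp1)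
  have h1 : S.e t i * (S.e t i + S.y i) ≤ |A| * (|A| + |S.y i|) := by
    have h2 : S.e t i * (S.e t i + S.y i) =
        A ^ 2 + (1 - 2 * B) * (A * S.y i) - B * (1 - B) * S.y i ^ 2 := by rw [he]; ring
    have h3 : (1 - 2 * B) * (A * S.y i) ≤ |A| * |S.y i| := by
      refine (le_abs_self _).trans ?_
      rw [abs_mul, abs_mul A]
      exact mul_le_of_le_one_left (by positivity) (abs_le.2 ⟨by linarith, by linarith⟩)
    have h4 : 0 ≤ B * (1 - B) * S.y i ^ 2 :=
      mul_nonneg (mul_nonneg hB0 (by linarith)) (sq_nonneg _)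
    nlinarith [sq_abs A]
  refine h1.trans ?_
  rw [← mul_assoc]
  exact mul_le_mul hA (by linarith) (by positivity) ((abs_nonneg _).trans hA)

/-- The weight ℓ turns the decay (1-ℓ/2)^T into 2/T by `natCast_mul_mul_one_sub_pow_le`. The forced
part carries M b_T, which is treated in the same way using M ≤ Lμ. -/
theorem Sharpens.weighted_modes_le (hS : S.Sharpens L δ T) (hV : S.Valid L η μ N) (hN : T ≤ N) :
    ∑ i ∈ Finset.univ.erase S.o, S.ℓ i * (|S.e T i| * (|S.e T i| + |S.y i|)) ≤
      68 * L * δ / T + 24 * L * S.M * |S.y S.o| ^ 2 := by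
  have hT : (0 : ℝ) < T := Nat.cast_pos.2 hS.T_pos
  have hb0 := hS.decayBound_nonneg hV T
  have hM := hV.M_pos
  have hL := hV.one_le
  have hμ := hV.μ_pos
  set b := S.decayBound L μ δ T with hb
  have hb1 : b ≤ 1 := by nlinarith [hS.mul_decayBound_le hV T]
  have hpow : ∀ i, S.ℓ i * (1 - S.ℓ i / 2) ^ T ≤ 2 / T := by
    intro i
    have := natCast_mul_mul_one_sub_pow_le (x := S.ℓ i / 2) (by linarith [hV.μ_le i])
      (by linarith [hV.ℓ_le i]) T
    rw [le_div_iff₀ hT]; linarith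
  have hterm : ∀ i ∈ Finset.univ.erase S.o, S.ℓ i * (|S.e T i| * (|S.e T i| + |S.y i|)) ≤
      2 / T * (|S.e 0 i| * |S.e T i|) + 2 / T * (|S.e 0 i| * |S.y i|) +
        4 * S.M * b * (|S.y i| * |S.e T i|) + 4 * S.M * b * (|S.y i| * |S.y i|) := by
    intro i hi
    have h1 := hS.mode_le hV hN (Finset.ne_of_mem_erase hi) le_rfl
    have h2 : S.ℓ i * |S.e T i| ≤ 2 / T * |S.e 0 i| + 4 * S.M * b * |S.y i| :=
      h1.trans (by gcongr; exact hpow i)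
    calc _ = S.ℓ i * |S.e T i| * (|S.e T i| + |S.y i|) := by ring
      _ ≤ (2 / T * |S.e 0 i| + 4 * S.M * b * |S.y i|) * (|S.e T i| + |S.y i|) := by gcongr
      _ = _ := by ring
  refine (Finset.sum_le_sum hterm).trans ?_
  simp only [Finset.sum_add_distrib, ← Finset.mul_sum]
  have hr0 : ∑ i ∈ Finset.univ.erase S.o, S.e 0 i ^ 2 ≤ δ ^ 2 := (S.rest_le_sum_sq 0).trans hS.start_error
  have hrT : ∑ i ∈ Finset.univ.erase S.o, S.e T i ^ 2 ≤ 1 ^ 2 :=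
    (hS.rest_le hV hN le_rfl).trans (pow_le_pow_left₀ hb0 hb1 2)
  have hy := hV.sum_erase_y_sq_le
  have s1 := sum_abs_mul_abs_le _ _ _ hS.δ_nonneg zero_le_one hr0 hrT
  have s2 := sum_abs_mul_abs_le _ _ _ hS.δ_nonneg zero_le_one hr0 hy
  have s3 := sum_abs_mul_abs_le _ _ _ zero_le_one zero_le_one hy hrT
  have s4 := sum_abs_mul_abs_le _ _ _ zero_le_one zero_le_one hy hy
  have hMb : S.M * b ≤ 8 * L * δ / T + 3 * L * S.M * |S.y S.o| ^ 2 := by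
    have h1 := natCast_mul_mul_one_sub_pow_le (x := μ / 8) (by linarith)
      (by linarith [hV.μ_le_one]) T
    have h2 : μ * (1 - μ / 8) ^ T ≤ 8 / T := by rw [le_div_iff₀ hT]; linarith
    have h3 : S.M * (1 - μ / 8) ^ T ≤ L * (8 / T) :=
      calc _ ≤ L * μ * (1 - μ / 8) ^ T :=
            mul_le_mul_of_nonneg_right hV.M_le' (hV.decay_pow_nonneg T)
        _ = L * (μ * (1 - μ / 8) ^ T) := by ring
        _ ≤ _ := by gcongr
    have h4 := mul_le_mul_of_nonneg_left h3 hS.δ_nonneg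
    calc S.M * b = δ * (S.M * (1 - μ / 8) ^ T) + 3 * L * S.M * |S.y S.o| ^ 2 := by
          rw [hb, decayBound]; ring
      _ ≤ δ * (L * (8 / T)) + 3 * L * S.M * |S.y S.o| ^ 2 := by linarith
      _ = _ := by ring
  have hT0 : 0 ≤ 2 / (T : ℝ) := by positivity
  have hMb0 : 0 ≤ 4 * S.M * b := by positivity
  have s1' := mul_le_mul_of_nonneg_left s1 hT0
  have s2' := mul_le_mul_of_nonneg_left s2 hT0
  have s3' := mul_le_mul_of_nonneg_left s3 hMb0
  have s4' := mul_le_mul_of_nonneg_left s4 hMb0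
  have h5 : δ / T ≤ L * (δ / T) := le_mul_of_one_le_left (by have := hS.δ_nonneg; positivity) hL
  have e1 : 2 / (T : ℝ) * (δ * 1) = 2 * (δ / T) := by ring
  have e2 : 8 * L * δ / T = 8 * (L * (δ / T)) := by ring
  have e3 : 68 * L * δ / T = 68 * (L * (δ / T)) := by ring
  rw [e1] at s1' s2'
  rw [e2] at hMb
  rw [e3]
  linarith

set_option maxHeartbeats 1000000 in
/-- While the sharpness falls but stays well above `2 / η`, the first layer grows. -/
theorem Sharpens.first_layer_grows (hS : S.Sharpens L δ T) (hV : S.Valid L η μ N) {t : ℕ}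
    (hTt : T ≤ t) (htN : t ≤ N) (hfall : ∀ s, T ≤ s → s ≤ t → 2 < S.σ s ∧ 0 < S.corr s)
    {δ₂ m c₁ C : ℝ} (hδ : δ ≤ δ₂) (hd : |S.y S.o| ≤ δ₂ ^ 2) (hδ₂ : δ₂ ≤ 1)
    (hdm : |S.y S.o| ≤ L * m ^ 2) (hηm : η ≤ m) (hm1 : m ≤ 1) (hc₁ : 0 < c₁)
    (hx : c₁ * δ₂ ≤ |S.e t S.o|) (hσ : C * m < S.σ t - 2) (hC1 : 1 ≤ C)
    (hC : 2 * L / c₁ + 1680 * L ^ 4 / c₁ ^ 2 ≤ C) :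
    0 < ∑ i, S.ℓ i * S.σ t * (S.ℓ i * S.σ t * S.e t i ^ 2 -
      2 * (S.e t i * (S.e t i + S.y i))) := by
  have hN : T ≤ N := hTt.trans htN
  have hL := hV.one_le
  have hM := hV.M_pos
  have hμ := hV.μ_pos
  have hη := hV.η_pos
  have hm : 0 < m := hη.trans_le hηm
  have hδ0 := hS.δ_nonneg
  have hδ₂0 : 0 ≤ δ₂ := hδ0.trans hδ
  have hT : (0 : ℝ) < T := Nat.cast_pos.2 hS.T_pos
  have hg : ∀ s, T ≤ s → s ≤ t → 0 < S.g s ∧ S.g s ≤ 1 := fun s h1 h2 => by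
    have h3 := hfall s h1 h2
    exact ⟨mul_pos (div_pos hM (by linarith)) h3.2,
      by linarith [(abs_le.1 (hV.abs_g_le_quarter (by linarith : 1 ≤ S.σ s))).2]⟩
  have hσT : S.σ t ≤ S.σ T := by
    have : ∀ s, T ≤ s → s ≤ t → S.σ s ≤ S.σ T := by
      intro s hs
      induction s, hs using Nat.le_induction with
      | base => exact fun _ => le_rfl
      | succ s hs ih =>
        intro hst
        have h1 := hg s hs (by omega)
        rw [hV.σ_succ s (by omega)]
        have h2 : (1 - S.g s) ^ 2 ≤ 1 := by nlinarith
        have h3 := hfall s hs (by omega)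
        nlinarith [ih (by omega)]
    exact this t hTt le_rfl
  set d := |S.y S.o| with hd'
  have hd0 : 0 ≤ d := abs_nonneg _
  have hdδ : d ≤ δ₂ := hd.trans (by nlinarith)
  have hd22 : d ^ 2 ≤ δ₂ ^ 2 := pow_le_pow_left₀ hd0 hdδ 2
  have hd2 : d ^ 2 ≤ δ₂ := hd22.trans (by nlinarith)
  -- the growth of the sharpness took a long time
  have hlong : C * m < 12 * L ^ 2 * S.M * δ₂ * T := by
    have h1 := hS.σ_le_two_add hV hN le_rfl
    have h2 : 8 * δ / μ * (1 - (1 - μ / 8) ^ T) ≤ δ * T := by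
      have h3 : 1 + (T : ℝ) * (-(μ / 8)) ≤ (1 + -(μ / 8)) ^ T :=
        one_add_mul_le_pow (by linarith [hV.μ_le_one]) T
      rw [← sub_eq_add_neg] at h3
      calc _ ≤ 8 * δ / μ * (T * (μ / 8)) := by gcongr; linarith
        _ = _ := by field_simp
    have h4 : 8 * δ / μ * (1 - (1 - μ / 8) ^ T) + 3 * L * d ^ 2 * T ≤ 4 * L * δ₂ * T := by
      have : δ * T + 3 * L * d ^ 2 * T ≤ L * δ₂ * T + 3 * L * δ₂ * T := by
        gcongr
        nlinarith
      linarith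
    have h5 : 3 * L * S.M * (8 * δ / μ * (1 - (1 - μ / 8) ^ T) + 3 * L * d ^ 2 * T) ≤
        3 * L * S.M * (4 * L * δ₂ * T) := by gcongr
    linarith
  -- With δ₂ = 0 the sharpness could not have exceeded 2 at all.
  have hδ₂pos : 0 < δ₂ := by
    rcases hδ₂0.eq_or_lt with h | h
    · rw [← h] at hlong
      nlinarith
    · exact h
  have hMm : S.M ≤ L * m ^ 2 := hV.M_le.trans (by gcongr)
  have hinvT : 1 / (T : ℝ) ≤ 12 * L ^ 3 * m * δ₂ := by
    rw [div_le_iff₀ hT]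
    have h1 : C * m < 12 * L ^ 2 * (L * m ^ 2) * δ₂ * T := hlong.trans_le (by gcongr)
    have h2 : m * C < m * (12 * L ^ 3 * m * δ₂ * T) := by linarith
    linarith [lt_of_mul_lt_mul_left h2 hm.le]
  have hrest : ∑ i ∈ Finset.univ.erase S.o, S.ℓ i * (S.e t i * (S.e t i + S.y i)) ≤
      840 * L ^ 4 * m * δ₂ ^ 2 := by
    have h1 : ∀ i ∈ Finset.univ.erase S.o, S.ℓ i * (S.e t i * (S.e t i + S.y i)) ≤
        S.ℓ i * (|S.e T i| * (|S.e T i| + |S.y i|)) := by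
      intro i hi
      have h2 := hV.mode_corr_le (Finset.ne_of_mem_erase hi) hTt (by omega) fun s h1 h2 =>
        ⟨by linarith [(hfall s h1 h2.le).1], (hg s h1 h2.le).1.le, (hg s h1 h2.le).2⟩
      have hp1 : (1 - μ) ^ (t - T) ≤ 1 :=
        pow_le_one₀ (by linarith [hV.μ_le_one]) (by linarith)
      refine mul_le_mul_of_nonneg_left (h2.trans ?_) (by linarith [hV.μ_le i])
      exact mul_le_of_le_one_left (by positivity) hp1
    refine (Finset.sum_le_sum h1).trans ((hS.weighted_modes_le hV hN).trans ?_)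
    have h2 : 68 * L * δ / T ≤ 816 * L ^ 4 * m * δ₂ ^ 2 :=
      calc 68 * L * δ / T = 68 * L * δ * (1 / T) := by ring
        _ ≤ 68 * L * δ₂ * (12 * L ^ 3 * m * δ₂) := by gcongr
        _ = _ := by ring
    have h3 : 24 * L * S.M * d ^ 2 ≤ 24 * L ^ 4 * m * δ₂ ^ 2 :=
      calc 24 * L * S.M * d ^ 2 ≤ 24 * L * (L * m ^ 2) * δ₂ ^ 2 := by gcongr
        _ = 24 * (L ^ 2 * m ^ 2) * δ₂ ^ 2 := by ring
        _ ≤ 24 * (L ^ 4 * m) * δ₂ ^ 2 := by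
          gcongr
          · norm_num
          · nlinarith
        _ = _ := by ring
    linarith
  have hσ0 : 0 < S.σ t := by linarith [(hfall t hTt le_rfl).1]
  rw [← Finset.add_sum_erase _ _ (Finset.mem_univ S.o), hV.ℓ_o]
  have hothers : -(2 * S.σ t * (840 * L ^ 4 * m * δ₂ ^ 2)) ≤
      ∑ i ∈ Finset.univ.erase S.o, S.ℓ i * S.σ t * (S.ℓ i * S.σ t * S.e t i ^ 2 -
        2 * (S.e t i * (S.e t i + S.y i))) := by
    -- The square (ℓσe)² is dropped; only the correlation part can be harmful.
    have h1 : ∀ i ∈ Finset.univ.erase S.o,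
        -(2 * S.σ t) * (S.ℓ i * (S.e t i * (S.e t i + S.y i))) ≤
        S.ℓ i * S.σ t * (S.ℓ i * S.σ t * S.e t i ^ 2 - 2 * (S.e t i * (S.e t i + S.y i))) := by
      intro i _
      nlinarith [sq_nonneg (S.ℓ i * S.σ t * S.e t i)]
    have h2 := Finset.sum_le_sum h1
    rw [← Finset.mul_sum] at h2
    nlinarith
  -- Geometric mean of the two bounds |y| ≤ L m² and |y| ≤ δ₂².
  have hdd : d ≤ L * m * δ₂ := by
    refine abs_le_of_sq_le_sq' ?_ (by positivity) |>.2
    calc d ^ 2 = d * d := sq d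
      _ ≤ L * m ^ 2 * δ₂ ^ 2 := mul_le_mul hdm hd hd0 (by positivity)
      _ ≤ L ^ 2 * (m ^ 2 * δ₂ ^ 2) := by
        rw [mul_assoc]
        gcongr
        nlinarith
      _ = _ := by ring
  set x := |S.e t S.o| with hx'
  have hxpos : 0 < x := (mul_pos hc₁ hδ₂pos).trans_le hx
  have hδx : δ₂ ≤ x / c₁ := by rw [le_div_iff₀ hc₁]; linarith
  have hyx : S.e t S.o * S.y S.o ≤ L * m * (x ^ 2 / c₁) :=
    calc S.e t S.o * S.y S.o ≤ |S.e t S.o * S.y S.o| := le_abs_self _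
      _ = x * d := abs_mul _ _
      _ ≤ x * (L * m * (x / c₁)) := by
        gcongr
        exact hdd.trans (by gcongr)
      _ = _ := by ring
  have hδx2 : δ₂ ^ 2 ≤ x ^ 2 / c₁ ^ 2 := by
    rw [← div_pow]; exact pow_le_pow_left₀ hδ₂0 hδx 2
  have hlead : C * m * x ^ 2 < (S.σ t - 2) * x ^ 2 :=
    mul_lt_mul_of_pos_right hσ (by positivity)
  have hC' := mul_le_mul_of_nonneg_left hC (by positivity : 0 ≤ m * x ^ 2)
  have h840 : 840 * L ^ 4 * m * δ₂ ^ 2 ≤ 840 * L ^ 4 * m * (x ^ 2 / c₁ ^ 2) := by gcongr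
  -- The two summands in the lower bound for C pay for the term 2ey and for the other modes.
  have hfin : 0 < (S.σ t - 2) * x ^ 2 - 2 * (S.e t S.o * S.y S.o) -
      2 * (840 * L ^ 4 * m * δ₂ ^ 2) := by
    have e1 : m * x ^ 2 * (2 * L / c₁ + 1680 * L ^ 4 / c₁ ^ 2) =
        2 * (L * m * (x ^ 2 / c₁)) + 2 * (840 * L ^ 4 * m * (x ^ 2 / c₁ ^ 2)) := by ring
    rw [e1] at hC'
    linarith
  have hx2 : x ^ 2 = S.e t S.o ^ 2 := sq_abs _
  have hprod := mul_pos hσ0 hfin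
  rw [hx2] at hprod
  linarith

/-! ### The error and the correlation at the start of Phase III. -/

/-- The correlation is still negative, so e² + ey in the leading mode is at most the negative
contribution available in the other modes, which is at most b. -/
theorem Sharpens.lead_sq_le (hS : S.Sharpens L δ T) (hV : S.Valid L η μ N) (hN : T ≤ N) {t : ℕ}
    (ht : t < T) : S.e t S.o ^ 2 ≤ |S.y S.o| ^ 2 + 2 * S.decayBound L μ δ t := by
  obtain ⟨hσ, hg4, hg0, hc⟩ := hS.growth hV hN ht
  have h1 := (abs_le.1 (hV.abs_sum_erase_mul_y_le (hS.decayBound_nonneg hV t)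
    (hS.rest_le hV hN ht.le))).1
  have h2 := S.corr_eq t
  rw [sum_erase_corr] at h2
  have h3 := S.rest_nonneg t
  rw [sq_abs]
  nlinarith [sq_nonneg (S.e t S.o + S.y S.o)]

theorem Sharpens.decayBound_le_mul (hS : S.Sharpens L δ T) (hV : S.Valid L η μ N) {δ₂ : ℝ}
    (hδ : δ ≤ δ₂) (hd : |S.y S.o| ≤ δ₂ ^ 2) (hδ₂ : δ₂ ≤ 1) (t : ℕ) :
    S.decayBound L μ δ t ≤ 4 * L * δ₂ := by
  have hL := hV.one_le
  have h0 := hS.δ_nonneg.trans hδ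
  have hdδ : |S.y S.o| ≤ δ₂ := hd.trans (by nlinarith)
  have h2 : |S.y S.o| ^ 2 ≤ δ₂ := by nlinarith [abs_nonneg (S.y S.o)]
  have h3 : L * |S.y S.o| ^ 2 ≤ L * δ₂ := by gcongr
  nlinarith [hS.decayBound_le hV t]

/-- The bound of `lead_sq_le` is available one step before T, and a single step multiplies the
leading mode by at most 2L, apart from the small term g·y. -/
theorem Sharpens.sum_sq_last_le (hS : S.Sharpens L δ T) (hV : S.Valid L η μ N) (hN : T ≤ N)
    {δ₂ : ℝ} (hδ : δ ≤ δ₂) (hd : |S.y S.o| ≤ δ₂ ^ 2) (hδ₂ : δ₂ ≤ 1) :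
    ∑ i, S.e T i ^ 2 ≤ 80 * L ^ 3 * δ₂ := by
  obtain ⟨t, rfl⟩ := Nat.exists_eq_succ_of_ne_zero hS.T_pos.ne'
  have hL := hV.one_le
  have h0 := hS.δ_nonneg.trans hδ
  obtain ⟨hσ, hg4, hg0, hc⟩ := hS.growth hV hN t.lt_succ_self
  have hx := hS.lead_sq_le hV hN t.lt_succ_self
  have hb := hS.decayBound_le_mul hV hδ hd hδ₂ t
  have hr := hS.rest_le hV hN (le_refl (t + 1))
  have hb' := hS.decayBound_le_mul hV hδ hd hδ₂ (t + 1)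
  have hb1 := hS.mul_decayBound_le hV (t + 1)
  have hb0 := hS.decayBound_nonneg hV (t + 1)
  set b := S.decayBound L μ δ (t + 1)
  have hdδ : |S.y S.o| ≤ δ₂ := hd.trans (by nlinarith)
  have hd2 : |S.y S.o| ^ 2 ≤ δ₂ := by nlinarith [abs_nonneg (S.y S.o)]
  have hx9 : S.e t S.o ^ 2 ≤ 9 * L * δ₂ := by nlinarith
  have hstep : S.e (t + 1) S.o ^ 2 ≤ 8 * L ^ 2 * S.e t S.o ^ 2 + 2 * |S.y S.o| ^ 2 := by
    rw [hV.e_succ t (by omega), hV.ℓ_o, sq_abs]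
    have h1 : ((1 - S.g t) * (1 - 1 * S.σ t)) ^ 2 ≤ (2 * L) ^ 2 := by
      apply sq_le_sq'
      · nlinarith [hV.σ_le t]
      · nlinarith [hV.σ_le t]
    have h2 : S.g t ^ 2 ≤ 1 := by nlinarith
    have h3 := mul_le_mul_of_nonneg_right h1 (sq_nonneg (S.e t S.o))
    have h4 := mul_le_mul_of_nonneg_right h2 (sq_nonneg (S.y S.o))
    nlinarith [sq_nonneg ((1 - S.g t) * (1 - 1 * S.σ t) * S.e t S.o + S.g t * S.y S.o)]
  have h5 : 8 * L ^ 2 * S.e t S.o ^ 2 ≤ 72 * L ^ 3 * δ₂ :=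
    calc _ ≤ 8 * L ^ 2 * (9 * L * δ₂) := by gcongr
      _ = _ := by ring
  have h6 : b ^ 2 ≤ L ^ 3 * δ₂ := by
    have : b ≤ 1 / 50 := by nlinarith
    have h7 : L * δ₂ ≤ L ^ 3 * δ₂ := by
      gcongr
      exact le_self_pow₀ hL (by norm_num)
    nlinarith
  have h8 : δ₂ ≤ L ^ 3 * δ₂ := le_mul_of_one_le_left h0 (one_le_pow₀ hL)
  rw [Nat.succ_eq_add_one, sum_sq_eq]
  linarith

/-- Here x' = -kx + hy with k = (1+h)(σ-1). At σ = 2 and h = 0 this is a pure change of sign, which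
keeps x²; k - 1 is at most the excess over 2 plus Lh. -/
theorem lead_corr_succ_le {L h σ x y : ℝ} (hL : 1 ≤ L) (hh0 : 0 ≤ h) (hh : h ≤ 1 / 4)
    (hσ1 : 1 ≤ σ) (hσL : σ ≤ L) :
    let x' := (1 + h) * (1 - σ) * x + h * y
    x' * (x' + y) ≤ x ^ 2 + 4 * L * ((max (σ - 2) 0 + L * h) * x ^ 2) +
      4 * L * (|x| * |y|) + |y| ^ 2 := by
  intro x'
  set k := (1 + h) * (σ - 1) with hk
  set w := max (σ - 2) 0 + L * h with hw
  have hk0 : 0 ≤ k := mul_nonneg (by linarith) (by linarith)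
  have hm0 : 0 ≤ max (σ - 2) 0 := le_max_right _ _
  have hm1 : σ - 2 ≤ max (σ - 2) 0 := le_max_left _ _
  have hmL : max (σ - 2) 0 ≤ L := max_le (by linarith) (by linarith)
  have hw0 : 0 ≤ w := by positivity
  have hkw : k ≤ 1 + w := by rw [hk, hw]; nlinarith
  have hwL : w ≤ 2 * L := by rw [hw]; nlinarith
  have hkL : k ≤ 2 * L := by rw [hk]; nlinarith
  have hk2 : k ^ 2 ≤ 1 + 4 * L * w := by
    have : k ^ 2 ≤ (1 + w) ^ 2 := pow_le_pow_left₀ hk0 hkw 2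
    nlinarith
  have hx' : x' * (x' + y) = k ^ 2 * x ^ 2 - (2 * h + 1) * k * (x * y) + (h ^ 2 + h) * y ^ 2 := by
    simp only [x', hk]; ring
  have h1 : -(x * y) ≤ |x| * |y| := by rw [← abs_mul]; exact neg_le_abs _
  have hkL' : k ≤ 5 / 4 * L := by rw [hk]; nlinarith
  have h2 : -((2 * h + 1) * k * (x * y)) ≤ 4 * L * (|x| * |y|) := by
    calc -((2 * h + 1) * k * (x * y)) = (2 * h + 1) * k * (-(x * y)) := by ring
      _ ≤ (2 * h + 1) * k * (|x| * |y|) := by gcongr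
      _ ≤ 4 * L * (|x| * |y|) :=
        mul_le_mul_of_nonneg_right (by nlinarith) (by positivity)
  have h3 : (h ^ 2 + h) * y ^ 2 ≤ |y| ^ 2 := by
    rw [sq_abs]
    exact mul_le_of_le_one_left (sq_nonneg _) (by nlinarith)
  have h4 := mul_le_mul_of_nonneg_right hk2 (sq_nonneg x)
  rw [hx']
  linarith

set_option maxHeartbeats 1000000 in
-- Bounding each factor separately would give too little: the excess contains M y² t and the leading
-- mode δ(1-μ/8)^t. In the product M·t·(1-μ/8)^t ≤ 8L, so late times, with a large excess, meet a
-- leading mode that has already shrunk.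
theorem Sharpens.excess_mul_lead_sq_le (hS : S.Sharpens L δ T) (hV : S.Valid L η μ N)
    (hN : T ≤ N) {δ₂ : ℝ} (hδ : δ ≤ δ₂) (hd : |S.y S.o| ≤ δ₂ ^ 2) (hδ₂ : δ₂ ≤ 1) {t : ℕ}
    (ht : t < T) : max (S.σ t - 2) 0 * S.e t S.o ^ 2 ≤ 199 * L ^ 3 * δ₂ ^ 2 := by
  have hL := hV.one_le
  have hM := hV.M_pos
  have hμ := hV.μ_pos
  have hδ0 := hS.δ_nonneg
  have h0 := hS.δ_nonneg.trans hδ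
  have hx := hS.lead_sq_le hV hN ht
  have hσ := hS.σ_le_two_add hV hN ht.le
  unfold decayBound at hx
  set d := |S.y S.o| with hd'
  have hd0 : 0 ≤ d := abs_nonneg _
  have hdδ : d ≤ δ₂ := hd.trans (by nlinarith)
  have hd2 : d ^ 2 ≤ δ₂ ^ 2 := pow_le_pow_left₀ hd0 hdδ 2
  have hd1 : d ^ 2 ≤ 1 := hd2.trans (by nlinarith)
  have hp0 := hV.decay_pow_nonneg t
  have hp1 := hV.decay_pow_le_one t
  set p := (1 - μ / 8) ^ t with hp
  set X := max (S.σ t - 2) 0 with hX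
  have hX0 : 0 ≤ X := le_max_right _ _
  have hXL : X ≤ L := max_le (by linarith [hV.σ_le t]) (by linarith)
  have hMμ : S.M / μ ≤ L := by rw [div_le_iff₀ hμ]; exact hV.M_le'
  have hX2 : X ≤ 24 * L ^ 2 * δ + 9 * L ^ 2 * S.M * d ^ 2 * t := by
    refine max_le ?_ (by positivity)
    have h1 : 3 * L * S.M * (8 * δ / μ * (1 - p)) ≤ 24 * L ^ 2 * δ :=
      calc 3 * L * S.M * (8 * δ / μ * (1 - p)) = 24 * L * δ * (S.M / μ) * (1 - p) := by ring
        _ ≤ 24 * L * δ * L * 1 := by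
          gcongr
          linarith
        _ = _ := by ring
    linarith
  have htp : S.M * t * p ≤ 8 * L := by
    have h1 := natCast_mul_mul_one_sub_pow_le (x := μ / 8) (by linarith)
      (by linarith [hV.μ_le_one]) t
    have h2 : μ * t * p ≤ 8 := by rw [← hp] at h1; linarith
    calc S.M * t * p ≤ L * μ * t * p := by gcongr; exact hV.M_le'
      _ = L * (μ * t * p) := by ring
      _ ≤ L * 8 := by gcongr
      _ = _ := by ring
  have hx2 : S.e t S.o ^ 2 ≤ 2 * δ * p + 7 * L * d ^ 2 := by nlinarith
  have e1 : X * (2 * δ * p) ≤ 48 * L ^ 2 * δ ^ 2 + 144 * L ^ 3 * δ * d ^ 2 := by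
    calc X * (2 * δ * p) ≤ (24 * L ^ 2 * δ + 9 * L ^ 2 * S.M * d ^ 2 * t) * (2 * δ * p) := by
          gcongr
      _ = 48 * L ^ 2 * δ ^ 2 * p + 18 * L ^ 2 * δ * d ^ 2 * (S.M * t * p) := by ring
      _ ≤ 48 * L ^ 2 * δ ^ 2 * 1 + 18 * L ^ 2 * δ * d ^ 2 * (8 * L) := by gcongr
      _ = _ := by ring
  have e2 : X * (7 * L * d ^ 2) ≤ 7 * L ^ 2 * d ^ 2 := by
    calc X * (7 * L * d ^ 2) ≤ L * (7 * L * d ^ 2) := by gcongr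
      _ = _ := by ring
  have hL23 : L ^ 2 ≤ L ^ 3 := pow_le_pow_right₀ hL (by norm_num)
  have e3 : 48 * L ^ 2 * δ ^ 2 ≤ 48 * L ^ 3 * δ₂ ^ 2 := by gcongr
  have e4 : 144 * L ^ 3 * δ * d ^ 2 ≤ 144 * L ^ 3 * 1 * δ₂ ^ 2 := by
    gcongr
    linarith
  have e5 : 7 * L ^ 2 * d ^ 2 ≤ 7 * L ^ 3 * δ₂ ^ 2 := by gcongr
  have := mul_le_mul_of_nonneg_left hx2 hX0
  linarith

set_option maxHeartbeats 1000000 in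
-- Compared with one step earlier, the leading contribution is still about x², and the other modes
-- change their product with the target only by L b ζ and by terms in h. Negativity of the earlier
-- correlation bounds x² + ∑ e_i y_i by |x||y|, which cancels the main terms. What remains has the
-- extra small factor δ₂ + ζ + M.
theorem Sharpens.corr_last_le (hS : S.Sharpens L δ T) (hV : S.Valid L η μ N)
    (hN : T ≤ N) {δ₂ ζ : ℝ} (hδ : δ ≤ δ₂) (hd : |S.y S.o| ≤ δ₂ ^ 2) (hδ₂ : δ₂ ≤ 1) (hζ : 0 ≤ ζ)
    (hy : ∑ i ∈ Finset.univ.erase S.o, (S.ℓ i * S.y i) ^ 2 ≤ ζ ^ 2) :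
    S.corr T ≤ 1000 * L ^ 4 * (δ₂ + ζ + S.M) * δ₂ := by
  obtain ⟨t, rfl⟩ := Nat.exists_eq_succ_of_ne_zero hS.T_pos.ne'
  rw [Nat.succ_eq_add_one] at *
  have hL := hV.one_le
  have hM := hV.M_pos
  have hM4 := hV.M_small
  have h0 := hS.δ_nonneg.trans hδ
  have ht : t < t + 1 := t.lt_succ_self
  obtain ⟨hσ, hg4, hg0, hc⟩ := hS.growth hV hN ht
  have hg := hS.neg_g_le hV hN ht
  have hx := hS.lead_sq_le hV hN ht
  have hwx := hS.excess_mul_lead_sq_le hV hN hδ hd hδ₂ ht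
  have hb := hS.decayBound_le_mul hV hδ hd hδ₂ t
  have hr := hS.rest_le hV hN ht.le
  have hr' := hS.rest_le hV hN (le_refl (t + 1))
  have hb' := hS.decayBound_le_mul hV hδ hd hδ₂ (t + 1)
  have hb1 := hS.mul_decayBound_le hV t
  have hb0 := hS.decayBound_nonneg hV t
  have hb0' := hS.decayBound_nonneg hV (t + 1)
  have hcorr := S.corr_eq t
  rw [sum_erase_corr] at hcorr
  have hcorr' := S.corr_eq (t + 1)
  rw [sum_erase_corr] at hcorr'
  have hrest0 := S.rest_nonneg t
  set b := S.decayBound L μ δ t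
  set b' := S.decayBound L μ δ (t + 1)
  set h := -S.g t with hh
  have hb1' : b ≤ 1 := by nlinarith
  -- the modes other than the leading one
  have hmodes : ∑ i ∈ Finset.univ.erase S.o, S.e (t + 1) i * S.y i ≤
      ∑ i ∈ Finset.univ.erase S.o, S.e t i * S.y i + L * (b * ζ) + h * 1 + h * (b * 1) := by
    have hterm : ∀ i ∈ Finset.univ.erase S.o, S.e (t + 1) i * S.y i ≤ S.e t i * S.y i +
        L * (|S.e t i| * |S.ℓ i * S.y i|) + h * S.y i ^ 2 + h * (|S.e t i| * |S.y i|) := by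
      intro i hi
      have hℓ0 : 0 ≤ S.ℓ i := hV.μ_pos.le.trans (hV.μ_le i)
      have hr1 := hV.damp t i (Finset.ne_of_mem_erase hi)
      have hr0 : 0 ≤ S.ℓ i * S.σ t := mul_nonneg hℓ0 (by linarith)
      have e1 : S.e (t + 1) i * S.y i = S.e t i * S.y i + S.σ t * (-(S.e t i * (S.ℓ i * S.y i))) +
          h * S.y i ^ 2 + h * ((1 - S.ℓ i * S.σ t) * (S.e t i * S.y i)) := by
        rw [hV.e_succ t (by omega), hh]; ring
      have e2 : S.σ t * (-(S.e t i * (S.ℓ i * S.y i))) ≤ L * (|S.e t i| * |S.ℓ i * S.y i|) := by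
        rw [← abs_mul]
        exact (mul_le_mul_of_nonneg_left (neg_le_abs _) (by linarith : 0 ≤ S.σ t)).trans
          (mul_le_mul_of_nonneg_right (hV.σ_le t) (abs_nonneg _))
      have e3 : (1 - S.ℓ i * S.σ t) * (S.e t i * S.y i) ≤ |S.e t i| * |S.y i| := by
        rw [← abs_mul]
        refine (mul_le_mul_of_nonneg_left (le_abs_self _) (by linarith)).trans ?_
        exact mul_le_of_le_one_left (abs_nonneg _) (by linarith)
      have e4 := mul_le_mul_of_nonneg_left e3 (by linarith : 0 ≤ h)
      linarith
    refine (Finset.sum_le_sum hterm).trans ?_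
    simp only [Finset.sum_add_distrib, ← Finset.mul_sum]
    have hy1 := hV.sum_erase_y_sq_le
    have s1 := sum_abs_mul_abs_le _ _ _ hb0 hζ hr hy
    have s2 := sum_abs_mul_abs_le _ _ _ hb0 zero_le_one hr hy1
    rw [one_pow] at hy1
    have hh0 : 0 ≤ h := by linarith
    gcongr
  have hlead := lead_corr_succ_le (x := S.e t S.o) (y := S.y S.o) hL (by linarith : 0 ≤ h)
    (by linarith) hσ (hV.σ_le t)
  have hxeq : S.e (t + 1) S.o = (1 + h) * (1 - S.σ t) * S.e t S.o + h * S.y S.o := by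
    rw [hV.e_succ t (by omega), hV.ℓ_o, hh]; ring
  simp only [← hxeq] at hlead
  set x := S.e t S.o
  set d := |S.y S.o| with hd'
  have hd0 : 0 ≤ d := abs_nonneg _
  have hdδ : d ≤ δ₂ := hd.trans (by nlinarith)
  have hd2 : d ^ 2 ≤ δ₂ ^ 2 := pow_le_pow_left₀ hd0 hdδ 2
  have hx9 : x ^ 2 ≤ 9 * L * δ₂ := by nlinarith
  have hxabs : |x| ≤ 3 * L := by
    refine abs_le_of_sq_le_sq (hx9.trans ?_) (by linarith)
    nlinarith
  have hxy : -(x * S.y S.o) ≤ |x| * d := by rw [hd', ← abs_mul]; exact neg_le_abs _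
  have hxd : |x| * d ≤ 3 * L * δ₂ ^ 2 :=
    mul_le_mul hxabs hd hd0 (by linarith)
  have hh4 : h ≤ 4 * L * S.M * δ₂ := by
    refine hg.trans ?_
    calc S.M * b ≤ S.M * (4 * L * δ₂) := by gcongr
      _ = _ := by ring
  have hhx : L * h * x ^ 2 ≤ 9 * L ^ 3 * δ₂ ^ 2 :=
    calc L * h * x ^ 2 ≤ L * (4 * L * (1 / 4) * δ₂) * (9 * L * δ₂) := by
          gcongr
          exact hh4.trans (by gcongr)
      _ = _ := by ring
  have hw : 4 * L * ((max (S.σ t - 2) 0 + L * h) * x ^ 2) ≤ 832 * L ^ 4 * δ₂ ^ 2 :=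
    calc _ = 4 * L * (max (S.σ t - 2) 0 * x ^ 2 + L * h * x ^ 2) := by ring
      _ ≤ 4 * L * (199 * L ^ 3 * δ₂ ^ 2 + 9 * L ^ 3 * δ₂ ^ 2) := by gcongr
      _ = _ := by ring
  have hbb : b' ^ 2 ≤ 16 * L ^ 2 * δ₂ ^ 2 :=
    calc b' ^ 2 ≤ (4 * L * δ₂) ^ 2 := pow_le_pow_left₀ hb0' hb' 2
      _ = _ := by ring
  have hbζ : L * (b * ζ) ≤ 4 * L ^ 2 * ζ * δ₂ :=
    calc L * (b * ζ) ≤ L * (4 * L * δ₂ * ζ) := by gcongr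
      _ = _ := by ring
  have hhb : h * (b * 1) ≤ h := by
    rw [mul_one]; exact mul_le_of_le_one_right (by linarith) hb1'
  have hxd5 : 5 * L * (|x| * d) ≤ 15 * L ^ 2 * δ₂ ^ 2 :=
    calc 5 * L * (|x| * d) ≤ 5 * L * (3 * L * δ₂ ^ 2) := by gcongr
      _ = _ := by ring
  have hxd1 : |x| * d ≤ L * (|x| * d) := le_mul_of_one_le_left (by positivity) hL
  have hL24 : L ^ 2 ≤ L ^ 4 := pow_le_pow_right₀ hL (by norm_num)
  have hL14 : L ≤ L ^ 4 := le_self_pow₀ hL (by norm_num)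
  have hL04 : 1 ≤ L ^ 4 := one_le_pow₀ hL
  have total : S.corr (t + 1) ≤ 832 * L ^ 4 * δ₂ ^ 2 + 15 * L ^ 2 * δ₂ ^ 2 + δ₂ ^ 2 +
      16 * L ^ 2 * δ₂ ^ 2 + 4 * L ^ 2 * ζ * δ₂ + 8 * L * S.M * δ₂ := by
    linarith
  refine total.trans ?_
  have f1 : 15 * L ^ 2 * δ₂ ^ 2 ≤ 15 * L ^ 4 * δ₂ ^ 2 := by gcongr
  have f2 : 16 * L ^ 2 * δ₂ ^ 2 ≤ 16 * L ^ 4 * δ₂ ^ 2 := by gcongr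
  have f3 : δ₂ ^ 2 ≤ L ^ 4 * δ₂ ^ 2 := le_mul_of_one_le_left (sq_nonneg _) hL04
  have f4 : 4 * L ^ 2 * ζ * δ₂ ≤ 4 * L ^ 4 * ζ * δ₂ := by gcongr
  have f5 : 8 * L * S.M * δ₂ ≤ 8 * L ^ 4 * S.M * δ₂ := by gcongr
  have f6 : 0 ≤ L ^ 4 * ζ * δ₂ := by positivity
  have f7 : 0 ≤ L ^ 4 * S.M * δ₂ := by positivity
  have f8 : 0 ≤ L ^ 4 * δ₂ ^ 2 := by positivity
  have e : 1000 * L ^ 4 * (δ₂ + ζ + S.M) * δ₂ = 1000 * (L ^ 4 * δ₂ ^ 2) + 1000 * (L ^ 4 * ζ * δ₂) +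
    1000 * (L ^ 4 * S.M * δ₂) := by ring
  rw [e]
  linarith

/-! ### Fall of the sharpness below the edge (Phase IV). -/

/-- One step of the energy estimate below the edge of stability. Here `D` is the distance of the
sharpness to the edge, `x` the leading mode, and `P` bounds the correlation in the other modes. -/
theorem energy_step {L η M D D' g x x' d P : ℝ} (hL : 1 ≤ L) (hη : 0 < η) (hM : 0 ≤ M)
    (hMη : M ≤ L * η ^ 2) (hD0 : 0 ≤ D) (hD1 : D ≤ 1) (hg0 : 0 ≤ g) (hg1 : g ≤ 1)
    (hgη : g ≤ 2 * L ^ 2 * η) (hd0 : 0 ≤ d) (hd1 : d ≤ 1) (hP : 0 ≤ P) (hx0 : 0 ≤ x)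
    (hx'0 : 0 ≤ x') (hD' : D' = 2 - (2 - D) * (1 - g) ^ 2) (hx' : x' ≤ (1 - D) * x + g * d)
    (hg : g ≤ M * (x ^ 2 + x * d + P)) (hx : x ≤ L / η) (hLη : 1 ≤ L / η) :
    D' ^ 2 - 40 * L ^ 2 * η * D' + 8 * M * (x' ^ 2 + d * x') ≤
      D ^ 2 - 40 * L ^ 2 * η * D + 8 * M * (x ^ 2 + d * x) + 8 * M * P := by
  set i := D' - D with hi
  have hi' : i = (2 - D) * (g * (2 - g)) := by rw [hi, hD']; ring
  have hig : g ≤ i := by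
    rw [hi']
    nlinarith [mul_nonneg hg0 (by linarith : 0 ≤ 1 - g), mul_nonneg hg0 (by linarith : 0 ≤ 1 - D),
      mul_nonneg (mul_nonneg hg0 (by linarith : 0 ≤ 1 - g)) (by linarith : 0 ≤ 1 - D)]
  have hi4 : i ≤ 4 * g := by
    rw [hi']
    nlinarith [mul_nonneg hg0 hD0, mul_nonneg hg0 hg0,
      mul_nonneg (mul_nonneg hg0 hg0) (by linarith : 0 ≤ 2 - D)]
  have hsq : D' ^ 2 - D ^ 2 ≤ 8 * g * D + 8 * L ^ 2 * η * i := by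
    have h1 : D' ^ 2 - D ^ 2 = i * (2 * D) + i * i := by rw [hi]; ring
    have h2 : i * (2 * D) ≤ 4 * g * (2 * D) := by gcongr
    have h3 : i * i ≤ 8 * L ^ 2 * η * i := by
      refine mul_le_mul_of_nonneg_right (by linarith) (by linarith)
    linarith
  -- The main growth 8gD of D² is paid for by the contraction 1-D of x², and of the linear term dx,
  -- in the energy.
  have hgD : 8 * g * D ≤ 8 * M * (D * x ^ 2 + D * (d * x) + P) := by
    have h1 : g * D ≤ M * (x ^ 2 + x * d + P) * D := by gcongr
    have h2 : P * D ≤ P := mul_le_of_le_one_right hP hD1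
    have h3 := mul_le_mul_of_nonneg_left h2 hM
    linarith
  have hx'2 : x' ^ 2 ≤ (1 - D) * x ^ 2 + g * (2 * x + 1) := by
    have h1 : x' ^ 2 ≤ ((1 - D) * x + g * d) ^ 2 := pow_le_pow_left₀ hx'0 hx' 2
    have h2 : ((1 - D) * x) ^ 2 ≤ (1 - D) * x ^ 2 := by
      rw [mul_pow]; exact mul_le_mul_of_nonneg_right (by nlinarith) (sq_nonneg _)
    have h3 : (1 - D) * x * d ≤ x := by
      have : (1 - D) * d ≤ 1 := by nlinarith
      nlinarith
    have h4 : g * d ^ 2 ≤ 1 := by nlinarith [mul_nonneg hg0 hd0]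
    have h5 := mul_le_mul_of_nonneg_left h3 hg0
    have h6 := mul_le_mul_of_nonneg_left h4 hg0
    have e : ((1 - D) * x + g * d) ^ 2 =
        ((1 - D) * x) ^ 2 + 2 * (g * ((1 - D) * x * d)) + g * (g * d ^ 2) := by ring
    linarith
  have hdx' : d * x' ≤ (1 - D) * (d * x) + g := by
    have h1 := mul_le_mul_of_nonneg_left hx' hd0
    have h2 : d * (g * d) ≤ g := by nlinarith [mul_nonneg hg0 hd0]
    linarith
  -- Together with 8L²ηi from `hsq` this error adds up to 40L²ηi, the gain from the linear term of
  -- the energy.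
  have herr : 8 * M * (g * (2 * x + 1) + g) ≤ 32 * L ^ 2 * η * i := by
    have h1 : 2 * x + 2 ≤ 4 * (L / η) := by linarith
    have hi0 : 0 ≤ i := hg0.trans hig
    calc 8 * M * (g * (2 * x + 1) + g) = 8 * M * g * (2 * x + 2) := by ring
      _ ≤ 8 * (L * η ^ 2) * i * (4 * (L / η)) := by
        gcongr
      _ = _ := by field_simp; ring
  have hsum : 8 * M * (x' ^ 2 + d * x') ≤
      8 * M * ((1 - D) * x ^ 2 + g * (2 * x + 1) + ((1 - D) * (d * x) + g)) := by gcongr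
  have hD'i : D' = D + i := by rw [hi]; ring
  have e : 40 * L ^ 2 * η * D' = 40 * L ^ 2 * η * D + 40 * L ^ 2 * η * i := by rw [hD'i]; ring
  rw [e]
  linarith

/-- The geometric factor matters: the total contribution over time is at most 2b/μ, and M/μ ≤ L. -/
theorem Sharpens.sum_erase_corr_le (hS : S.Sharpens L δ T) (hV : S.Valid L η μ N) (hN : T ≤ N)
    {t : ℕ} (hTt : T ≤ t) (htN : t ≤ N)
    (h : ∀ s, T ≤ s → s < t → 1 ≤ S.σ s ∧ 0 ≤ S.g s ∧ S.g s ≤ 1) :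
    ∑ i ∈ Finset.univ.erase S.o, S.e t i * (S.e t i + S.y i) ≤
      2 * S.decayBound L μ δ T * (1 - μ) ^ (t - T) := by
  have hb0 := hS.decayBound_nonneg hV T
  have hb1 := hS.mul_decayBound_le hV T
  have hL := hV.one_le
  have hp0 : 0 ≤ (1 - μ) ^ (t - T) := pow_nonneg (by linarith [hV.μ_le_one]) _
  refine (Finset.sum_le_sum fun i hi =>
    hV.mode_corr_le (Finset.ne_of_mem_erase hi) hTt (by omega) h).trans ?_
  rw [← Finset.mul_sum]
  simp only [mul_add, Finset.sum_add_distrib]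
  have hr := hS.rest_le hV hN le_rfl
  set b := S.decayBound L μ δ T
  have hb : b ≤ 1 := by nlinarith
  have s1 := sum_abs_mul_abs_le _ _ _ hb0 hb0 hr hr
  have s2 := sum_abs_mul_abs_le _ _ _ hb0 zero_le_one hr hV.sum_erase_y_sq_le
  have : ∑ i ∈ Finset.univ.erase S.o, |S.e T i| * |S.e T i| +
      ∑ i ∈ Finset.univ.erase S.o, |S.e T i| * |S.y i| ≤ 2 * b := by nlinarith
  rw [← mul_add]
  nlinarith

set_option maxHeartbeats 1000000 in
/-- When the sharpness falls through the edge of stability, it stays above half of it. -/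
theorem Sharpens.one_le_σ_of_fall (hS : S.Sharpens L δ T) (hV : S.Valid L η μ N) {T₃ : ℕ}
    (hT₃ : T ≤ T₃) (hT₃N : T₃ < N) (h3 : ∀ s, T ≤ s → s ≤ T₃ → 2 < S.σ s ∧ 0 < S.corr s)
    (h4 : ∀ s, T₃ < s → s ≤ N → S.σ s < 2 ∧ 0 < S.corr s) {t : ℕ} (hTt : T ≤ t) (htN : t ≤ N) :
    1 ≤ S.σ t := by
  have hN : T ≤ N := by omega
  have hL := hV.one_le
  have hM := hV.M_pos
  have hμ := hV.μ_pos
  have hη := hV.η_pos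
  have hLη := hV.L_div_η
  have hη2 := mul_pow_mul_le_one hL hη.le (by norm_num) 2 (by norm_num) hV.η_small
  have hcorr : ∀ s, T ≤ s → s ≤ N → 0 < S.corr s := fun s h1 h2 => by
    rcases le_or_gt s T₃ with h | h
    exacts [(h3 s h1 h).2, (h4 s h h2).2]
  have hg : ∀ s, T ≤ s → s ≤ N → 1 ≤ S.σ s → 0 ≤ S.g s ∧ S.g s ≤ 1 ∧ S.g s ≤ 2 * L ^ 2 * η :=
    fun s h1 h2 hσ => ⟨mul_nonneg (div_nonneg hM.le (by linarith)) (hcorr s h1 h2).le,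
      by linarith [(abs_le.1 (hV.abs_g_le_quarter hσ)).2], (abs_le.1 (hV.abs_g_le hσ)).2⟩
  have hx : ∀ s, |S.e s S.o| ^ 2 ≤ L / η ∧ |S.e s S.o| ≤ L / η := fun s => by
    have h1 : |S.e s S.o| ^ 2 ≤ L / η := by
      rw [sq_abs]
      have := hV.loss s
      rw [sum_sq_eq] at this
      linarith [S.rest_nonneg s]
    refine ⟨h1, ?_⟩
    by_contra h
    nlinarith
  have hd0 : 0 ≤ |S.y S.o| := abs_nonneg _
  have hd1 : |S.y S.o| ≤ 1 := by
    have := mul_pow_mul_le_one hL hd0 (by norm_num) 0 (by norm_num) hS.y_small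
    linarith
  set d := |S.y S.o| with hd
  have hb0 := hS.decayBound_nonneg hV T
  have hb1 := hS.mul_decayBound_le hV T
  set b := S.decayBound L μ δ T with hb
  set P : ℕ → ℝ := fun s => 2 * b * (1 - μ) ^ (s - T) with hP
  have hp0 : ∀ k : ℕ, 0 ≤ (1 - μ) ^ k := fun k => pow_nonneg (by linarith [hV.μ_le_one]) _
  have hP0 : ∀ s, 0 ≤ P s := fun s => mul_nonneg (by linarith) (hp0 _)
  -- The term P/μ prepays the geometric series of future contributions of the other modes: it drops
  -- by exactly P in each step.
  set Φ : ℕ → ℝ := fun s => (2 - S.σ s) ^ 2 - 40 * L ^ 2 * η * (2 - S.σ s) +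
    8 * S.M * (|S.e s S.o| ^ 2 + d * |S.e s S.o|) + 8 * S.M * (P s / μ) with hΦ
  -- If σ < 1, then D = 2-σ lies in (1, 2), and 40L²η ≤ 0.4 gives D² - 40L²ηD > 1/2.
  have hσΦ : ∀ s, T₃ < s → s ≤ N → Φ s ≤ 1 / 2 → 1 ≤ S.σ s := by
    intro s h1 h2 h5
    by_contra hlt
    have hσ0 := hV.σ_pos s h2
    have h6 : 0 ≤ 8 * S.M * (|S.e s S.o| ^ 2 + d * |S.e s S.o|) := by positivity
    have h7 : 0 ≤ 8 * S.M * (P s / μ) :=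
      mul_nonneg (by linarith) (div_nonneg (hP0 s) hμ.le)
    simp only [hΦ] at h5
    nlinarith
  have main : ∀ s, T₃ + 1 ≤ s → s ≤ N →
      (∀ r, T ≤ r → r ≤ s → 1 ≤ S.σ r) ∧ Φ s ≤ 1 / 2 := by
    intro s hs
    induction s, hs using Nat.le_induction with
    | base =>
      intro hsN
      have hΦ0 : Φ (T₃ + 1) ≤ 1 / 2 := by
        have hσ3 := h3 T₃ hT₃ le_rfl
        have hg3 := hg T₃ hT₃ hT₃N.le (by linarith [hσ3.1])
        have hσ4 := h4 (T₃ + 1) (by omega) hsN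
        -- The first iteration below the edge overshoots by at most one step, that is by 4g.
        have hD : 2 - S.σ (T₃ + 1) ≤ 8 * L ^ 2 * η := by
          rw [hV.σ_succ T₃ hT₃N.le]
          nlinarith [sq_nonneg (1 - S.g T₃)]
        have hD2 : (2 - S.σ (T₃ + 1)) ^ 2 ≤ (8 / 100) ^ 2 :=
          pow_le_pow_left₀ (by linarith) (by linarith) 2
        have hD3 : 0 ≤ 40 * L ^ 2 * η * (2 - S.σ (T₃ + 1)) :=
          mul_nonneg (by positivity) (by linarith)
        have hx4 := hx (T₃ + 1)
        have h8 : 8 * S.M * (|S.e (T₃ + 1) S.o| ^ 2 + d * |S.e (T₃ + 1) S.o|) ≤ 16 / 100 := by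
          have h9 : d * |S.e (T₃ + 1) S.o| ≤ L / η :=
            (mul_le_of_le_one_left (abs_nonneg _) hd1).trans hx4.2
          calc _ ≤ 8 * (L * η ^ 2) * (L / η + L / η) := by
                gcongr
                · exact hV.M_le
                · exact hx4.1
            _ = 16 * (L ^ 2 * η) := by field_simp; ring
            _ ≤ _ := by linarith
        have h10 : 8 * S.M * (P (T₃ + 1) / μ) ≤ 16 / 50 := by
          have h11 : P (T₃ + 1) ≤ 2 * b :=
            mul_le_of_le_one_right (by linarith)
              (pow_le_one₀ (by linarith [hV.μ_le_one]) (by linarith))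
          have h12 : S.M / μ ≤ L := by rw [div_le_iff₀ hμ]; exact hV.M_le'
          calc 8 * S.M * (P (T₃ + 1) / μ) = 8 * (S.M / μ) * P (T₃ + 1) := by ring
            _ ≤ 8 * L * (2 * b) := by
              gcongr
              exact hP0 _
            _ ≤ _ := by linarith
        simp only [hΦ]
        linarith
      refine ⟨fun r h1 h2 => ?_, hΦ0⟩
      rcases Nat.lt_or_ge T₃ r with h | h
      · obtain rfl : r = T₃ + 1 := by omega
        exact hσΦ _ (by omega) hsN hΦ0
      · linarith [(h3 r h1 h).1]
    | succ s hs ih =>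
      intro hsN
      obtain ⟨ih1, ih2⟩ := ih (by omega)
      have hσ := ih1 s (by omega) le_rfl
      have hgs := hg s (by omega) (by omega) hσ
      have hσ2 := (h4 s (by omega) (by omega)).1
      have hc := hS.sum_erase_corr_le hV hN (t := s) (by omega) (by omega) fun r h1 h2 =>
        have hr := hg r h1 (by omega) (ih1 r h1 h2.le)
        ⟨ih1 r h1 h2.le, hr.1, hr.2.1⟩
      have hgle : S.g s ≤ S.M * (|S.e s S.o| ^ 2 + |S.e s S.o| * d + P s) := by
        have h5 : S.corr s ≤ |S.e s S.o| ^ 2 + |S.e s S.o| * d + P s := by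
          rw [S.corr_eq s, sq_abs, hd, ← abs_mul]
          nlinarith [le_abs_self (S.e s S.o * S.y S.o)]
        have h6 : S.M / S.σ s ≤ S.M := div_le_self hM.le hσ
        exact mul_le_mul h6 h5 (hcorr s (by omega) (by omega)).le hM.le
      have hx' : |S.e (s + 1) S.o| ≤ (1 - (2 - S.σ s)) * |S.e s S.o| + S.g s * d := by
        rw [hV.e_succ s (by omega), hV.ℓ_o]
        refine (abs_sub _ _).trans ?_
        rw [abs_mul, abs_mul (S.g s), abs_of_nonneg hgs.1, abs_mul,
          abs_of_nonneg (by linarith [hgs.2.1] : 0 ≤ 1 - S.g s),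
          abs_of_nonpos (by linarith : 1 - 1 * S.σ s ≤ 0)]
        refine add_le_add (mul_le_mul_of_nonneg_right ?_ (abs_nonneg _)) le_rfl
        nlinarith [hgs.1]
      have hstep := energy_step hL hη hM.le hV.M_le (by linarith : 0 ≤ 2 - S.σ s) (by linarith)
        hgs.1 hgs.2.1 hgs.2.2 hd0 hd1 (hP0 s) (abs_nonneg (S.e s S.o))
        (abs_nonneg (S.e (s + 1) S.o)) (D' := 2 - S.σ (s + 1))
        (by rw [hV.σ_succ s (by omega)]; ring) hx' hgle (hx s).2 hLη
      have hPs : P (s + 1) / μ = P s / μ - P s := by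
        simp only [hP]
        rw [show s + 1 - T = s - T + 1 by omega, pow_succ]
        field_simp
      have hΦs : Φ (s + 1) ≤ Φ s := by
        simp only [hΦ]
        rw [hPs]
        linarith
      refine ⟨fun r h1 h2 => ?_, hΦs.trans ih2⟩
      rcases Nat.lt_or_ge s r with h | h
      · obtain rfl : r = s + 1 := by omega
        exact hσΦ _ (by omega) hsN (hΦs.trans ih2)
      · exact ih1 r h1 h
  exact (main N hT₃N le_rfl).1 t hTt htN

end ModeSystem

/-! ### Norms, gradients of the loss, and Parseval's identity. -/

theorem l2norm_nonneg {m : ℕ} (x : Fin m → ℝ) : 0 ≤ l2norm x := norm_nonneg _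

theorem l2norm_sq {m : ℕ} (x : Fin m → ℝ) : l2norm x ^ 2 = x ⬝ᵥ x := by
  rw [l2norm, EuclideanSpace.real_norm_sq_eq]
  simp [dotProduct, sq]

theorem deriv_mul_l2norm_sq {m : ℕ} (a : ℝ) (x b : Fin m → ℝ) :
    deriv (fun s : ℝ => a * l2norm (x + s • b) ^ 2) 0 = 2 * a * (x ⬝ᵥ b) := by
  have h : (fun s : ℝ => a * l2norm (x + s • b) ^ 2) =
      fun s : ℝ => a * (x ⬝ᵥ x + s * (2 * (x ⬝ᵥ b)) + s ^ 2 * (b ⬝ᵥ b)) := by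
    funext s
    rw [l2norm_sq]
    simp only [add_dotProduct, dotProduct_add, smul_dotProduct, dotProduct_smul, smul_eq_mul,
      dotProduct_comm b x]
    ring
  rw [h]
  have h1 := ((((hasDerivAt_id (0 : ℝ)).mul_const (2 * (x ⬝ᵥ b))).const_add (x ⬝ᵥ x)).add
    (((hasDerivAt_id (0 : ℝ)).pow 2).mul_const (b ⬝ᵥ b))).const_mul a
  refine (h1.congr_deriv ?_).deriv
  simp
  ring

theorem gradFirst_eq {n d h : ℕ} (X : Matrix (Fin d) (Fin n) ℝ) (Y : Fin n → ℝ)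
    (W₁ : Matrix (Fin h) (Fin d) ℝ) (W₂ : Fin h → ℝ) :
    gradFirst X Y W₁ W₂ =
      (1 / (n : ℝ)) • Matrix.vecMulVec W₂ (X *ᵥ (W₂ ᵥ* (W₁ * X) - Y)) := by
  ext i j
  have h : ∀ s : ℝ, W₂ ᵥ* ((W₁ + s • Matrix.single i j (1 : ℝ)) * X) - Y =
      (W₂ ᵥ* (W₁ * X) - Y) + s • (W₂ i • X j) := by
    intro s
    have : W₂ ᵥ* (Matrix.single i j (1 : ℝ) * X) = W₂ i • X j := by
      rw [← Matrix.vecMul_vecMul]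
      ext k
      simp [Matrix.vecMul, dotProduct, Matrix.single_apply, Finset.sum_ite_eq, ite_and]
    rw [Matrix.add_mul, Matrix.vecMul_add, Matrix.smul_mul, Matrix.vecMul_smul, this]
    abel
  simp only [gradFirst, Matrix.of_apply, sqLoss, h, deriv_mul_l2norm_sq, Matrix.smul_apply,
    Matrix.vecMulVec_apply, Matrix.mulVec, dotProduct_smul, smul_eq_mul]
  rw [dotProduct_comm (X j)]
  ring

theorem gradSecond_eq {n d h : ℕ} (X : Matrix (Fin d) (Fin n) ℝ) (Y : Fin n → ℝ)
    (W₁ : Matrix (Fin h) (Fin d) ℝ) (W₂ : Fin h → ℝ) :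
    gradSecond X Y W₁ W₂ = (1 / (n : ℝ)) • ((W₁ * X) *ᵥ (W₂ ᵥ* (W₁ * X) - Y)) := by
  ext i
  have h : ∀ s : ℝ, (W₂ + s • Pi.single i (1 : ℝ)) ᵥ* (W₁ * X) - Y =
      (W₂ ᵥ* (W₁ * X) - Y) + s • (W₁ * X) i := by
    intro s
    rw [Matrix.add_vecMul, Matrix.smul_vecMul, Matrix.single_one_vecMul]
    simp only [Matrix.row]
    abel
  simp only [gradSecond, sqLoss, h, deriv_mul_l2norm_sq, Pi.smul_apply, Matrix.mulVec, smul_eq_mul]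
  rw [dotProduct_comm ((W₁ * X) i)]
  ring

theorem vecMul_vecMulVec_self {h n : ℕ} {u : Fin h → ℝ} (hu : l2norm u = 1) (w : Fin n → ℝ) :
    u ᵥ* Matrix.vecMulVec u w = w := by
  have : u ⬝ᵥ u = 1 := by rw [← l2norm_sq, hu, one_pow]
  rw [Matrix.vecMul_vecMulVec, this, one_smul]

/-- Parseval's identity in coordinates. -/
theorem sum_dotProduct_mul_dotProduct {m : ℕ} {q : Fin m → Fin m → ℝ}
    (hq : Orthonormal ℝ fun i => (WithLp.toLp 2 (q i) : EuclideanSpace ℝ (Fin m)))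
    (x y : Fin m → ℝ) : ∑ i, (x ⬝ᵥ q i) * (y ⬝ᵥ q i) = x ⬝ᵥ y := by
  rcases isEmpty_or_nonempty (Fin m)
  · simp [dotProduct]
  let b := basisOfOrthonormalOfCardEqFinrank hq (by simp)
  have hb : ⇑b = fun i => (WithLp.toLp 2 (q i) : EuclideanSpace ℝ (Fin m)) :=
    coe_basisOfOrthonormalOfCardEqFinrank hq _
  let B := b.toOrthonormalBasis (hb ▸ hq)
  have hB : ∀ i, B i = (WithLp.toLp 2 (q i) : EuclideanSpace ℝ (Fin m)) := fun i => by
    simp [B, hb]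
  have h := B.sum_inner_mul_inner (WithLp.toLp 2 x) (WithLp.toLp 2 y)
  simp only [hB, EuclideanSpace.inner_toLp_toLp, star_trivial] at h
  rw [dotProduct_comm x y, ← h]
  refine Finset.sum_congr rfl fun i _ => ?_
  rw [dotProduct_comm x]

/-! ### Rank-one dynamics and the passage to normalized coordinates. -/

namespace Run

variable {n d h : ℕ} {R : Run n d h} {ρ : ℝ} {t₀ : ℕ}

theorem IsGD.first_succ (hgd : R.IsGD) {t : ℕ} (ih1 : R.W₁ t * R.X = Matrix.vecMulVec R.u (R.v t))
    (ih2 : R.W₂ t = R.c t • R.u) : R.W₁ (t + 1) * R.X = Matrix.vecMulVec R.u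
      (R.v t - (R.η / n * R.c t) • ((R.X *ᵥ R.E t) ᵥ* R.X)) := by
  have hE : R.W₂ t ᵥ* (R.W₁ t * R.X) - R.Y = R.E t := rfl
  rw [(hgd t).1, gradFirst_eq, hE, Matrix.sub_mul, ih1, ih2, Matrix.smul_mul, Matrix.smul_mul, Matrix.vecMulVec_mul]
  ext i j
  simp [Matrix.vecMulVec_apply]
  ring

theorem IsGD.second_succ (hgd : R.IsGD) {t : ℕ}
    (ih1 : R.W₁ t * R.X = Matrix.vecMulVec R.u (R.v t)) (ih2 : R.W₂ t = R.c t • R.u) :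
    R.W₂ (t + 1) = (R.c t - R.η / n * (R.E t ⬝ᵥ R.v t)) • R.u := by
  have hE : R.W₂ t ᵥ* (R.W₁ t * R.X) - R.Y = R.E t := rfl
  rw [(hgd t).2, gradSecond_eq, hE, ih1, ih2, Matrix.vecMulVec_mulVec, dotProduct_comm (R.E t)]
  ext i
  simp
  ring

theorem v_eq_of_rankOne {t : ℕ} {w : Fin n → ℝ} (hu : l2norm R.u = 1)
    (h1 : R.W₁ t * R.X = Matrix.vecMulVec R.u w) : R.v t = w := by
  rw [v, h1, vecMul_vecMulVec_self hu]

theorem c_eq_of_rankOne {t : ℕ} {k : ℝ} (hu : l2norm R.u = 1) (h2 : R.W₂ t = k • R.u) :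
    R.c t = k := by
  rw [c, h2, smul_dotProduct, ← l2norm_sq, hu, one_pow, smul_eq_mul, mul_one]

/-- With W₂ = cu and W₁X = uvᵀ both gradients point along u, so every update stays in the rank-one
family with the same u. -/
theorem IsGD.rankOne (hgd : R.IsGD) (h1 : R.RankOneAssumption ρ t₀) {t : ℕ} (ht : t₀ ≤ t) :
    R.W₁ t * R.X = Matrix.vecMulVec R.u (R.v t) ∧ R.W₂ t = R.c t • R.u := by
  induction t, ht using Nat.le_induction with
  | base => exact ⟨h1.first, h1.second⟩
  | succ t ht ih =>
    have e1 := hgd.first_succ ih.1 ih.2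
    have e2 := hgd.second_succ ih.1 ih.2
    exact ⟨by rw [v_eq_of_rankOne h1.unit e1, e1], by rw [c_eq_of_rankOne h1.unit e2, e2]⟩

theorem IsGD.v_succ (hgd : R.IsGD) (h1 : R.RankOneAssumption ρ t₀) {t : ℕ} (ht : t₀ ≤ t) :
    R.v (t + 1) = R.v t - (R.η / n * R.c t) • ((R.X *ᵥ R.E t) ᵥ* R.X) :=
  v_eq_of_rankOne h1.unit (hgd.first_succ (hgd.rankOne h1 ht).1 (hgd.rankOne h1 ht).2)

theorem IsGD.c_succ (hgd : R.IsGD) (h1 : R.RankOneAssumption ρ t₀) {t : ℕ} (ht : t₀ ≤ t) :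
    R.c (t + 1) = R.c t - R.η / n * (R.E t ⬝ᵥ R.v t) :=
  c_eq_of_rankOne h1.unit (hgd.second_succ (hgd.rankOne h1 ht).1 (hgd.rankOne h1 ht).2)

theorem IsGD.F_eq (hgd : R.IsGD) (h1 : R.RankOneAssumption ρ t₀) {t : ℕ} (ht : t₀ ≤ t) :
    R.F t = R.c t • R.v t := by
  obtain ⟨ih1, ih2⟩ := hgd.rankOne h1 ht
  rw [F, ih1, ih2, Matrix.smul_vecMul, vecMul_vecMulVec_self h1.unit]

theorem IsSpectral.kernel_dotProduct (hs : R.IsSpectral) (x : Fin n → ℝ) (i : Fin n) :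
    ((R.X *ᵥ x) ᵥ* R.X) ⬝ᵥ R.q i = R.lam i * (x ⬝ᵥ R.q i) := by
  rw [← Matrix.dotProduct_mulVec, ← Matrix.vecMul_transpose, ← Matrix.dotProduct_mulVec,
    Matrix.mulVec_mulVec, hs.q_eigen, dotProduct_smul, smul_eq_mul]

theorem IsSpectral.parseval (hs : R.IsSpectral) (x y : Fin n → ℝ) :
    ∑ i, (x ⬝ᵥ R.q i) * (y ⬝ᵥ R.q i) = x ⬝ᵥ y :=
  sum_dotProduct_mul_dotProduct hs.q_orthonormal x y

theorem IsSpectral.sum_sq (hs : R.IsSpectral) (x : Fin n → ℝ) :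
    ∑ i, (x ⬝ᵥ R.q i) ^ 2 = l2norm x ^ 2 := by
  rw [l2norm_sq, ← hs.parseval]
  exact Finset.sum_congr rfl fun i _ => sq _

/-- The training run in normalized coordinates, with time starting at `T`. -/
noncomputable def modes [NeZero n] (R : Run n d h) (T : ℕ) : ModeSystem (Fin n) where
  o := 0
  ℓ i := R.lam i / R.lam 0
  y i := (R.Y ⬝ᵥ R.q i) / l2norm R.Y
  M := R.η ^ 2 * R.lam 0 * l2norm R.Y ^ 2 / n ^ 2
  e t i := (R.E (T + t) ⬝ᵥ R.q i) / l2norm R.Y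
  σ t := R.η * R.sharpness (T + t)

section Modes

variable [NeZero n] {T t : ℕ}

theorem IsSpectral.sum_sq_modes (hs : R.IsSpectral) :
    ∑ i, (R.modes T).e t i ^ 2 = l2norm (R.E (T + t)) ^ 2 / l2norm R.Y ^ 2 := by
  simp only [modes, div_pow, ← Finset.sum_div, hs.sum_sq]

theorem IsSpectral.sum_sq_modes_y (hs : R.IsSpectral) (hY : 0 < l2norm R.Y) :
    ∑ i, (R.modes T).y i ^ 2 = 1 := by
  simp only [modes, div_pow, ← Finset.sum_div, hs.sum_sq]
  exact div_self (by positivity)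

theorem IsSpectral.corr_modes (hs : R.IsSpectral) :
    (R.modes T).corr t = (R.E (T + t) ⬝ᵥ R.F (T + t)) / l2norm R.Y ^ 2 := by
  have hF : R.F (T + t) = R.E (T + t) + R.Y := by rw [E]; abel
  rw [ModeSystem.corr, hF, ← hs.parseval, Finset.sum_div]
  refine Finset.sum_congr rfl fun i _ => ?_
  simp only [modes, add_dotProduct]
  ring

theorem IsSpectral.g_modes (hs : R.IsSpectral) (hη : 0 < R.η) (hlam : 0 < R.lam 0)
    (hY : 0 < l2norm R.Y) (hc : R.c (T + t) ≠ 0) :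
    (R.modes T).g t = R.η / (n * R.c (T + t) ^ 2) * (R.E (T + t) ⬝ᵥ R.F (T + t)) := by
  have hn : (n : ℝ) ≠ 0 := Nat.cast_ne_zero.2 (NeZero.ne n)
  rw [ModeSystem.g, hs.corr_modes]
  simp only [modes, sharpness]
  field_simp

theorem IsGD.c_succ_modes (hgd : R.IsGD) (hs : R.IsSpectral) (h1 : R.RankOneAssumption ρ t₀)
    (hη : 0 < R.η) (hlam : 0 < R.lam 0) (hY : 0 < l2norm R.Y) (ht : t₀ ≤ T + t)
    (hc : R.c (T + t) ≠ 0) : R.c (T + t + 1) = R.c (T + t) * (1 - (R.modes T).g t) := by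
  have hn : (n : ℝ) ≠ 0 := Nat.cast_ne_zero.2 (NeZero.ne n)
  rw [hgd.c_succ h1 ht, hs.g_modes hη hlam hY hc, hgd.F_eq h1 ht, dotProduct_smul, smul_eq_mul]
  field_simp

theorem IsGD.e_succ_modes (hgd : R.IsGD) (hs : R.IsSpectral) (h1 : R.RankOneAssumption ρ t₀)
    (hη : 0 < R.η) (hlam : 0 < R.lam 0) (hY : 0 < l2norm R.Y) (ht : t₀ ≤ T + t)
    (hc : R.c (T + t) ≠ 0) (i : Fin n) :
    (R.modes T).e (t + 1) i = (1 - (R.modes T).g t) *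
      (1 - (R.modes T).ℓ i * (R.modes T).σ t) * (R.modes T).e t i -
        (R.modes T).g t * (R.modes T).y i := by
  have hn : (n : ℝ) ≠ 0 := Nat.cast_ne_zero.2 (NeZero.ne n)
  have hvq : R.c (T + t) * (R.v (T + t) ⬝ᵥ R.q i) = R.E (T + t) ⬝ᵥ R.q i + R.Y ⬝ᵥ R.q i := by
    rw [← add_dotProduct, E, sub_add_cancel, hgd.F_eq h1 ht, smul_dotProduct, smul_eq_mul]
  have hE : R.E (T + t + 1) ⬝ᵥ R.q i = R.c (T + t) * (1 - (R.modes T).g t) *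
      (R.v (T + t) ⬝ᵥ R.q i - R.η / n * R.c (T + t) * (R.lam i * (R.E (T + t) ⬝ᵥ R.q i))) -
      R.Y ⬝ᵥ R.q i := by
    rw [E, hgd.F_eq h1 (ht.trans (Nat.le_succ _)), hgd.c_succ_modes hs h1 hη hlam hY ht hc,
      hgd.v_succ h1 ht, sub_dotProduct, smul_dotProduct, sub_dotProduct, smul_dotProduct,
      hs.kernel_dotProduct, smul_eq_mul, smul_eq_mul]
  have hE' : R.E (T + t + 1) ⬝ᵥ R.q i = (1 - (R.modes T).g t) *
      (R.E (T + t) ⬝ᵥ R.q i + R.Y ⬝ᵥ R.q i -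
        R.η / n * R.c (T + t) ^ 2 * R.lam i * (R.E (T + t) ⬝ᵥ R.q i)) - R.Y ⬝ᵥ R.q i := by
    rw [hE, ← hvq]; ring
  have e1 : (R.modes T).e (t + 1) i = (R.E (T + t + 1) ⬝ᵥ R.q i) / l2norm R.Y := rfl
  have e2 : (R.modes T).ℓ i * (R.modes T).σ t = R.η / n * R.c (T + t) ^ 2 * R.lam i := by
    simp only [modes, sharpness]; field_simp
  rw [e1, hE', e2]
  simp only [modes]
  field_simp
  ring

theorem IsGD.σ_succ_modes (hgd : R.IsGD) (hs : R.IsSpectral) (h1 : R.RankOneAssumption ρ t₀)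
    (hη : 0 < R.η) (hlam : 0 < R.lam 0) (hY : 0 < l2norm R.Y) (ht : t₀ ≤ T + t)
    (hc : R.c (T + t) ≠ 0) :
    (R.modes T).σ (t + 1) = (R.modes T).σ t * (1 - (R.modes T).g t) ^ 2 := by
  have e1 : (R.modes T).σ (t + 1) = R.η * (R.lam 0 / n * R.c (T + t + 1) ^ 2) := rfl
  have e2 : (R.modes T).σ t = R.η * (R.lam 0 / n * R.c (T + t) ^ 2) := rfl
  rw [e1, e2, hgd.c_succ_modes hs h1 hη hlam hY ht hc]
  ring

/-- The growth of the first layer in normalized coordinates. -/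
theorem IsGD.v_growth_modes (hgd : R.IsGD) (hs : R.IsSpectral) (h1 : R.RankOneAssumption ρ t₀)
    (hlam : 0 < R.lam 0) (hY : 0 < l2norm R.Y) (ht : t₀ ≤ T + t) :
    R.c (T + t) ^ 2 * (l2norm (R.v (T + t + 1)) ^ 2 - l2norm (R.v (T + t)) ^ 2) =
      l2norm R.Y ^ 2 * ∑ i, (R.modes T).ℓ i * (R.modes T).σ t *
        ((R.modes T).ℓ i * (R.modes T).σ t * (R.modes T).e t i ^ 2 -
          2 * ((R.modes T).e t i * ((R.modes T).e t i + (R.modes T).y i))) := by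
  have hn : (n : ℝ) ≠ 0 := Nat.cast_ne_zero.2 (NeZero.ne n)
  rw [← hs.sum_sq, ← hs.sum_sq, ← Finset.sum_sub_distrib, Finset.mul_sum, Finset.mul_sum]
  refine Finset.sum_congr rfl fun i _ => ?_
  have hvq : R.c (T + t) * (R.v (T + t) ⬝ᵥ R.q i) = R.E (T + t) ⬝ᵥ R.q i + R.Y ⬝ᵥ R.q i := by
    rw [← add_dotProduct, E, sub_add_cancel, hgd.F_eq h1 ht, smul_dotProduct, smul_eq_mul]
  have e2 : (R.modes T).ℓ i * (R.modes T).σ t = R.η / n * R.c (T + t) ^ 2 * R.lam i := by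
    simp only [modes, sharpness]; field_simp
  rw [hgd.v_succ h1 ht, sub_dotProduct, smul_dotProduct, hs.kernel_dotProduct, smul_eq_mul, e2]
  have e3 : l2norm R.Y ^ 2 * (R.η / n * R.c (T + t) ^ 2 * R.lam i *
      (R.η / n * R.c (T + t) ^ 2 * R.lam i * (R.modes T).e t i ^ 2 -
        2 * ((R.modes T).e t i * ((R.modes T).e t i + (R.modes T).y i)))) =
      R.η / n * R.c (T + t) ^ 2 * R.lam i *
      (R.η / n * R.c (T + t) ^ 2 * R.lam i * (R.E (T + t) ⬝ᵥ R.q i) ^ 2 -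
        2 * ((R.E (T + t) ⬝ᵥ R.q i) * (R.E (T + t) ⬝ᵥ R.q i + R.Y ⬝ᵥ R.q i))) := by
    simp only [modes]
    field_simp
  rw [e3, ← hvq]
  ring

end Modes

end Run

/-! ### Consequences of the spectral assumptions. -/

namespace Run

variable {n d h : ℕ} {R : Run n d h}

/-- The right side does not involve the basis. This allows passing from `q` to the singular vectors
built from `p` even when eigenvalues coincide. -/
theorem sum_eigenvalue_mul_sq {n d : ℕ} {X : Matrix (Fin d) (Fin n) ℝ} {q : Fin n → Fin n → ℝ}
    {lam : Fin n → ℝ} (hq : Orthonormal ℝ fun i => (WithLp.toLp 2 (q i) : EuclideanSpace ℝ (Fin n)))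
    (he : ∀ i, (Xᵀ * X) *ᵥ q i = lam i • q i) (x : Fin n → ℝ) :
    ∑ i, lam i * (x ⬝ᵥ q i) ^ 2 = (X *ᵥ x) ⬝ᵥ (X *ᵥ x) := by
  have h1 : (X *ᵥ x) ⬝ᵥ (X *ᵥ x) = ((Xᵀ * X) *ᵥ x) ⬝ᵥ x := by
    rw [← Matrix.mulVec_mulVec, Matrix.mulVec_transpose, ← Matrix.dotProduct_mulVec]
  have h2 : ∀ i, ((Xᵀ * X) *ᵥ x) ⬝ᵥ q i = lam i * (x ⬝ᵥ q i) := fun i => by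
    rw [← Matrix.mulVec_mulVec, Matrix.mulVec_transpose, ← Matrix.dotProduct_mulVec,
      ← Matrix.vecMul_transpose, ← Matrix.dotProduct_mulVec, Matrix.mulVec_mulVec, he,
      dotProduct_smul, smul_eq_mul]
  rw [h1, ← sum_dotProduct_mul_dotProduct hq]
  exact Finset.sum_congr rfl fun i _ => by rw [h2]; ring

/-- The right singular vectors belonging to the left singular vectors `p`. -/
theorem IsSpectral.exists_singular_basis (hs : R.IsSpectral) (hpos : ∀ i, 0 < R.lam i) :
    ∃ b : Fin n → Fin n → ℝ,
      (Orthonormal ℝ fun i => (WithLp.toLp 2 (b i) : EuclideanSpace ℝ (Fin n))) ∧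
      (∀ i, (R.Xᵀ * R.X) *ᵥ b i = R.lam i • b i) ∧
      ∀ i, (R.Y ⬝ᵥ b i) ^ 2 = R.lam i * (R.β ⬝ᵥ R.p i) ^ 2 := by
  have hdot : ∀ (x : Fin d → ℝ) i, (x ᵥ* R.X) ⬝ᵥ (R.Xᵀ *ᵥ R.p i) = R.lam i * (x ⬝ᵥ R.p i) := by
    intro x i
    rw [← Matrix.dotProduct_mulVec, Matrix.mulVec_mulVec, hs.p_eigen, dotProduct_smul, smul_eq_mul]
  have hp : ∀ i j, R.p i ⬝ᵥ R.p j = if i = j then 1 else 0 := by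
    intro i j
    have := orthonormal_iff_ite.1 hs.p_orthonormal i j
    rw [EuclideanSpace.inner_toLp_toLp, star_trivial, dotProduct_comm] at this
    exact this
  refine ⟨fun i => (√(R.lam i))⁻¹ • (R.Xᵀ *ᵥ R.p i), ?_, ?_, ?_⟩
  · rw [orthonormal_iff_ite]
    intro i j
    rw [EuclideanSpace.inner_toLp_toLp, star_trivial, smul_dotProduct, dotProduct_smul]
    have h1 : (R.Xᵀ *ᵥ R.p j) ⬝ᵥ (R.Xᵀ *ᵥ R.p i) = R.lam i * (R.p j ⬝ᵥ R.p i) := by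
      rw [Matrix.mulVec_transpose R.X (R.p j)]; exact hdot _ _
    rw [h1, hp]
    split_ifs with h2 h3 h3
    · subst h2
      have := hpos j
      have h4 := Real.sqrt_pos.2 this
      simp only [smul_eq_mul]
      field_simp
      exact (Real.sq_sqrt this.le).symm
    · exact absurd h2.symm h3
    · exact absurd h3.symm h2
    · simp
  · intro i
    rw [Matrix.mulVec_smul, ← Matrix.mulVec_mulVec, Matrix.mulVec_mulVec _ R.X, hs.p_eigen,
      Matrix.mulVec_smul, smul_comm]
  · intro i
    have := hpos i
    have h4 := Real.sqrt_pos.2 this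
    rw [dotProduct_smul, Y, hdot, smul_eq_mul, mul_pow, inv_pow, Real.sq_sqrt this.le]
    field_simp

theorem eigenvectors_orthogonal {n : ℕ} {A : Matrix (Fin n) (Fin n) ℝ} (hA : Aᵀ = A)
    {x y : Fin n → ℝ} {l l' : ℝ} (hx : A *ᵥ x = l • x) (hy : A *ᵥ y = l' • y) (hl : l ≠ l') :
    x ⬝ᵥ y = 0 := by
  have h1 : (A *ᵥ x) ⬝ᵥ y = x ⬝ᵥ (A *ᵥ y) := by
    rw [Matrix.dotProduct_mulVec, ← Matrix.mulVec_transpose, hA]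
  rw [hx, hy, smul_dotProduct, dotProduct_smul, smul_eq_mul, smul_eq_mul] at h1
  have : (l - l') * (x ⬝ᵥ y) = 0 := by linarith
  exact (mul_eq_zero.1 this).resolve_left (sub_ne_zero.2 hl)

section Bounds

variable [NeZero n] {a γ K ρ : ℝ}

theorem natCast_pos_of_neZero (n : ℕ) [NeZero n] : (0 : ℝ) < n :=
  Nat.cast_pos.2 (Nat.pos_of_ne_zero (NeZero.ne n))

theorem DataAssumption.lam_ge (hd : R.DataAssumption a γ K ρ) (hs : R.IsSpectral) (i : Fin n) :
    (n : ℝ) ^ a / K ≤ R.lam i := by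
  obtain ⟨k, -, hkn, -, hbulk, -⟩ := hd.spectrum
  rcases le_or_gt k i with hi | hi
  · exact (hbulk i hi).1
  · exact (hbulk ⟨k, hkn⟩ le_rfl).1.trans (hs.antitone (Fin.le_def.2 hi.le))

theorem DataAssumption.lam_pos (hd : R.DataAssumption a γ K ρ) (hs : R.IsSpectral) (hK : 1 ≤ K)
    (i : Fin n) : 0 < R.lam i :=
  (div_pos (Real.rpow_pos_of_pos (natCast_pos_of_neZero n) a) (by linarith)).trans_le
    (hd.lam_ge hs i)

theorem DataAssumption.Y_pos (hd : R.DataAssumption a γ K ρ) (hK : 1 ≤ K) : 0 < l2norm R.Y :=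
  (div_pos (Real.sqrt_pos.2 (natCast_pos_of_neZero n)) (by linarith)).trans_le hd.label.1

theorem DataAssumption.Y_sq (hd : R.DataAssumption a γ K ρ) (hK : 1 ≤ K) :
    n ≤ K ^ 2 * l2norm R.Y ^ 2 ∧ l2norm R.Y ^ 2 ≤ K ^ 2 * n := by
  have hn := natCast_pos_of_neZero n
  have h1 := hd.label.1
  have h2 := hd.label.2
  have hs := Real.sq_sqrt hn.le
  have hs0 := Real.sqrt_nonneg (n : ℝ)
  rw [div_le_iff₀ (by linarith)] at h1
  constructor
  · calc (n : ℝ) = √n ^ 2 := hs.symm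
      _ ≤ (l2norm R.Y * K) ^ 2 := pow_le_pow_left₀ hs0 h1 2
      _ = _ := by ring
  · calc l2norm R.Y ^ 2 ≤ (K * √n) ^ 2 := pow_le_pow_left₀ (l2norm_nonneg _) h2 2
      _ = _ := by rw [mul_pow, hs]

theorem DataAssumption.target_sq (hd : R.DataAssumption a γ K ρ) (hK : 1 ≤ K) (i : Fin n) :
    l2norm R.β ^ 2 ≤ K ^ 2 * n * (R.β ⬝ᵥ R.p i) ^ 2 ∧
      n * (R.β ⬝ᵥ R.p i) ^ 2 ≤ K ^ 2 * l2norm R.β ^ 2 := by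
  have hn := natCast_pos_of_neZero n
  have hs := Real.sq_sqrt hn.le
  have hs0 := Real.sqrt_pos.2 hn
  obtain ⟨h1, h2⟩ := hd.target i
  have hK0 : 0 < K := by linarith
  have hβ : 0 < l2norm R.β := by
    refine (l2norm_nonneg _).lt_of_ne fun h0 => ?_
    rw [← h0, div_zero] at h1
    have : 0 < 1 / (K * √n) := by positivity
    linarith
  rw [div_le_div_iff₀ (by positivity) hβ, one_mul] at h1
  rw [div_le_div_iff₀ hβ hs0] at h2
  constructor
  · calc l2norm R.β ^ 2 ≤ (|R.β ⬝ᵥ R.p i| * (K * √n)) ^ 2 := pow_le_pow_left₀ hβ.le h1 2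
      _ = _ := by rw [mul_pow, mul_pow, hs, sq_abs]; ring
  · calc n * (R.β ⬝ᵥ R.p i) ^ 2 = (|R.β ⬝ᵥ R.p i| * √n) ^ 2 := by rw [mul_pow, hs, sq_abs]; ring
      _ ≤ (K * l2norm R.β) ^ 2 := pow_le_pow_left₀ (by positivity) h2 2
      _ = _ := by ring

/-- In the singular basis ‖Y‖² = ∑ λ_i⟨β,p_i⟩², and each of the n summands is at least of order
n^a‖β‖²/n, whereas ‖Y‖² is at most of order n. -/
theorem DataAssumption.β_sq_le (hd : R.DataAssumption a γ K ρ) (hs : R.IsSpectral) (hK : 1 ≤ K) :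
    (n : ℝ) ^ a * l2norm R.β ^ 2 ≤ K ^ 5 * n := by
  have hn := natCast_pos_of_neZero n
  have hK0 : 0 < K := by linarith
  have hP := Real.rpow_pos_of_pos hn a
  obtain ⟨b, hb, -, hYb⟩ := hs.exists_singular_basis (hd.lam_pos hs hK)
  have hY : ∑ i, R.lam i * (R.β ⬝ᵥ R.p i) ^ 2 = l2norm R.Y ^ 2 := by
    rw [l2norm_sq, ← sum_dotProduct_mul_dotProduct hb]
    exact Finset.sum_congr rfl fun i _ => by rw [← hYb, sq]
  have hterm : ∀ i : Fin n, (n : ℝ) ^ a * l2norm R.β ^ 2 / (K ^ 3 * n) ≤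
      R.lam i * (R.β ⬝ᵥ R.p i) ^ 2 := by
    intro i
    rw [div_le_iff₀ (by positivity)]
    have h1 := (hd.target_sq hK i).1
    have h2 := hd.lam_ge hs i
    rw [div_le_iff₀ hK0] at h2
    calc (n : ℝ) ^ a * l2norm R.β ^ 2 ≤ R.lam i * K * (K ^ 2 * n * (R.β ⬝ᵥ R.p i) ^ 2) :=
          mul_le_mul h2 h1 (sq_nonneg _) (mul_nonneg (hd.lam_pos hs hK i).le hK0.le)
      _ = _ := by ring
  have hsum := Finset.sum_le_sum fun i (_ : i ∈ Finset.univ) => hterm i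
  rw [hY, Finset.sum_const, Finset.card_univ, Fintype.card_fin, nsmul_eq_mul] at hsum
  have h3 := hsum.trans (hd.Y_sq hK).2
  have e : (n : ℝ) * ((n : ℝ) ^ a * l2norm R.β ^ 2 / (K ^ 3 * n)) =
      (n : ℝ) ^ a * l2norm R.β ^ 2 / K ^ 3 := by field_simp
  rw [e, div_le_iff₀ (by positivity)] at h3
  linarith

/-- A simple top eigenvalue makes q₁ equal up to sign to the first singular vector, so ⟨Y,q₁⟩² =
λ₁⟨β,p₁⟩², of order at most ‖β‖², which is small compared with ‖Y‖² by `β_sq_le`. -/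
theorem DataAssumption.lead_sq_le (hd : R.DataAssumption a γ K ρ) (hs : R.IsSpectral)
    (hK : 1 ≤ K) (hgap : ∀ i, i ≠ 0 → R.lam i < R.lam 0) :
    (n : ℝ) ^ a * R.δ₁ ^ 2 ≤ K ^ 10 := by
  have hn := natCast_pos_of_neZero n
  have hK0 : 0 < K := by linarith
  have hP := Real.rpow_pos_of_pos hn a
  obtain ⟨b, hb, hbe, hYb⟩ := hs.exists_singular_basis (hd.lam_pos hs hK)
  have horth : ∀ i, i ≠ 0 → R.q 0 ⬝ᵥ b i = 0 := fun i hi =>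
    eigenvectors_orthogonal (by rw [Matrix.transpose_mul, Matrix.transpose_transpose])
      (hs.q_eigen 0) (hbe i) (hgap i hi).ne'
  have hq1 : R.q 0 ⬝ᵥ R.q 0 = 1 := by
    have := hs.q_orthonormal.1 0
    rw [← l2norm_sq, l2norm, this, one_pow]
  have h1 : R.Y ⬝ᵥ R.q 0 = (R.Y ⬝ᵥ b 0) * (R.q 0 ⬝ᵥ b 0) := by
    rw [← sum_dotProduct_mul_dotProduct hb, Finset.sum_eq_single 0]
    · intro i _ hi; rw [horth i hi, mul_zero]
    · simp
  have h2 : (R.q 0 ⬝ᵥ b 0) ^ 2 = 1 := by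
    rw [← sum_dotProduct_mul_dotProduct hb, Finset.sum_eq_single 0] at hq1
    · rw [sq]; exact hq1
    · intro i _ hi; rw [horth i hi, mul_zero]
    · simp
  have h3 : (R.Y ⬝ᵥ R.q 0) ^ 2 = R.lam 0 * (R.β ⬝ᵥ R.p 0) ^ 2 := by
    rw [h1, mul_pow, h2, mul_one, hYb]
  have hY := hd.Y_pos hK
  rw [δ₁, div_pow, sq_abs, h3, mul_div_assoc', div_le_iff₀ (by positivity)]
  have h4 := hd.top.2
  have h5 := (hd.target_sq hK 0).2
  have h6 := hd.β_sq_le hs hK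
  have h7 := (hd.Y_sq hK).1
  calc (n : ℝ) ^ a * (R.lam 0 * (R.β ⬝ᵥ R.p 0) ^ 2)
      ≤ (n : ℝ) ^ a * (K * n * (R.β ⬝ᵥ R.p 0) ^ 2) := by gcongr
    _ = (n : ℝ) ^ a * K * (n * (R.β ⬝ᵥ R.p 0) ^ 2) := by ring
    _ ≤ (n : ℝ) ^ a * K * (K ^ 2 * l2norm R.β ^ 2) := by gcongr
    _ = K ^ 3 * ((n : ℝ) ^ a * l2norm R.β ^ 2) := by ring
    _ ≤ K ^ 3 * (K ^ 5 * (K ^ 2 * l2norm R.Y ^ 2)) :=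
      mul_le_mul_of_nonneg_left (h6.trans (by gcongr)) (by positivity)
    _ = _ := by ring

/-- The first k eigenvalues are dominated by a geometric series of ratio 1/γ, the others by n^a
each; no bound on k is needed. -/
theorem DataAssumption.sum_lam_sq_le (hd : R.DataAssumption a γ K ρ) (hs : R.IsSpectral)
    (hK : 1 ≤ K) (hγ : 1 < γ) :
    ∑ i, R.lam i ^ 2 ≤ K ^ 2 * (γ / (γ - 1) * n ^ 2 + n * ((n : ℝ) ^ a) ^ 2) := by
  have hn := natCast_pos_of_neZero n
  have hP := Real.rpow_pos_of_pos hn a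
  have hlam := hd.lam_pos hs hK
  have hγ0 : 0 < γ := by linarith
  obtain ⟨k, hk1, hkn, hgeo, hbulk, -⟩ := hd.spectrum
  set r := 1 / γ with hr
  have hr0 : 0 < r := by positivity
  have hr1 : r < 1 := by rw [hr, div_lt_one hγ0]; exact hγ
  have hdecay : ∀ (j : ℕ) (hj : j < n), j < k → R.lam ⟨j, hj⟩ ≤ R.lam 0 * r ^ j := by
    intro j
    induction j with
    | zero =>
      intro hj _
      rw [pow_zero, mul_one]
      exact le_of_eq (congrArg R.lam (Fin.ext (by simp)))
    | succ j ih =>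
      intro hj hjk
      have h1 := hgeo ⟨j, by omega⟩ ⟨j + 1, hj⟩ rfl hjk
      have h2 := ih (by omega) (by omega)
      calc R.lam ⟨j + 1, hj⟩ ≤ R.lam ⟨j, by omega⟩ / γ := h1
        _ = R.lam ⟨j, by omega⟩ * r := by rw [hr]; ring
        _ ≤ R.lam 0 * r ^ j * r := by gcongr
        _ = _ := by ring
  have hterm : ∀ i : Fin n, R.lam i ^ 2 ≤ (K * n) ^ 2 * r ^ (i : ℕ) + (K * (n : ℝ) ^ a) ^ 2 := by
    intro i
    rcases le_or_gt k i with hi | hi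
    · have h1 : R.lam i ^ 2 ≤ (K * (n : ℝ) ^ a) ^ 2 :=
        pow_le_pow_left₀ (hlam i).le (hbulk i hi).2 2
      have h2 : 0 ≤ (K * n) ^ 2 * r ^ (i : ℕ) := by positivity
      linarith
    · have h1 : R.lam i ≤ K * n * r ^ (i : ℕ) :=
        (hdecay i i.2 hi).trans (by gcongr; exact hd.top.2)
      have h2 : R.lam i ^ 2 ≤ (K * n * r ^ (i : ℕ)) ^ 2 := pow_le_pow_left₀ (hlam i).le h1 2
      have h3 : (r ^ (i : ℕ)) ^ 2 ≤ r ^ (i : ℕ) := by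
        have h4 : r ^ (i : ℕ) ≤ 1 := pow_le_one₀ hr0.le hr1.le
        have h5 : 0 ≤ r ^ (i : ℕ) := by positivity
        nlinarith
      calc R.lam i ^ 2 ≤ (K * n) ^ 2 * (r ^ (i : ℕ)) ^ 2 := by rw [← mul_pow]; exact h2
        _ ≤ (K * n) ^ 2 * r ^ (i : ℕ) := by gcongr
        _ ≤ _ := le_add_of_nonneg_right (sq_nonneg _)
  refine (Finset.sum_le_sum fun i _ => hterm i).trans ?_
  rw [Finset.sum_add_distrib, ← Finset.mul_sum, Finset.sum_const, Finset.card_univ,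
    Fintype.card_fin, nsmul_eq_mul, Fin.sum_univ_eq_sum_range (fun j => r ^ j)]
  have hgsum : ∑ j ∈ Finset.range n, r ^ j ≤ γ / (γ - 1) := by
    have h1 := geom_sum_mul_neg r n
    have h2 : 0 ≤ r ^ n := by positivity
    have h3 : (∑ j ∈ Finset.range n, r ^ j) ≤ 1 / (1 - r) := by
      rw [le_div_iff₀ (by linarith)]; linarith
    have h4 : 1 / (1 - r) = γ / (γ - 1) := by
      have : γ - 1 ≠ 0 := by linarith
      rw [hr]; field_simp
    rwa [h4] at h3
  have : (K * n) ^ 2 * ∑ j ∈ Finset.range n, r ^ j ≤ (K * n) ^ 2 * (γ / (γ - 1)) := by gcongr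
  nlinarith

/-- After ℓ² ≤ ℓ the sum is a multiple of ‖XY‖², which in the singular basis is ∑ λ_i²⟨β,p_i⟩². All
⟨β,p_i⟩² are of order at most ‖β‖²/n, so the sum of the λ_i² decides. This supplies the small ζ of
`corr_last_le`. -/
theorem DataAssumption.sum_weighted_le (hd : R.DataAssumption a γ K ρ) (hs : R.IsSpectral)
    (hK : 1 ≤ K) (hγ : 1 < γ) (T : ℕ) :
    ∑ i ∈ Finset.univ.erase (R.modes T).o, ((R.modes T).ℓ i * (R.modes T).y i) ^ 2 ≤
      K ^ 12 * (γ / (γ - 1) / (n : ℝ) ^ a + (n : ℝ) ^ a / n) := by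
  have hn := natCast_pos_of_neZero n
  have hK0 : 0 < K := by linarith
  have hP := Real.rpow_pos_of_pos hn a
  have hlam := hd.lam_pos hs hK
  have hY := hd.Y_pos hK
  obtain ⟨b, hb, hbe, hYb⟩ := hs.exists_singular_basis hlam
  have h1 : ∑ i ∈ Finset.univ.erase (R.modes T).o, ((R.modes T).ℓ i * (R.modes T).y i) ^ 2 ≤
      ∑ i, R.lam i * (R.Y ⬝ᵥ R.q i) ^ 2 / (R.lam 0 * l2norm R.Y ^ 2) := by
    refine (Finset.sum_le_sum_of_subset_of_nonneg (Finset.erase_subset _ _)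
      fun i _ _ => sq_nonneg _).trans (Finset.sum_le_sum fun i _ => ?_)
    have h2 : R.lam i / R.lam 0 ≤ 1 := by
      rw [div_le_one (hlam 0)]; exact hs.antitone (Fin.zero_le i)
    have h3 : 0 ≤ R.lam i / R.lam 0 := div_nonneg (hlam i).le (hlam 0).le
    have h4 : (R.lam i / R.lam 0) ^ 2 ≤ R.lam i / R.lam 0 := by nlinarith
    simp only [modes]
    rw [mul_pow]
    refine (mul_le_mul_of_nonneg_right h4 (sq_nonneg _)).trans_eq ?_
    have := hlam 0
    field_simp
  have h2 : ∑ i, R.lam i * (R.Y ⬝ᵥ R.q i) ^ 2 = ∑ i, R.lam i ^ 2 * (R.β ⬝ᵥ R.p i) ^ 2 := by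
    rw [sum_eigenvalue_mul_sq hs.q_orthonormal hs.q_eigen, ← sum_eigenvalue_mul_sq hb hbe]
    exact Finset.sum_congr rfl fun i _ => by rw [hYb]; ring
  have h3 : n * ∑ i, R.lam i ^ 2 * (R.β ⬝ᵥ R.p i) ^ 2 ≤
      K ^ 2 * l2norm R.β ^ 2 * ∑ i, R.lam i ^ 2 := by
    rw [Finset.mul_sum, Finset.mul_sum]
    refine Finset.sum_le_sum fun i _ => ?_
    have := mul_le_mul_of_nonneg_left (hd.target_sq hK i).2 (sq_nonneg (R.lam i))
    linarith
  have h4 := hd.sum_lam_sq_le hs hK hγ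
  have h5 := hd.β_sq_le hs hK
  have h6 := (hd.Y_sq hK).1
  have h7 := hd.top.1
  rw [div_le_iff₀ hK0] at h7
  rw [← Finset.sum_div, h2] at h1
  refine h1.trans ?_
  have hl0 := hlam 0
  rw [div_le_iff₀ (by positivity)]
  set P := (n : ℝ) ^ a
  set Γ := γ / (γ - 1) with hΓ
  have hΓ0 : 0 < Γ := div_pos (by linarith) (by linarith)
  have h8 : n * ∑ i, R.lam i ^ 2 * (R.β ⬝ᵥ R.p i) ^ 2 ≤
      K ^ 2 * (K ^ 5 * n / P) * (K ^ 2 * (Γ * n ^ 2 + n * P ^ 2)) := by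
    refine h3.trans ?_
    gcongr
    rw [le_div_iff₀ hP]; linarith
  have h9 : ∑ i, R.lam i ^ 2 * (R.β ⬝ᵥ R.p i) ^ 2 ≤ K ^ 9 * (Γ / P + P / n) * n ^ 2 := by
    refine le_of_mul_le_mul_left (h8.trans_eq ?_) hn
    field_simp
  refine h9.trans ?_
  have h10 : (n : ℝ) ^ 2 ≤ K ^ 3 * (R.lam 0 * l2norm R.Y ^ 2) := by
    calc (n : ℝ) ^ 2 = n * n := sq _
      _ ≤ R.lam 0 * K * (K ^ 2 * l2norm R.Y ^ 2) := by gcongr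
      _ = _ := by ring
  calc K ^ 9 * (Γ / P + P / n) * n ^ 2
      ≤ K ^ 9 * (Γ / P + P / n) * (K ^ 3 * (R.lam 0 * l2norm R.Y ^ 2)) := by gcongr
    _ = _ := by ring

end Bounds

end Run

/-! ### The mode system of a run satisfies the abstract hypotheses. -/

namespace Run

variable {n d h : ℕ} {R : Run n d h} [NeZero n] {a γ K ρ : ℝ} {t₀ T₁ t₁ : ℕ}

theorem RateAssumption.η_pos (hr : R.RateAssumption a K) (hK : 1 ≤ K) : 0 < R.η :=
  (div_pos (Real.rpow_pos_of_pos (natCast_pos_of_neZero n) _) (by linarith)).trans_le hr.1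

theorem RateAssumption.η_sq_le (hr : R.RateAssumption a K) (hK : 1 ≤ K) :
    R.η ^ 2 ≤ K ^ 2 * ((n : ℝ) ^ a / n) := by
  have hn := natCast_pos_of_neZero n
  have h1 : ((n : ℝ) ^ (-(1 - a) / 2)) ^ 2 = (n : ℝ) ^ a / n := by
    rw [← Real.rpow_natCast, ← Real.rpow_mul hn.le, ← Real.rpow_sub_one hn.ne']
    congr 1
    push_cast
    ring
  calc R.η ^ 2 ≤ (K * (n : ℝ) ^ (-(1 - a) / 2)) ^ 2 :=
        pow_le_pow_left₀ (hr.η_pos hK).le hr.2 2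
    _ = _ := by rw [mul_pow, h1]

theorem c_ne_zero_of_sharpness {t : ℕ} (hη : 0 < R.η) (h : 2 / R.η < R.sharpness t) :
    R.c t ≠ 0 := by
  intro h0
  rw [sharpness, h0] at h
  have : 0 < 2 / R.η := by positivity
  simp only [ne_eq, OfNat.ofNat_ne_zero, not_false_eq_true, zero_pow, mul_zero] at h
  linarith

theorem Assumptions.c_ne_zero_of_corr (hA : R.Assumptions a γ K ρ t₀ T₁) {t : ℕ} (ht : t₀ ≤ t)
    (h : 0 < R.E t ⬝ᵥ R.F t) : R.c t ≠ 0 := by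
  intro h0
  rw [hA.gd.F_eq hA.rankOne ht, h0, zero_smul, dotProduct_zero] at h
  exact lt_irrefl _ h

/-- If c vanished, the output would be zero and δ₀ would equal 1. -/
theorem Assumptions.c_ne_zero_start (hA : R.Assumptions a γ K ρ t₀ T₁) (hK : 1 ≤ K)
    (ht : t₀ ≤ T₁) (hρ : ρ < 1) : R.c T₁ ≠ 0 := by
  intro h0
  have hY := hA.data.Y_pos hK
  have hE : R.E T₁ = -R.Y := by
    rw [E, hA.gd.F_eq hA.rankOne ht, h0, zero_smul, zero_sub]
  have h1 := hA.loss.2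
  have h2 : l2norm (R.E T₁) = l2norm R.Y := by
    rw [hE, l2norm, l2norm, WithLp.toLp_neg, norm_neg]
  rw [δ₀, h2, div_self hY.ne'] at h1
  linarith

/-- The exponent 7 comes from M ≤ K³η², η² ≤ K² n^a/n and μ = n^a/(K²n), which give M ≤ K⁷μ; the
other constants are smaller. -/
theorem Assumptions.valid (hA : R.Assumptions a γ K ρ t₀ T₁) (hK : 1 ≤ K)
    (hη : 100 * (K ^ 7) ^ 4 * R.η ≤ 1) (hT : t₀ ≤ T₁) {N : ℕ}
    (hc : ∀ t ≤ N, R.c (T₁ + t) ≠ 0) :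
    (R.modes T₁).Valid (K ^ 7) R.η ((n : ℝ) ^ a / (K ^ 2 * n)) N := by
  have hn := natCast_pos_of_neZero n
  have hK0 : 0 < K := by linarith
  have hP := Real.rpow_pos_of_pos hn a
  have hη0 := hA.rate.η_pos hK
  have hlam := hA.data.lam_pos hA.spectral hK
  have hl0 := hlam 0
  have hY := hA.data.Y_pos hK
  have hM : R.η ^ 2 * R.lam 0 * l2norm R.Y ^ 2 / n ^ 2 ≤ K ^ 3 * R.η ^ 2 := by
    rw [div_le_iff₀ (by positivity)]
    calc R.η ^ 2 * R.lam 0 * l2norm R.Y ^ 2 ≤ R.η ^ 2 * (K * n) * (K ^ 2 * n) := by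
          gcongr
          · exact hA.data.top.2
          · exact (hA.data.Y_sq hK).2
      _ = _ := by ring
  have hK37 : K ^ 3 ≤ K ^ 7 := pow_le_pow_right₀ hK (by norm_num)
  have hr : ∀ t i, (R.modes T₁).ℓ i * (R.modes T₁).σ t =
      R.η * (R.lam i / n * R.c (T₁ + t) ^ 2) := by
    intro t i
    simp only [modes, sharpness]; field_simp
  refine
    { one_le := one_le_pow₀ hK
      η_pos := hη0
      η_small := hη
      M_pos := by simp only [modes]; positivity
      M_le := hM.trans (by gcongr)
      M_le' := ?_
      μ_pos := by positivity
      ℓ_o := div_self hl0.ne'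
      μ_le := ?_
      ℓ_le := fun i => (div_le_one hl0).2 (hA.spectral.antitone (Fin.zero_le i))
      y_unit := hA.spectral.sum_sq_modes_y hY
      σ_pos := ?_
      σ_le := ?_
      damp := ?_
      loss := ?_
      e_succ := fun t ht i => hA.gd.e_succ_modes hA.spectral hA.rankOne hη0 hl0 hY (by omega)
        (hc t ht) i
      σ_succ := fun t ht => hA.gd.σ_succ_modes hA.spectral hA.rankOne hη0 hl0 hY (by omega)
        (hc t ht) }
  · refine hM.trans ?_
    calc K ^ 3 * R.η ^ 2 ≤ K ^ 3 * (K ^ 2 * ((n : ℝ) ^ a / n)) := by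
          gcongr
          exact hA.rate.η_sq_le hK
      _ = _ := by field_simp
  · intro i
    have h1 := hA.data.lam_ge hA.spectral i
    have h2 := hA.data.top.2
    simp only [modes]
    rw [div_le_div_iff₀ (by positivity) hl0]
    rw [div_le_iff₀ hK0] at h1
    calc (n : ℝ) ^ a * R.lam 0 ≤ R.lam i * K * (K * n) :=
          mul_le_mul h1 h2 hl0.le (mul_nonneg (hlam i).le hK0.le)
      _ = _ := by ring
  · intro t ht
    have := hc t ht
    simp only [modes, sharpness]
    positivity
  · intro t
    have h1 := (hA.sharp (T₁ + t) (by omega)).1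
    rw [le_div_iff₀ hη0] at h1
    have h2 : K ≤ K ^ 7 := le_self_pow₀ hK (by norm_num)
    simp only [modes]
    linarith
  · intro t i hi
    have h1 := (hA.sharp (T₁ + t) (by omega)).2 i hi
    rw [lt_div_iff₀ hη0] at h1
    rw [hr]
    linarith
  · intro t
    have h1 := hA.loss.1 (T₁ + t) (by omega)
    have h2 := (hA.data.Y_sq hK).1
    rw [hA.spectral.sum_sq_modes, div_le_div_iff₀ (by positivity) hη0]
    calc l2norm (R.E (T₁ + t)) ^ 2 * R.η ≤ K * (n / R.η) * R.η := by gcongr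
      _ = K * n := by field_simp
      _ ≤ K * (K ^ 2 * l2norm R.Y ^ 2) := by gcongr
      _ = K ^ 3 * l2norm R.Y ^ 2 := by ring
      _ ≤ _ := by gcongr

theorem two_lt_σ_modes (hη : 0 < R.η) {T t : ℕ} (h : 2 / R.η < R.sharpness (T + t)) :
    2 < (R.modes T).σ t := by
  rw [div_lt_iff₀ hη] at h
  simp only [modes]
  linarith

theorem σ_modes_lt_two (hη : 0 < R.η) {T t : ℕ} (h : R.sharpness (T + t) < 2 / R.η) :
    (R.modes T).σ t < 2 := by
  rw [lt_div_iff₀ hη] at h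
  simp only [modes]
  linarith

theorem IsSpectral.corr_modes_pos (hs : R.IsSpectral) (hY : 0 < l2norm R.Y) {T t : ℕ}
    (h : 0 < R.E (T + t) ⬝ᵥ R.F (T + t)) : 0 < (R.modes T).corr t := by
  rw [hs.corr_modes]; positivity

theorem Assumptions.sharpens (hA : R.Assumptions a γ K ρ t₀ T₁) (hK : 1 ≤ K)
    (hS : R.StartsPhaseIII t₀ T₁ t₁) (hρ : 100 * (K ^ 7) ^ 4 * ρ ≤ 1)
    (hδ₁ : 100 * (K ^ 7) ^ 4 * R.δ₁ ≤ 1) :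
    (R.modes T₁).Sharpens (K ^ 7) (R.δ₀ T₁) (t₁ - T₁) := by
  obtain ⟨hT, hlt, hI, hII, hIII⟩ := hS
  have hη := hA.rate.η_pos hK
  have hY := hA.data.Y_pos hK
  have hl0 := hA.data.lam_pos hA.spectral hK 0
  have hn := natCast_pos_of_neZero n
  have hgrow : ∀ t, R.c (T₁ + t) ^ 2 < R.c (T₁ + t + 1) ^ 2 →
      (R.modes T₁).σ t < (R.modes T₁).σ (t + 1) := by
    intro t ht
    have : R.η * (R.lam 0 / n * R.c (T₁ + t) ^ 2) < R.η * (R.lam 0 / n * R.c (T₁ + t + 1) ^ 2) := by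
      gcongr
    exact this
  refine
    { T_pos := by omega
      δ_nonneg := div_nonneg (l2norm_nonneg _) hY.le
      δ_small := (mul_le_mul_of_nonneg_left hA.loss.2 (by positivity)).trans hρ
      y_small := ?_
      start_error := ?_
      start_lt := σ_modes_lt_two hη hI.1
      start_grow := hgrow 0 hI.2
      grow := fun t h0 ht => ⟨two_lt_σ_modes hη (hII (T₁ + t) (by omega) (by omega)).1,
        hgrow t (hII (T₁ + t) (by omega) (by omega)).2⟩
      last := ?_ }
  · simp only [modes]
    rw [abs_div, abs_of_pos hY]
    exact hδ₁
  · rw [hA.spectral.sum_sq_modes, δ₀, div_pow, add_zero]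
  · have e : T₁ + (t₁ - T₁) = t₁ := by omega
    exact ⟨two_lt_σ_modes hη (by rw [e]; exact hIII.1),
      hA.spectral.corr_modes_pos hY (by rw [e]; exact hIII.2)⟩

/-- The same c_t² puts λ₁ above the level 2/η and every other eigenvalue below 1/η, so λ₁ is simple.
-/
theorem Assumptions.eigenvalue_gap (hA : R.Assumptions a γ K ρ t₀ T₁) (hK : 1 ≤ K) {t : ℕ}
    (ht : t₀ ≤ t) (hσ : 2 / R.η < R.sharpness t) (i : Fin n) (hi : i ≠ 0) :
    R.lam i < R.lam 0 := by
  have hη := hA.rate.η_pos hK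
  have hn := natCast_pos_of_neZero n
  have h1 := (hA.sharp t ht).2 i hi
  have h2 : 1 / R.η ≤ 2 / R.η := by gcongr; norm_num
  have h3 := h1.trans_le (h2.trans hσ.le)
  rw [sharpness] at h3
  have h4 := lt_of_mul_lt_mul_right h3 (sq_nonneg _)
  rwa [div_lt_div_iff_of_pos_right hn] at h4

theorem Assumptions.c_ne_zero_until (hA : R.Assumptions a γ K ρ t₀ T₁) (hK : 1 ≤ K)
    (hS : R.StartsPhaseIII t₀ T₁ t₁) (hρ : ρ < 1) {t : ℕ} (ht : t < t₁ - T₁) :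
    R.c (T₁ + t) ≠ 0 := by
  obtain ⟨hT, hlt, hI, hII, hIII⟩ := hS
  rcases Nat.eq_zero_or_pos t with rfl | h
  · exact hA.c_ne_zero_start hK hT hρ
  · exact c_ne_zero_of_sharpness (hA.rate.η_pos hK) (hII (T₁ + t) (by omega) (by omega)).1

theorem δ₁_nonneg (R : Run n d h) : 0 ≤ R.δ₁ := div_nonneg (abs_nonneg _) (l2norm_nonneg _)

theorem δ₀_nonneg {n d h : ℕ} (R : Run n d h) (T : ℕ) : 0 ≤ R.δ₀ T :=
  div_nonneg (l2norm_nonneg _) (l2norm_nonneg _)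

theorem δ₁_le_δ₂_sq (R : Run n d h) (T : ℕ) : R.δ₁ ≤ R.δ₂ T ^ 2 := by
  calc R.δ₁ = √R.δ₁ ^ 2 := (Real.sq_sqrt R.δ₁_nonneg).symm
    _ ≤ _ := pow_le_pow_left₀ (Real.sqrt_nonneg _) (le_max_right _ _) 2

/-- Everything that is small for large `n`, bounded by `θ`. -/
structure SmallParams (n : ℕ) (a γ K ρ θ : ℝ) : Prop where
  rho : ρ ≤ θ
  rate : K * (n : ℝ) ^ (-(1 - a) / 2) ≤ θ
  lead : K ^ 10 / (n : ℝ) ^ a ≤ θ ^ 4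
  quarter : (n : ℝ) ^ (a / 4) ≥ 1
  weighted : K ^ 12 * (γ / (γ - 1) / (n : ℝ) ^ a + (n : ℝ) ^ a / n) ≤ θ ^ 2

theorem exists_smallParams {a γ K θ : ℝ} (ha₀ : 0 < a) (ha₁ : a < 1) (hθ : 0 < θ) {ρ : ℕ → ℝ}
    (hρ : Tendsto ρ atTop (𝓝 0)) : ∃ N : ℕ, ∀ n : ℕ, N ≤ n → SmallParams n a γ K (ρ n) θ := by
  have hneg : ∀ b : ℝ, 0 < b → Tendsto (fun n : ℕ => (n : ℝ) ^ (-b)) atTop (𝓝 0) := fun b hb =>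
    (tendsto_rpow_neg_atTop hb).comp tendsto_natCast_atTop_atTop
  have h1 : ∀ᶠ n : ℕ in atTop, ρ n ≤ θ := (hρ.eventually_lt_const hθ).mono fun _ h => h.le
  have h2 : ∀ᶠ n : ℕ in atTop, K * (n : ℝ) ^ (-(1 - a) / 2) ≤ θ := by
    have := (hneg ((1 - a) / 2) (by linarith)).const_mul K
    rw [mul_zero] at this
    filter_upwards [this.eventually_lt_const hθ] with n hn
    rw [neg_div]
    exact hn.le
  have h3 : ∀ᶠ n : ℕ in atTop, K ^ 10 / (n : ℝ) ^ a ≤ θ ^ 4 := by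
    have := (hneg a ha₀).const_mul (K ^ 10)
    rw [mul_zero] at this
    filter_upwards [this.eventually_lt_const (by positivity : 0 < θ ^ 4)] with n hn
    rw [div_eq_mul_inv, ← Real.rpow_neg n.cast_nonneg]
    exact hn.le
  have h4 : ∀ᶠ n : ℕ in atTop, (n : ℝ) ^ (a / 4) ≥ 1 := by
    filter_upwards [eventually_ge_atTop 1] with n hn
    exact Real.one_le_rpow (by exact_mod_cast hn) (by linarith)
  have h5 : ∀ᶠ n : ℕ in atTop,
      K ^ 12 * (γ / (γ - 1) / (n : ℝ) ^ a + (n : ℝ) ^ a / n) ≤ θ ^ 2 := by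
    have := (((hneg a ha₀).const_mul (γ / (γ - 1))).add
      (hneg (1 - a) (by linarith))).const_mul (K ^ 12)
    simp only [mul_zero, add_zero] at this
    filter_upwards [this.eventually_lt_const (by positivity : 0 < θ ^ 2),
      eventually_ge_atTop 1] with n hn hn1
    have hn0 : (n : ℝ) ≠ 0 := by positivity
    rw [div_eq_mul_inv (γ / (γ - 1)), ← Real.rpow_neg n.cast_nonneg, ← Real.rpow_sub_one hn0]
    rw [neg_sub] at hn
    exact hn.le
  obtain ⟨N, hN⟩ := eventually_atTop.1 (h1.and (h2.and (h3.and (h4.and h5))))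
  exact ⟨N, fun n hn => ⟨(hN n hn).1, (hN n hn).2.1, (hN n hn).2.2.1, (hN n hn).2.2.2.1,
    (hN n hn).2.2.2.2⟩⟩

/-- The fourth power in `SmallParams.lead` is needed because δ₂ contains √δ₁, while the data bound
δ₁². -/
theorem Assumptions.δ₂_le (hA : R.Assumptions a γ K ρ t₀ T₁) (hK : 1 ≤ K)
    (hS : R.StartsPhaseIII t₀ T₁ t₁) {θ : ℝ} (hθ : 0 ≤ θ) (hP : SmallParams n a γ K ρ θ) :
    R.δ₁ ≤ θ ^ 2 ∧ R.δ₂ T₁ ≤ θ := by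
  have hgap := hA.eigenvalue_gap hK (hS.1.trans hS.2.1.le) hS.2.2.2.2.1
  have h1 := hA.data.lead_sq_le hA.spectral hK hgap
  have hPn := Real.rpow_pos_of_pos (natCast_pos_of_neZero n) a
  have h2 : R.δ₁ ^ 2 ≤ (θ ^ 2) ^ 2 := by
    rw [← pow_mul]
    refine le_trans ?_ hP.lead
    rw [le_div_iff₀ hPn]; linarith
  have h3 : R.δ₁ ≤ θ ^ 2 := (abs_le_of_sq_le_sq' h2 (by positivity)).2
  exact ⟨h3, max_le (hA.loss.2.trans hP.rho) ((Real.sqrt_le_left hθ).2 h3)⟩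

end Run

/-! ### The two claims for a run. -/

/-- With p = ⟨x,y⟩, the Gram determinant ‖x‖²‖y‖² - p² does not change when x is replaced by x - y,
so it is at most ε‖y‖⁴ ≤ 4εp². It remains that (1-2ε)²(1+4ε) ≤ 1. -/
theorem one_sub_le_cosAngle {m : ℕ} {x y : Fin m → ℝ} {ε : ℝ} (hy : 0 < l2norm y)
    (hε0 : 0 ≤ ε) (hε : ε ≤ 1 / 4) (h : l2norm (x - y) ^ 2 ≤ ε * l2norm y ^ 2) :
    1 - 2 * ε ≤ cosAngle x y := by
  set Y := l2norm y
  set X := l2norm x with hX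
  set E := x - y with hE
  have hxE : x = E + y := by rw [hE]; abel
  have hp : x ⬝ᵥ y = Y ^ 2 + E ⬝ᵥ y := by
    rw [hxE, add_dotProduct, l2norm_sq]; ring
  have hXsq : X ^ 2 = Y ^ 2 + 2 * (E ⬝ᵥ y) + l2norm E ^ 2 := by
    rw [hX, l2norm_sq, l2norm_sq, l2norm_sq, hxE]
    simp only [add_dotProduct, dotProduct_add, dotProduct_comm y E]
    ring
  have hcs : (E ⬝ᵥ y) ^ 2 ≤ l2norm E ^ 2 * Y ^ 2 := by
    rw [l2norm_sq, l2norm_sq]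
    simpa [dotProduct, sq] using Finset.sum_mul_sq_le_sq_mul_sq Finset.univ E y
  have hX0 : 0 ≤ X := l2norm_nonneg _
  have hb : |E ⬝ᵥ y| ≤ Y ^ 2 / 2 := by
    refine abs_le_of_sq_le_sq (hcs.trans ?_) (by positivity)
    calc l2norm E ^ 2 * Y ^ 2 ≤ 1 / 4 * Y ^ 2 * Y ^ 2 := by
          gcongr
          exact h.trans (by gcongr)
      _ = _ := by ring
  set p := x ⬝ᵥ y
  have hp2 : Y ^ 2 / 2 ≤ p := by rw [hp]; linarith [(abs_le.1 hb).1]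
  have hY2 : 0 < Y ^ 2 := by positivity
  have hp0 : 0 < p := by linarith
  have hXY : (X * Y) ^ 2 ≤ p ^ 2 * (1 + 4 * ε) := by
    have h1 : (X * Y) ^ 2 ≤ p ^ 2 + ε * (Y ^ 2) ^ 2 := by
      rw [mul_pow, hXsq, hp]
      nlinarith [sq_nonneg (E ⬝ᵥ y), mul_le_mul_of_nonneg_right h hY2.le]
    have h2 : (Y ^ 2) ^ 2 ≤ 4 * p ^ 2 := by nlinarith
    nlinarith
  have hXpos : 0 < X := by
    refine hX0.lt_of_ne fun h0 => ?_
    have : l2norm x ^ 2 = 0 := by rw [← hX, ← h0]; ring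
    rw [l2norm_sq, dotProduct_self_eq_zero] at this
    have : p = 0 := by simp only [p, this, zero_dotProduct]
    linarith
  rw [cosAngle, le_div_iff₀ (by positivity)]
  refine (abs_le_of_sq_le_sq' ?_ hp0.le).2
  rw [mul_pow]
  calc (1 - 2 * ε) ^ 2 * (X * Y) ^ 2 ≤ (1 - 2 * ε) ^ 2 * (p ^ 2 * (1 + 4 * ε)) := by gcongr
    _ = p ^ 2 * ((1 - 2 * ε) ^ 2 * (1 + 4 * ε)) := by ring
    _ ≤ p ^ 2 * 1 := by
      gcongr
      nlinarith [mul_nonneg hε0 hε0]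
    _ = _ := by ring

theorem l2norm_smul {m : ℕ} (k : ℝ) (x : Fin m → ℝ) : l2norm (k • x) = |k| * l2norm x := by
  rw [l2norm, WithLp.toLp_smul, norm_smul, Real.norm_eq_abs, l2norm]

theorem cosAngle_smul_left {m : ℕ} {k : ℝ} (hk : 0 < k) (x y : Fin m → ℝ) :
    cosAngle (k • x) y = cosAngle x y := by
  rw [cosAngle, cosAngle, l2norm_smul, smul_dotProduct, abs_of_pos hk, smul_eq_mul, mul_assoc,
    mul_div_mul_left _ _ hk.ne']

namespace Run

variable {n d h : ℕ} {R : Run n d h} [NeZero n] {a γ K ρ : ℝ} {t₀ T₁ t₁ : ℕ}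

theorem l2norm_F_sq {n d h : ℕ} (R : Run n d h) (t : ℕ) :
    l2norm (R.F t) ^ 2 = l2norm R.Y ^ 2 + 2 * (R.E t ⬝ᵥ R.F t) - l2norm (R.E t) ^ 2 := by
  have hY : R.Y = R.F t - R.E t := by rw [E]; abel
  rw [l2norm_sq, l2norm_sq, l2norm_sq, hY]
  simp only [sub_dotProduct, dotProduct_sub, dotProduct_comm (R.F t) (R.E t)]
  ring

theorem Assumptions.α_eq (hA : R.Assumptions a γ K ρ t₀ T₁) {t : ℕ} (ht : t₀ ≤ t)
    (hc : R.c t ≠ 0) : R.α t = l2norm (R.F t) ^ 2 / (R.c t ^ 2) ^ 2 := by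
  rw [α, hA.gd.F_eq hA.rankOne ht, l2norm_smul, mul_pow, sq_abs]
  field_simp

theorem Assumptions.layers_move (hA : R.Assumptions a γ K ρ t₀ T₁) (hK : 1 ≤ K)
    (hS : R.StartsPhaseIII t₀ T₁ t₁) {t : ℕ} (hIII : R.InPhaseIII t₁ t) {θ c₁ C : ℝ}
    (hθ0 : 0 < θ) (hθ : 100 * (K ^ 7) ^ 4 * θ ≤ 1) (hP : SmallParams n a γ K ρ θ) (hc₁ : 0 < c₁)
    (hC1 : 1 ≤ C) (hC : 2 * K ^ 7 / c₁ + 1680 * (K ^ 7) ^ 4 / c₁ ^ 2 ≤ C)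
    (hx : c₁ * (R.δ₂ T₁ * l2norm R.Y) ≤ |R.E t ⬝ᵥ R.q 0|)
    (hexc : C * max 1 (1 / (R.η * (n : ℝ) ^ (a / 4))) < R.excess t) :
    R.c (t + 1) ^ 2 < R.c t ^ 2 ∧ l2norm (R.v t) ^ 2 < l2norm (R.v (t + 1)) ^ 2 := by
  have hL4 : 1 ≤ (K ^ 7) ^ 4 := one_le_pow₀ (one_le_pow₀ hK)
  have hθ1 : θ ≤ 1 := by nlinarith
  have hηθ : R.η ≤ θ := hA.rate.2.trans hP.rate
  have hη0 := hA.rate.η_pos hK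
  have hY := hA.data.Y_pos hK
  have hl0 := hA.data.lam_pos hA.spectral hK 0
  obtain ⟨hδ₁, hδ₂⟩ := hA.δ₂_le hK hS hθ0.le hP
  have hT : t₀ ≤ T₁ := hS.1
  have hlt : T₁ < t₁ := hS.2.1
  have ht1 : t₁ ≤ t := hIII.1
  obtain ⟨s, rfl⟩ : ∃ s, t = T₁ + s := ⟨t - T₁, by omega⟩
  have hcne : ∀ r ≤ s, R.c (T₁ + r) ≠ 0 := by
    intro r hr
    rcases lt_or_ge r (t₁ - T₁) with h | h
    · exact hA.c_ne_zero_until hK hS (hP.rho.trans_lt (by nlinarith)) h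
    · exact c_ne_zero_of_sharpness hη0 (hIII.2 (T₁ + r) (by omega) (by omega)).1
  have hV := hA.valid hK ((mul_le_mul_of_nonneg_left hηθ (by positivity)).trans hθ) hT hcne
  have hSh := hA.sharpens hK hS ((mul_le_mul_of_nonneg_left hP.rho (by positivity)).trans hθ)
    ((mul_le_mul_of_nonneg_left (hδ₁.trans (by nlinarith)) (by positivity)).trans hθ)
  have hfall : ∀ r, t₁ - T₁ ≤ r → r ≤ s → 2 < (R.modes T₁).σ r ∧ 0 < (R.modes T₁).corr r := by
    intro r h1 h2
    have h3 := hIII.2 (T₁ + r) (by omega) (by omega)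
    exact ⟨two_lt_σ_modes hη0 h3.1, hA.spectral.corr_modes_pos hY h3.2⟩
  have hlast := hfall s (by omega) le_rfl
  have hcs := hcne s le_rfl
  constructor
  · rw [hA.gd.c_succ_modes hA.spectral hA.rankOne hη0 hl0 hY (by omega) hcs, mul_pow]
    have hg0 : 0 < (R.modes T₁).g s := mul_pos (div_pos hV.M_pos (by linarith)) hlast.2
    have hg1 := (abs_le.1 (hV.abs_g_le_quarter (by linarith : 1 ≤ (R.modes T₁).σ s))).2
    exact mul_lt_of_lt_one_right (by positivity) (by nlinarith)
  -- In units of 1/η the threshold is m = max(η, n^(-a/4)). The exponent a/4 is the one for which δ₁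
  -- = O(n^(-a/2)) gives δ₁ = O(m²).
  · set m := R.η * max 1 (1 / (R.η * (n : ℝ) ^ (a / 4))) with hm
    have hnp : (0 : ℝ) < (n : ℝ) ^ (a / 4) := by linarith [hP.quarter]
    have hm' : m = max R.η (1 / (n : ℝ) ^ (a / 4)) := by
      rw [hm, mul_max_of_nonneg _ _ hη0.le, mul_one]
      congr 1
      field_simp
    have hm1 : m ≤ 1 := by
      rw [hm']
      exact max_le (hηθ.trans hθ1) ((div_le_one hnp).2 hP.quarter)
    have hy : |(R.modes T₁).y (R.modes T₁).o| = R.δ₁ := by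
      simp only [modes, abs_div, abs_of_pos hY, δ₁]
    have hdm : R.δ₁ ≤ K ^ 7 * m ^ 2 := by
      have hgap := hA.eigenvalue_gap hK (hS.1.trans hS.2.1.le) hS.2.2.2.2.1
      have h1 := hA.data.lead_sq_le hA.spectral hK hgap
      have hn := natCast_pos_of_neZero n
      have h2 : (n : ℝ) ^ a = ((n : ℝ) ^ (a / 4)) ^ 4 := by
        rw [← Real.rpow_natCast, ← Real.rpow_mul hn.le]
        congr 1
        push_cast
        ring
      have h3 : 1 ≤ m * (n : ℝ) ^ (a / 4) := by
        rw [← div_le_iff₀ hnp, hm']; exact le_max_right _ _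
      set Q := (n : ℝ) ^ (a / 4)
      have hm0 : 0 < m := by rw [hm']; exact hη0.trans_le (le_max_left _ _)
      rw [h2] at h1
      have h4 : (R.δ₁ * Q ^ 2) ^ 2 ≤ (K ^ 5) ^ 2 := by
        calc (R.δ₁ * Q ^ 2) ^ 2 = Q ^ 4 * R.δ₁ ^ 2 := by ring
          _ ≤ K ^ 10 := h1
          _ = _ := by ring
      have h5 := (abs_le_of_sq_le_sq' h4 (by positivity)).2
      have h6 : 1 ≤ m ^ 2 * Q ^ 2 := by rw [← mul_pow]; exact one_le_pow₀ h3
      have h7 : K ^ 5 ≤ K ^ 7 := pow_le_pow_right₀ hK (by norm_num)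
      calc R.δ₁ ≤ R.δ₁ * (m ^ 2 * Q ^ 2) := le_mul_of_one_le_right R.δ₁_nonneg h6
        _ = R.δ₁ * Q ^ 2 * m ^ 2 := by ring
        _ ≤ K ^ 7 * m ^ 2 := by
          gcongr
          linarith
    have hpos := hSh.first_layer_grows hV (t := s) (by omega) le_rfl hfall (δ₂ := R.δ₂ T₁) (m := m)
      (c₁ := c₁) (C := C) (le_max_left _ _) (hy ▸ R.δ₁_le_δ₂_sq T₁) (hδ₂.trans hθ1) (hy ▸ hdm)
      (by rw [hm']; exact le_max_left _ _) hm1 hc₁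
      (by
        simp only [modes]
        rw [abs_div, abs_of_pos hY, le_div_iff₀ hY]
        linarith)
      (by
        have h1 := mul_lt_mul_of_pos_left hexc hη0
        rw [excess, mul_sub, mul_div_cancel₀ _ hη0.ne'] at h1
        simp only [modes]
        rw [hm]
        linarith)
      hC1 hC
    have hgr := hA.gd.v_growth_modes hA.spectral hA.rankOne hl0 hY (by omega : t₀ ≤ T₁ + s)
    have h1 : 0 < R.c (T₁ + s) ^ 2 *
        (l2norm (R.v (T₁ + s + 1)) ^ 2 - l2norm (R.v (T₁ + s)) ^ 2) := by
      rw [hgr]; exact mul_pos (by positivity) hpos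
    have h2 := (mul_pos_iff_of_pos_left (by positivity : 0 < R.c (T₁ + s) ^ 2)).1 h1
    linarith

set_option maxHeartbeats 1000000 in
theorem Assumptions.α_increases (hA : R.Assumptions a γ K ρ t₀ T₁) (hK : 1 ≤ K) (hγ : 1 < γ)
    (hS : R.StartsPhaseIII t₀ T₁ t₁) {t₂ : ℕ} (hIV : R.InPhaseIV t₁ t₂) {θ c₂ : ℝ}
    (hθ0 : 0 < θ) (hθ : 400 * (K ^ 7) ^ 4 * θ ≤ 1) (hP : SmallParams n a γ K ρ θ) (hc₂ : 0 < c₂)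
    (hθc : 24000 * (K ^ 7) ^ 4 * θ ≤ c₂) (hcθ : c₂ * θ ≤ 1) (hc : 0 < R.c T₁)
    (hE : l2norm (R.E t₂) ^ 2 ≤ l2norm (R.E t₁) ^ 2)
    (hexc : c₂ * (R.δ₂ T₁ / R.η) ≤ R.excess t₁) :
    R.α t₁ < R.α t₂ ∧ 1 - 160 * (K ^ 7) ^ 3 * R.δ₂ T₁ ≤ cosAngle (R.v t₁) R.Y ∧
      1 - 160 * (K ^ 7) ^ 3 * R.δ₂ T₁ ≤ cosAngle (R.v t₂) R.Y := by
  have hL1 : 1 ≤ K ^ 7 := one_le_pow₀ hK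
  have hL4 : 1 ≤ (K ^ 7) ^ 4 := one_le_pow₀ hL1
  have hθ1 : θ ≤ 1 := by nlinarith
  have hθ100 : 100 * (K ^ 7) ^ 4 * θ ≤ 1 := by linarith
  have hηθ : R.η ≤ θ := hA.rate.2.trans hP.rate
  have hη0 := hA.rate.η_pos hK
  have hY := hA.data.Y_pos hK
  have hl0 := hA.data.lam_pos hA.spectral hK 0
  have hn := natCast_pos_of_neZero n
  obtain ⟨hδ₁, hδ₂⟩ := hA.δ₂_le hK hS hθ0.le hP
  have hδ₂0 : 0 ≤ R.δ₂ T₁ := (R.δ₀_nonneg T₁).trans (le_max_left _ _)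
  have hT : t₀ ≤ T₁ := hS.1
  have hlt : T₁ < t₁ := hS.2.1
  obtain ⟨T₃, hIII, hT₃, hIV⟩ := hIV
  have ht13 : t₁ ≤ T₃ := hIII.1
  have hcne : ∀ r ≤ t₂ - T₁, R.c (T₁ + r) ≠ 0 := by
    intro r hr
    rcases lt_or_ge r (t₁ - T₁) with h | h
    · exact hA.c_ne_zero_until hK hS (hP.rho.trans_lt (by nlinarith)) h
    · rcases le_or_gt (T₁ + r) T₃ with h' | h'
      · exact c_ne_zero_of_sharpness hη0 (hIII.2 (T₁ + r) (by omega) h').1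
      · exact hA.c_ne_zero_of_corr (by omega) (hIV (T₁ + r) h' (by omega)).2
  have hV := hA.valid hK ((mul_le_mul_of_nonneg_left hηθ (by positivity)).trans hθ100) hT hcne
  have hSh := hA.sharpens hK hS ((mul_le_mul_of_nonneg_left hP.rho (by positivity)).trans hθ100)
    ((mul_le_mul_of_nonneg_left (hδ₁.trans (by nlinarith)) (by positivity)).trans hθ100)
  have hTN : t₁ - T₁ ≤ t₂ - T₁ := by omega
  have hσ1 : ∀ r, t₁ - T₁ ≤ r → r ≤ t₂ - T₁ → 1 ≤ (R.modes T₁).σ r := fun r h1 h2 =>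
    hSh.one_le_σ_of_fall hV (T₃ := T₃ - T₁) (by omega) (by omega)
      (fun s h1 h2 =>
        have h3 := hIII.2 (T₁ + s) (by omega) (by omega)
        ⟨two_lt_σ_modes hη0 h3.1, hA.spectral.corr_modes_pos hY h3.2⟩)
      (fun s h1 h2 =>
        have h3 := hIV (T₁ + s) (by omega) (by omega)
        ⟨σ_modes_lt_two hη0 h3.1, hA.spectral.corr_modes_pos hY h3.2⟩) h1 h2
  -- The sign of c persists because g < 1: g is negative while σ grows, and g ≤ 1/4 afterwards since
  -- σ ≥ 1.
  have hcpos : ∀ r ≤ t₂ - T₁, 0 < R.c (T₁ + r) := by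
    intro r
    induction r with
    | zero => exact fun _ => hc
    | succ r ih =>
      intro hr
      have h1 := ih (by omega)
      have hg : (R.modes T₁).g r < 1 := by
        rcases lt_or_ge r (t₁ - T₁) with h | h
        · linarith [(hSh.growth hV hTN h).2.2.1]
        · linarith [(abs_le.1 (hV.abs_g_le_quarter (hσ1 r h (by omega)))).2]
      rw [← add_assoc, hA.gd.c_succ_modes hA.spectral hA.rankOne hη0 hl0 hY (by omega) h1.ne']
      exact mul_pos h1 (by linarith)
  have e1 : T₁ + (t₁ - T₁) = t₁ := by omega
  have e2 : T₁ + (t₂ - T₁) = t₂ := by omega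
  have hc1 : 0 < R.c t₁ := e1 ▸ hcpos (t₁ - T₁) hTN
  have hc2 : 0 < R.c t₂ := e2 ▸ hcpos (t₂ - T₁) le_rfl
  have hy : |(R.modes T₁).y (R.modes T₁).o| = R.δ₁ := by
    simp only [modes, abs_div, abs_of_pos hY, δ₁]
  have hY2 : 0 < l2norm R.Y ^ 2 := by positivity
  have hE1 : l2norm (R.E t₁) ^ 2 ≤ 80 * (K ^ 7) ^ 3 * R.δ₂ T₁ * l2norm R.Y ^ 2 := by
    have h1 := hSh.sum_sq_last_le hV hTN (δ₂ := R.δ₂ T₁) (le_max_left _ _)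
      (hy ▸ R.δ₁_le_δ₂_sq T₁) (hδ₂.trans hθ1)
    rw [hA.spectral.sum_sq_modes, e1, div_le_iff₀ hY2] at h1
    exact h1
  have hL3 : (K ^ 7) ^ 3 ≤ (K ^ 7) ^ 4 := pow_le_pow_right₀ hL1 (by norm_num)
  have hε : 80 * (K ^ 7) ^ 3 * R.δ₂ T₁ ≤ 1 / 4 := by
    calc 80 * (K ^ 7) ^ 3 * R.δ₂ T₁ ≤ 80 * (K ^ 7) ^ 4 * θ := by gcongr
      _ ≤ 1 / 4 := by linarith
  have hε0 : 0 ≤ 80 * (K ^ 7) ^ 3 * R.δ₂ T₁ := by positivity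
  have hcos : ∀ t, t₀ ≤ t → 0 < R.c t →
      l2norm (R.E t) ^ 2 ≤ 80 * (K ^ 7) ^ 3 * R.δ₂ T₁ * l2norm R.Y ^ 2 →
      1 - 160 * (K ^ 7) ^ 3 * R.δ₂ T₁ ≤ cosAngle (R.v t) R.Y := by
    intro t ht hct hEt
    rw [← cosAngle_smul_left hct, ← hA.gd.F_eq hA.rankOne ht]
    have := one_sub_le_cosAngle (x := R.F t) hY hε0 hε hEt
    linarith
  refine ⟨?_, hcos t₁ (by omega) hc1 hE1, hcos t₂ (by omega) hc2 (hE.trans hE1)⟩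
  have hweighted := hA.data.sum_weighted_le hA.spectral hK hγ T₁
  have hcorr := hSh.corr_last_le hV hTN (δ₂ := R.δ₂ T₁) (ζ := θ) (le_max_left _ _)
    (hy ▸ R.δ₁_le_δ₂_sq T₁) (hδ₂.trans hθ1) hθ0.le (hweighted.trans hP.weighted)
  rw [hA.spectral.corr_modes, e1, div_le_iff₀ hY2] at hcorr
  have hMθ : (R.modes T₁).M ≤ θ := by
    have h1 : K ^ 7 * R.η ≤ 1 := by
      have h2 : K ^ 7 ≤ (K ^ 7) ^ 4 := le_self_pow₀ hL1 (by norm_num)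
      have h3 : K ^ 7 * R.η ≤ (K ^ 7) ^ 4 * θ := by gcongr
      linarith
    calc (R.modes T₁).M ≤ K ^ 7 * R.η ^ 2 := hV.M_le
      _ = K ^ 7 * R.η * R.η := by ring
      _ ≤ 1 * R.η := by gcongr
      _ ≤ θ := by linarith
  have hsmall : R.E t₁ ⬝ᵥ R.F t₁ ≤ c₂ / 8 * R.δ₂ T₁ * l2norm R.Y ^ 2 := by
    refine hcorr.trans ?_
    gcongr
    -- The three small quantities are each at most θ, whence 24000 = 8·3·1000 in the condition on θ.
    calc 1000 * (K ^ 7) ^ 4 * (R.δ₂ T₁ + θ + (R.modes T₁).M)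
        ≤ 1000 * (K ^ 7) ^ 4 * (θ + θ + θ) := by gcongr
      _ ≤ c₂ / 8 := by linarith
  have hF1 := R.l2norm_F_sq t₁
  have hF2 := R.l2norm_F_sq t₂
  have hEF1 : 0 < R.E t₁ ⬝ᵥ R.F t₁ := hS.2.2.2.2.2
  have hIV2 := hIV t₂ hT₃ le_rfl
  set A := l2norm (R.F t₁) ^ 2 with hAdef
  set B := l2norm (R.F t₂) ^ 2
  set δ := R.δ₂ T₁
  set y := l2norm R.Y ^ 2
  have hA34 : 3 / 4 * y ≤ A := by
    have : 80 * (K ^ 7) ^ 3 * δ * y ≤ 1 / 4 * y := by gcongr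
    linarith
  -- Both ⟨E,F⟩ > 0 at t₂ and the assumed decrease of the loss enter here; only 2⟨E,F⟩ at t₁ is
  -- lost.
  have hB : A - c₂ / 4 * δ * y < B := by linarith [hIV2.2]
  have hcδ : c₂ * δ ≤ 1 := (mul_le_mul_of_nonneg_left hδ₂ hc₂.le).trans hcθ
  have hcδ0 : 0 ≤ c₂ * δ := by positivity
  have hAB : A < B * (1 + c₂ * δ) := by
    have h1 : (A - c₂ / 4 * δ * y) * (1 + c₂ * δ) < B * (1 + c₂ * δ) :=
      mul_lt_mul_of_pos_right hB (by linarith)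
    have h2 : A ≤ (A - c₂ / 4 * δ * y) * (1 + c₂ * δ) := by
      have h3 : c₂ * δ * (3 / 4 * y) ≤ c₂ * δ * A := by gcongr
      have h4 : c₂ * δ * y * (c₂ * δ) ≤ c₂ * δ * y * 1 := by gcongr
      linarith [mul_nonneg hcδ0 hY2.le]
    linarith
  have hs1 : (2 + c₂ * δ) / R.η ≤ R.sharpness t₁ := by
    rw [excess] at hexc
    calc (2 + c₂ * δ) / R.η = 2 / R.η + c₂ * (δ / R.η) := by ring
      _ ≤ _ := by linarith
  have hs2 : R.sharpness t₂ < 2 / R.η := hIV2.1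
  have hs20 : 0 < R.sharpness t₂ := by rw [sharpness]; positivity
  have hA0 : 0 < A := by linarith
  have hB0 : 0 < B := by
    by_contra hneg
    have := mul_nonpos_of_nonpos_of_nonneg (not_lt.1 hneg) (by linarith : 0 ≤ 1 + c₂ * δ)
    linarith
  -- The squared sharpness is proportional to c⁴. It gains the factor (1 + c₂δ/2)² ≥ 1 + c₂δ at t₁,
  -- which outweighs the loss in ‖F‖².
  have hkey : A * R.sharpness t₂ ^ 2 < B * R.sharpness t₁ ^ 2 := by
    have h1 : R.sharpness t₂ ^ 2 ≤ (2 / R.η) ^ 2 := pow_le_pow_left₀ hs20.le hs2.le 2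
    have h2 : ((2 + c₂ * δ) / R.η) ^ 2 ≤ R.sharpness t₁ ^ 2 :=
      pow_le_pow_left₀ (by positivity) hs1 2
    calc A * R.sharpness t₂ ^ 2 ≤ A * (2 / R.η) ^ 2 := by gcongr
      _ < B * (1 + c₂ * δ) * (2 / R.η) ^ 2 := mul_lt_mul_of_pos_right hAB (by positivity)
      _ = B * ((4 + 4 * (c₂ * δ)) / R.η ^ 2) := by ring
      _ ≤ B * ((2 + c₂ * δ) ^ 2 / R.η ^ 2) := by
        gcongr
        nlinarith
      _ = B * ((2 + c₂ * δ) / R.η) ^ 2 := by rw [div_pow]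
      _ ≤ B * R.sharpness t₁ ^ 2 := by gcongr
  rw [hA.α_eq (by omega) hc1.ne', hA.α_eq (by omega) hc2.ne',
    div_lt_div_iff₀ (by positivity) (by positivity)]
  have hk : 0 < (R.lam 0 / n) ^ 2 := by positivity
  refine lt_of_mul_lt_mul_right ?_ hk.le
  calc A * (R.c t₂ ^ 2) ^ 2 * (R.lam 0 / n) ^ 2 = A * R.sharpness t₂ ^ 2 := by
        rw [sharpness]; ring
    _ < B * R.sharpness t₁ ^ 2 := hkey
    _ = B * (R.c t₁ ^ 2) ^ 2 * (R.lam 0 / n) ^ 2 := by rw [sharpness]; ring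

end Run

/-! ### Choice of the constants. -/

theorem mainTheorem1 (a γ K : ℝ) (ha₀ : 0 < a) (ha₁ : a < 1) (hγ : 1 < γ) (hK : 1 ≤ K) :
    (∀ c₁ : ℝ, 0 < c₁ → ∃ C : ℝ, 0 < C ∧
      ∀ ρ : ℕ → ℝ, Tendsto ρ atTop (𝓝 0) → ∃ N : ℕ, ∀ n : ℕ, N ≤ n → ∀ [NeZero n],
      ∀ (d h : ℕ) (R : Run n d h) (t₀ T₁ t₁ t : ℕ),
        R.Assumptions a γ K (ρ n) t₀ T₁ →
        R.StartsPhaseIII t₀ T₁ t₁ →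
        R.InPhaseIII t₁ t →
        c₁ * (R.δ₂ T₁ * l2norm R.Y) ≤ |R.E t ⬝ᵥ R.q 0| →
        C * max 1 (1 / (R.η * (n : ℝ) ^ (a / 4))) < R.excess t →
        R.c (t + 1) ^ 2 < R.c t ^ 2 ∧ l2norm (R.v t) ^ 2 < l2norm (R.v (t + 1)) ^ 2) ∧
    (∃ C : ℝ, 0 < C ∧ ∀ c₂ : ℝ, 0 < c₂ →
      ∀ ρ : ℕ → ℝ, Tendsto ρ atTop (𝓝 0) → ∃ N : ℕ, ∀ n : ℕ, N ≤ n → ∀ [NeZero n],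
      ∀ (d h : ℕ) (R : Run n d h) (t₀ T₁ t₁ t₂ : ℕ),
        R.Assumptions a γ K (ρ n) t₀ T₁ →
        -- the sign of the unit vector `u` is chosen so that `c` is positive at the end of Phase I
        0 < R.c T₁ →
        R.StartsPhaseIII t₀ T₁ t₁ →
        R.InPhaseIV t₁ t₂ →
        l2norm (R.E t₂) ^ 2 ≤ l2norm (R.E t₁) ^ 2 →
        c₂ * (R.δ₂ T₁ / R.η) ≤ R.excess t₁ →
        R.α t₁ < R.α t₂ ∧
          1 - C * R.δ₂ T₁ ≤ cosAngle (R.v t₁) R.Y ∧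
          1 - C * R.δ₂ T₁ ≤ cosAngle (R.v t₂) R.Y) := by
  have hK0 : 0 < K := by linarith
  have hL : 0 < K ^ 7 := by positivity
  refine ⟨fun c₁ hc₁ => ⟨1 + (2 * K ^ 7 / c₁ + 1680 * (K ^ 7) ^ 4 / c₁ ^ 2), by positivity,
    fun ρ hρ => ?_⟩, 160 * (K ^ 7) ^ 3, by positivity, fun c₂ hc₂ ρ hρ => ?_⟩
  · have hθ0 : 0 < 1 / (100 * (K ^ 7) ^ 4) := by positivity
    obtain ⟨N, hN⟩ := Run.exists_smallParams (γ := γ) (K := K) ha₀ ha₁ hθ0 hρ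
    refine ⟨N, fun n hn _ d h R t₀ T₁ t₁ t hA hS hIII hx hexc => ?_⟩
    exact hA.layers_move hK hS hIII hθ0 (by rw [mul_one_div_cancel (by positivity)]) (hN n hn) hc₁
      (le_add_of_nonneg_right (by positivity)) (by linarith) hx hexc
  -- With this s one has 1/s ≤ 1, 1/s ≤ c₂ and c₂/s ≤ 1, which yields all conditions on θ. Only N
  -- depends on c₂; C does not.
  · set s := 1 + c₂ + 1 / c₂ with hs
    have hi : 0 < 1 / c₂ := by positivity
    have hs0 : 0 < s := by positivity
    set θ := 1 / (24000 * (K ^ 7) ^ 4 * s) with hθ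
    have hθ0 : 0 < θ := by positivity
    have hθs : 24000 * (K ^ 7) ^ 4 * θ = 1 / s := by rw [hθ]; field_simp
    have hs1 : 1 / s ≤ 1 := (div_le_one hs0).2 (by linarith)
    have hsc : 1 / s ≤ c₂ := by
      rw [div_le_iff₀ hs0, hs]
      have : c₂ * (1 / c₂) = 1 := by field_simp
      nlinarith
    have hL4 : 1 ≤ (K ^ 7) ^ 4 := one_le_pow₀ (one_le_pow₀ hK)
    have hcs : c₂ * θ ≤ 1 := by
      have h1 : θ ≤ 1 / s := by rw [← hθs]; nlinarith
      have h2 : c₂ * (1 / s) ≤ 1 := by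
        rw [mul_one_div, div_le_one hs0]; linarith
      exact (mul_le_mul_of_nonneg_left h1 hc₂.le).trans h2
    obtain ⟨N, hN⟩ := Run.exists_smallParams (γ := γ) (K := K) ha₀ ha₁ hθ0 hρ
    refine ⟨N, fun n hn _ d h R t₀ T₁ t₁ t₂ hA hc hS hIV hE hexc => ?_⟩
    exact hA.α_increases hK hγ hS hIV hθ0 (by linarith) (hN n hn) hc₂ (by linarith) hcs hc hE hexc
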